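/- All graphs are finite and simple, and $v(G)$, $e(G)$ denote the numbers of vertices and edges of $G$. Subgraphs are not necessarily induced. Write $d(G)=e(G)/v(G)$ if $v(G)\ge 1$ and $d(G)=0$ otherwise; $d_1(G)=e(G)/(v(G)-1)$ if $v(G)\ge 2$ and $d_1(G)=0$ otherwise; $d_2(G)=(e(G)-1)/(v(G)-2)$ if $G$ has an edge and $v(G)\ge 3$, $d_2(G)=1/2$ if $G\cong K_2$, and $d_2(G)=0$ otherwise. Let $m(G)$, $ar(G)$ and $m_2(G)$ be the maxima over all subgraphs $J\subseteq G$ of $d(J)$, $d_1(J)$ and $d_2(J)$, respectively. For graphs $H_1,H_2$ with $m_2(H_1)\ge m_2(H_2)$ put $$d_2(H_1,H_2)=\frac{e(H_1)}{v(H_1)-2+1/m_2(H_2)}$$ if $H_2$ has an edge and $v(H_1)\ge 2$, and $d_2(H_1,H_2)=0$ otherwise; let $m_2(H_1,H_2)=\max\{d_2(J,H_2):J\subseteq H_1\}$. A graph $G$ is strictly $2$-balanced if $d_2(J)<m_2(G)$ for every proper subgraph $J\subsetneq G$, and $H_1$ is strictly balanced with respect to $d_2(\cdot,H_2)$ if $d_2(J,H_2)<m_2(H_1,H_2)$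 for every proper subgraph $J\subsetneq H_1$. A pair $(H_1,H_2)$ with $m_2(H_1)\ge m_2(H_2)$ is a heart if $H_2$ is strictly $2$-balanced and $H_1$ is strictly $2$-balanced when $m_2(H_1)=m_2(H_2)$, and strictly balanced with respect to $d_2(\cdot,H_2)$ when $m_2(H_1)>m_2(H_2)$. A heart of $(H_1,H_2)$ is a heart $(H_1',H_2')$ with $H_1'\subseteq H_1$, $H_2'\subseteq H_2$, $m_2(H_2')=m_2(H_2)$, and $m_2(H_1',H_2')=m_2(H_1,H_2)$ if $m_2(H_1)>m_2(H_2)$, while $m_2(H_1')=m_2(H_1)$ if $m_2(H_1)=m_2(H_2)$. Write $G\to(H_1,\dots,H_r)$ if for every colouring of the edges of $G$ with colours $1,\dots,r$ there is an $i$ such that $G$ contains a copy of $H_i$ all of whose edges have colour $i$. Let $G_{n,p}$ be the binomial random graph on $n$ vertices with edge probability $p$. **Theorem.** Let $r\ge 2$ and let $H_1,\dots,H_r$ be graphs, each with at least one edge, such that $m_2(H_1)\ge m_2(H_2)\ge\dots\ge m_2(H_r)$ and $m_2(H_2)>1$. Suppose that (i) $m_2(H_1)=m_2(H_2)$, or that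 for some heart $(H_1',H_2')$ of $(H_1,H_2)$ at least one of the following holds: (ii) $\chi(H_2')\ge 3$; (iii) $m(H_2')>2$; (iv) $ar(H_2')>2$; (v) $H_1'\cong K_a$ for some $a\ge 3$; (vi) $H_1'\cong K_{a,b}$ for some $a,b\ge 3$; (vii) there exists $\ell\in\mathbb N$ such that $\ell<ar(H_1')$ and $m_2(H_1,H_2)\le \ell+\tfrac12$; (viii) there exists $\ell\in\mathbb N$ such that $\ell<m(H_1')$ and $m_2(H_1,H_2)\le \ell+1$, and $H_2'$ is not a cycle. Then there exists a constant $b>0$ such that, for every $p=p(n)\in[0,1]$ with $p\le b\,n^{-1/m_2(H_1,H_2)}$ for all sufficiently large $n$, $$\lim_{n\to\infty}\mathbb P\big[G_{n,p}\to(H_1,\dots,H_r)\big]=0 .$$ -/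

import Mathlib

open Filter Topology

namespace KohayakawaKreuter

noncomputable section

universe u v w

/-- The number of vertices of a (finite) graph. -/
def vert {V : Type u} (_ : SimpleGraph V) : ℕ := Nat.card V

/-- The number of edges of a (finite) graph. -/
def edge {V : Type u} (G : SimpleGraph V) : ℕ := G.edgeSet.ncard

/-- The density `d(G) = e(G) / v(G)`, and `0` for the graph without vertices. -/
def density {V : Type u} (G : SimpleGraph V) : ℝ :=
  if 1 ≤ vert G then (edge G : ℝ) / (vert G : ℝ) else 0

/-- The `m`-density `m(G)`: the maximum of `d(J)` over all (not necessarily induced) subgraphs `J`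
of the finite graph `G`. The supremum is over a finite non-empty family. -/
def mDensity {V : Type u} (G : SimpleGraph V) : ℝ := ⨆ J : G.Subgraph, density J.coe

/-- `d₁(G) = e(G) / (v(G) - 1)` if `v(G) ≥ 2`, and `0` otherwise. -/
def d1 {V : Type u} (G : SimpleGraph V) : ℝ :=
  if 2 ≤ vert G then (edge G : ℝ) / ((vert G : ℝ) - 1) else 0

/-- The arboricity (1-density) `ar(G)`: the maximum of `d₁(J)` over all subgraphs `J` of `G`. -/
def ar {V : Type u} (G : SimpleGraph V) : ℝ := ⨆ J : G.Subgraph, d1 J.coe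

open Classical in
/-- `d₂(G) = (e(G) - 1) / (v(G) - 2)` if `G` has an edge and at least three vertices,
`1 / 2` if `G` is a single edge `K₂`, and `0` otherwise. -/
def d2 {V : Type u} (G : SimpleGraph V) : ℝ :=
  if G ≠ ⊥ ∧ 3 ≤ vert G then ((edge G : ℝ) - 1) / ((vert G : ℝ) - 2)
  else if Nonempty (G ≃g (⊤ : SimpleGraph (Fin 2))) then 1 / 2
  else 0

/-- The 2-density `m₂(G)`: the maximum of `d₂(J)` over all subgraphs `J` of `G`. -/
def m2 {V : Type u} (G : SimpleGraph V) : ℝ := ⨆ J : G.Subgraph, d2 J.coe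

/-- `G` is strictly 2-balanced: `d₂(J) < m₂(G)` for every proper subgraph `J` of `G`. -/
def StrictlyTwoBalanced {V : Type u} (G : SimpleGraph V) : Prop :=
  ∀ J : G.Subgraph, J ≠ ⊤ → d2 J.coe < m2 G

open Classical in
/-- `d₂(H₁, H₂) = e(H₁) / (v(H₁) - 2 + 1 / m₂(H₂))` if `H₂` has an edge and `v(H₁) ≥ 2`,
and `0` otherwise. -/
def d2Pair {V : Type u} {W : Type v} (H₁ : SimpleGraph V) (H₂ : SimpleGraph W) : ℝ :=
  if H₂ ≠ ⊥ ∧ 2 ≤ vert H₁ then (edge H₁ : ℝ) / ((vert H₁ : ℝ) - 2 + 1 / m2 H₂) else 0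

/-- The asymmetric 2-density `m₂(H₁, H₂)`: the maximum of `d₂(J, H₂)` over all subgraphs `J`
of `H₁`. -/
def m2Pair {V : Type u} {W : Type v} (H₁ : SimpleGraph V) (H₂ : SimpleGraph W) : ℝ :=
  ⨆ J : H₁.Subgraph, d2Pair J.coe H₂

/-- `H₁` is strictly balanced with respect to `d₂(·, H₂)`. -/
def StrictlyBalancedWrt {V : Type u} {W : Type v} (H₁ : SimpleGraph V) (H₂ : SimpleGraph W) :
    Prop :=
  ∀ J : H₁.Subgraph, J ≠ ⊤ → d2Pair J.coe H₂ < m2Pair H₁ H₂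

/-- The pair `(H₁, H₂)` is a heart. -/
structure IsHeart {V : Type u} {W : Type v} (H₁ : SimpleGraph V) (H₂ : SimpleGraph W) :
    Prop where
  le : m2 H₂ ≤ m2 H₁
  right : StrictlyTwoBalanced H₂
  left_of_eq : m2 H₁ = m2 H₂ → StrictlyTwoBalanced H₁
  left_of_gt : m2 H₂ < m2 H₁ → StrictlyBalancedWrt H₁ H₂

/-- The pair of subgraphs `(H₁', H₂')`, `H₁' ⊆ H₁` and `H₂' ⊆ H₂`, is a heart of `(H₁, H₂)`. -/
structure IsHeartOf {V : Type u} {W : Type v} {H₁ : SimpleGraph V} {H₂ : SimpleGraph W}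
    (H₁' : H₁.Subgraph) (H₂' : H₂.Subgraph) : Prop where
  heart : IsHeart H₁'.coe H₂'.coe
  right : m2 H₂'.coe = m2 H₂
  left_of_gt : m2 H₂ < m2 H₁ → m2Pair H₁'.coe H₂'.coe = m2Pair H₁ H₂
  left_of_eq : m2 H₁ = m2 H₂ → m2 H₁'.coe = m2 H₁

/-- `G → (H₁, …, H_r)`: every colouring of the edges of `G` with `r` colours has, for some
colour `i`, a copy of `H_i` all of whose edges have colour `i`. -/
def Arrows {W : Type w} (G : SimpleGraph W) {r : ℕ} {V : Fin r → Type u}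
    (H : ∀ i : Fin r, SimpleGraph (V i)) : Prop :=
  ∀ C : G.EdgeLabeling (Fin r), ∃ i : Fin r, (H i).IsContained (C.labelGraph i)

end

end KohayakawaKreuter

open KohayakawaKreuter

/-! Write m for m₂(H₁, H₂) and μ for m₂(H₂). At edge probability at most b n^(-1/m), a set J of
edges has in expectation at most n^w b^(e(J)) copies, where w = v(J) - e(J)/m is its `weight`.
Colours other than the first two can be left unused, so G → (H₁, …, H_r) means that no red-blue
colouring avoids red copies of the first heart and blue copies of the second. A minimal unavoidable
family of copies (`IsCritical`) is extracted; in it each edge of a copy is the only edge shared with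
some copy of the other colour. Let E be the union of the family. Two facts about E are combined.

Deterministic part: E contains some J with e(J) > m v(J) (`IsCritical.exists_dense_of_twoBalanced`,
`IsCritical.exists_dense_of_pairBalanced`). If all subsets of E were sparse, either E could be
coloured after all, by decomposing it into forests, pseudoforests, or degenerate and bipartite
parts, or the degrees forced by the red and blue copies at each edge would exceed the average
degree. Conditions (i)-(viii) are used only here. As m is rational, such a J has weight at most -gap
for a fixed gap > 0.

Probabilistic part: E may be large, so it is explored from a single edge by attaching copies one
after another. A red copy has weight 2 - 1/μ at density m, so it acts like an edge of cost 1/μ. A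
blue copy whose edges all carry red copies therefore behaves like H₂ at density μ, and attaching it
at an edge does not raise the weight. By strict balancedness a step either loses at least a fixed ε
of weight or is attached only at the current edge (`IsCritical.exists_isExtension`). Steps of the
second kind have boundedly many shapes. Steps of the first kind have polynomially many in the size
reached, but a bounded number of them makes the weight very negative.

The exploration stops after D losses, or at K ≈ c log n edges, or when it has found all of E, hence
J (`IsCritical.hasOutcome`). Each of these outcomes has expected number at most n^(-gap); in the
second case this comes from the factor b^K with b small. There are only O(n^(gap/2)) abstract
outcomes, so a union bound finishes the proof (`exists_threshold`). -/

namespace KohayakawaKreuter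

open Finset

/-! ### Edge sets, their covers and weights -/

section EdgeSets

variable {V : Type*} [DecidableEq V]

/-- The set of vertices covered by a set of edges. -/
def cover (J : Finset (Sym2 V)) : Finset V := J.biUnion Sym2.toFinset

lemma mem_cover {J : Finset (Sym2 V)} {x : V} : x ∈ cover J ↔ ∃ e ∈ J, x ∈ e := by
  simp [cover]

lemma cover_mono {J K : Finset (Sym2 V)} (h : J ⊆ K) : cover J ⊆ cover K :=
  biUnion_subset_biUnion_of_subset_left _ h

lemma cover_union (J K : Finset (Sym2 V)) : cover (J ∪ K) = cover J ∪ cover K := by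
  ext x; simp only [mem_cover, mem_union]; grind

lemma cover_inter_subset (J K : Finset (Sym2 V)) : cover (J ∩ K) ⊆ cover J ∩ cover K :=
  subset_inter (cover_mono inter_subset_left) (cover_mono inter_subset_right)

lemma toFinset_subset_cover {J : Finset (Sym2 V)} {e : Sym2 V} (he : e ∈ J) :
    e.toFinset ⊆ cover J := subset_biUnion_of_mem Sym2.toFinset he

@[simp] lemma cover_empty : cover (∅ : Finset (Sym2 V)) = ∅ := rfl

@[simp] lemma cover_singleton (e : Sym2 V) : cover {e} = e.toFinset := by simp [cover]

lemma cover_image {W : Type*} [DecidableEq W] (f : V → W) (J : Finset (Sym2 V)) :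
    cover (J.image (Sym2.map f)) = (cover J).image f := by
  ext x
  simp only [mem_cover, mem_image, exists_exists_and_eq_and, Sym2.mem_map]
  grind

lemma card_toFinset_le_two (e : Sym2 V) : #e.toFinset ≤ 2 := by
  rw [Sym2.card_toFinset]; split_ifs <;> omega

lemma card_cover_le (J : Finset (Sym2 V)) : #(cover J) ≤ 2 * #J := by
  rw [mul_comm]
  exact card_biUnion_le_card_mul _ _ _ fun e _ => card_toFinset_le_two e

lemma two_le_card_cover {J : Finset (Sym2 V)} (hJ : ∀ e ∈ J, ¬ e.IsDiag) (hne : J.Nonempty) :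
    2 ≤ #(cover J) := by
  obtain ⟨e, he⟩ := hne
  rw [← Sym2.card_toFinset_of_not_isDiag e (hJ e he)]
  exact card_le_card (toFinset_subset_cover he)

lemma eq_of_toFinset_subset {e f : Sym2 V} (he : ¬ e.IsDiag)
    (hef : e.toFinset ⊆ f.toFinset) : e = f := by
  induction e with | _ a b
  induction f with | _ c d
  simp only [Sym2.mk_isDiag_iff] at he
  have ha : a ∈ s(c, d) := by rw [← Sym2.mem_toFinset]; exact hef (by simp)
  have hb : b ∈ s(c, d) := by rw [← Sym2.mem_toFinset]; exact hef (by simp)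
  exact ((Sym2.mem_and_mem_iff he).1 ⟨ha, hb⟩).symm

lemma card_eq_one_of_card_cover_le_two {J : Finset (Sym2 V)} (hJ : ∀ e ∈ J, ¬ e.IsDiag)
    (hne : J.Nonempty) (h : #(cover J) ≤ 2) : #J = 1 := by
  obtain ⟨e, he⟩ := hne
  have hc : e.toFinset = cover J := eq_of_subset_of_card_le (toFinset_subset_cover he)
    (by rw [Sym2.card_toFinset_of_not_isDiag e (hJ e he)]; exact h)
  rw [card_eq_one]
  refine ⟨e, eq_singleton_iff_unique_mem.2 ⟨he, fun f hf => ?_⟩⟩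
  exact eq_of_toFinset_subset (hJ f hf) (hc ▸ toFinset_subset_cover hf)

/-- The weight `v(J) - e(J) / m` of an edge set: the order of magnitude of the expected number of
copies of `J` at density `n ^ (-1 / m)` is `n` to this power. -/
noncomputable def weight (m : ℝ) (J : Finset (Sym2 V)) : ℝ := (#(cover J) : ℝ) - #J / m

lemma injOn_sym2Map {W : Type*} {f : V → W} {J : Finset (Sym2 V)}
    (hf : Set.InjOn f (cover J)) : Set.InjOn (Sym2.map f) (J : Set (Sym2 V)) := by
  intro e he e' he' h
  induction e with | _ a b
  induction e' with | _ c d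
  have hm : ∀ {e : Sym2 V} {x}, e ∈ J → x ∈ e → x ∈ (cover J : Set V) :=
    fun he hx => mem_coe.2 (mem_cover.2 ⟨_, he, hx⟩)
  have ha := hm he (Sym2.mem_mk_left a b)
  have hb := hm he (Sym2.mem_mk_right a b)
  have hc := hm he' (Sym2.mem_mk_left c d)
  have hd := hm he' (Sym2.mem_mk_right c d)
  simp only [Sym2.map_mk, Sym2.eq_iff] at h ⊢
  rcases h with ⟨h1, h2⟩ | ⟨h1, h2⟩
  · exact .inl ⟨hf ha hc h1, hf hb hd h2⟩
  · exact .inr ⟨hf ha hd h1, hf hb hc h2⟩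

lemma weight_image {W : Type*} [DecidableEq W] {f : V → W} {J : Finset (Sym2 V)}
    (hf : Set.InjOn f (cover J)) (m : ℝ) : weight m (J.image (Sym2.map f)) = weight m J := by
  rw [weight, weight, cover_image, card_image_of_injOn hf, card_image_of_injOn (injOn_sym2Map hf)]

/-- Inclusion-exclusion is exact for edges. The two covers may also share vertices that lie on no
common edge, which only lowers the weight of the union. -/
lemma weight_union_le {m : ℝ} (G F : Finset (Sym2 V)) :
    weight m (G ∪ F) ≤ weight m G + weight m F - weight m (G ∩ F) := by
  have h1 : (#(G ∪ F) : ℝ) + #(G ∩ F) = #G + #F := by exact_mod_cast card_union_add_card_inter G F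
  have h2 : (#(cover G ∪ cover F) : ℝ) + #(cover G ∩ cover F) = #(cover G) + #(cover F) := by
    exact_mod_cast card_union_add_card_inter _ _
  have h3 : (#(cover (G ∩ F)) : ℝ) ≤ #(cover G ∩ cover F) := by
    exact_mod_cast card_le_card (cover_inter_subset G F)
  have h4 : (#(G ∪ F) : ℝ) / m + #(G ∩ F) / m = #G / m + #F / m := by
    rw [← add_div, h1, add_div]
  rw [weight, weight, weight, weight, cover_union]
  linarith

end EdgeSets

/-! ### Minimal non-colourable families -/

section Critical

variable {V : Type*}

/-- A family of edge sets tagged by colours (`true` for red, `false` for blue) is colourable if the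
edges can be coloured red and blue so that no red-tagged set is red and no blue-tagged set is
blue. -/
def Colourable (fam : Finset (Bool × Finset (Sym2 V))) : Prop :=
  ∃ R : Finset (Sym2 V), ∀ F, ((true, F) ∈ fam → ¬ F ⊆ R) ∧ ((false, F) ∈ fam → ¬ Disjoint F R)

/-- A minimal non-colourable family. -/
structure IsCritical (fam : Finset (Bool × Finset (Sym2 V))) : Prop where
  not_colourable : ¬ Colourable fam
  colourable_of_ssubset : ∀ fam', fam' ⊂ fam → Colourable fam'

lemma exists_isCritical {fam : Finset (Bool × Finset (Sym2 V))} (h : ¬ Colourable fam) :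
    ∃ fam' ⊆ fam, IsCritical fam' := by
  induction fam using Finset.strongInduction with
  | H fam ih =>
    by_cases hc : ∀ fam', fam' ⊂ fam → Colourable fam'
    · exact ⟨fam, Subset.rfl, h, hc⟩
    · push Not at hc
      obtain ⟨fam', hs, hn⟩ := hc
      obtain ⟨f, hf, hcr⟩ := ih fam' hs hn
      exact ⟨f, hf.trans hs.1, hcr⟩

variable [DecidableEq V]

/-- The set of all edges of the members of a tagged family. -/
def edges (fam : Finset (Bool × Finset (Sym2 V))) : Finset (Sym2 V) := fam.biUnion Prod.snd

lemma mem_edges {fam : Finset (Bool × Finset (Sym2 V))} {e : Sym2 V} :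
    e ∈ edges fam ↔ ∃ c F, (c, F) ∈ fam ∧ e ∈ F := by
  simp [edges]

lemma subset_edges {fam : Finset (Bool × Finset (Sym2 V))} {c : Bool} {F : Finset (Sym2 V)}
    (h : (c, F) ∈ fam) : F ⊆ edges fam := fun _ he => mem_edges.2 ⟨c, F, h, he⟩

/-- By minimality the family without F has a good colouring, and F must be entirely red in it.
Turning e blue repairs F, so it must spoil some blue-tagged set. That set was fine before, so e was
its only red edge, and it meets F exactly in e. -/
lemma IsCritical.exists_inter_eq_of_red {fam : Finset (Bool × Finset (Sym2 V))}
    (h : IsCritical fam) {F : Finset (Sym2 V)} (hF : (true, F) ∈ fam) {e : Sym2 V} (he : e ∈ F) :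
    ∃ F', (false, F') ∈ fam ∧ F ∩ F' = {e} := by
  obtain ⟨R, hR⟩ := h.colourable_of_ssubset _ (erase_ssubset hF)
  have hFR : F ⊆ R := by
    by_contra hc
    refine h.not_colourable ⟨R, fun K => ⟨fun hK => ?_, fun hK => (hR K).2 (by simp [hK])⟩⟩
    by_cases hKF : K = F
    · rwa [hKF]
    · exact (hR K).1 (by simp [hK, hKF])
  have hnc := h.not_colourable
  simp only [Colourable, not_exists, not_forall] at hnc
  obtain ⟨K, hK⟩ := hnc (R.erase e)
  rw [not_and_or] at hK
  rcases hK with hK | hK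
  · push Not at hK
    exfalso
    by_cases hKF : K = F
    · have := hK.2 (hKF ▸ he); simp at this
    · exact (hR K).1 (by simp [hK, hKF]) (hK.2.trans (erase_subset _ _))
  · push Not at hK
    have hd := (hR K).2 (by simp [hK.1])
    refine ⟨K, hK.1, ?_⟩
    rw [Finset.disjoint_left] at hd
    push Not at hd
    obtain ⟨x, hxK, hxR⟩ := hd
    have key : ∀ y ∈ K, y ∈ R → y = e := by
      intro y hy hyR
      by_contra hne
      exact Finset.disjoint_left.1 hK.2 hy (mem_erase.2 ⟨hne, hyR⟩)
    have hxe := key x hxK hxR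
    subst hxe
    ext y
    simp only [mem_inter, mem_singleton]
    exact ⟨fun hy => key y hy.2 (hFR hy.1), fun hy => hy ▸ ⟨he, hxK⟩⟩

lemma IsCritical.exists_inter_eq_of_blue {fam : Finset (Bool × Finset (Sym2 V))}
    (h : IsCritical fam) {F : Finset (Sym2 V)} (hF : (false, F) ∈ fam) {e : Sym2 V} (he : e ∈ F) :
    ∃ F', (true, F') ∈ fam ∧ F ∩ F' = {e} := by
  obtain ⟨R, hR⟩ := h.colourable_of_ssubset _ (erase_ssubset hF)
  have hFR : Disjoint F R := by
    by_contra hc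
    refine h.not_colourable ⟨R, fun K => ⟨fun hK => (hR K).1 (by simp [hK]), fun hK => ?_⟩⟩
    by_cases hKF : K = F
    · rwa [hKF]
    · exact (hR K).2 (by simp [hK, hKF])
  have hnc := h.not_colourable
  simp only [Colourable, not_exists, not_forall] at hnc
  obtain ⟨K, hK⟩ := hnc (insert e R)
  rw [not_and_or] at hK
  rcases hK with hK | hK
  · push Not at hK
    have hd := (hR K).1 (by simp [hK.1])
    obtain ⟨x, hxK, hxR⟩ := not_subset.1 hd
    have hxe : x = e := (mem_insert.1 (hK.2 hxK)).resolve_right hxR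
    subst hxe
    refine ⟨K, hK.1, ?_⟩
    ext y
    simp only [mem_inter, mem_singleton]
    refine ⟨fun hy => (mem_insert.1 (hK.2 hy.2)).resolve_right
      (Finset.disjoint_left.1 hFR hy.1), fun hy => hy ▸ ⟨he, hxK⟩⟩
  · push Not at hK
    exfalso
    by_cases hKF : K = F
    · exact Finset.disjoint_left.1 hK.2 (hKF ▸ he) (mem_insert_self _ _)
    · exact (hR K).2 (by simp [hK, hKF]) (hK.2.mono_right (subset_insert _ _))

/-- Connectedness: if every member that meets G were contained in G, good colourings of the members
inside G and of the other members could be glued along G. -/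
lemma IsCritical.exists_crossing {fam : Finset (Bool × Finset (Sym2 V))} (h : IsCritical fam)
    {G : Finset (Sym2 V)} (hG : G ⊆ edges fam) (hne : G.Nonempty) (hG' : G ≠ edges fam) :
    ∃ e ∈ G, ∃ c F, (c, F) ∈ fam ∧ e ∈ F ∧ ¬ F ⊆ G := by
  by_contra! hno
  have hsplit : ∀ c F, (c, F) ∈ fam → F ⊆ G ∨ Disjoint F G := by
    intro c F hF
    by_contra! hcon
    obtain ⟨e, heF, heG⟩ := Finset.not_disjoint_iff.1 hcon.2
    exact hcon.1 (hno e heG c F hF heF)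
  obtain ⟨e, he⟩ := hne
  obtain ⟨c, F, hF, heF⟩ := mem_edges.1 (hG he)
  obtain ⟨e', he', heG'⟩ := exists_of_ssubset (hG.ssubset_of_ne hG')
  obtain ⟨c', F', hF', heF'⟩ := mem_edges.1 he'
  obtain ⟨R, hR⟩ := h.colourable_of_ssubset (fam.filter fun x => x.2 ⊆ G)
    (filter_ssubset.2 ⟨_, hF', fun hs => heG' (hs heF')⟩)
  obtain ⟨R', hR'⟩ := h.colourable_of_ssubset (fam.filter fun x => ¬ x.2 ⊆ G)
    (filter_ssubset.2 ⟨_, hF, fun hs => hs (hno e he c F hF heF)⟩)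
  refine h.not_colourable ⟨(R ∩ G) ∪ (R' \ G), fun K => ⟨fun hK hs => ?_, fun hK hs => ?_⟩⟩
  · by_cases hKG : K ⊆ G
    · refine (hR K).1 (by simp [hK, hKG]) fun x hx => ?_
      have := hs hx
      have := hKG hx
      grind
    · have hd := (hsplit _ _ hK).resolve_left hKG
      refine (hR' K).1 (by simp [hK, hKG]) fun x hx => ?_
      have := hs hx
      have := Finset.disjoint_left.1 hd hx
      grind
  · by_cases hKG : K ⊆ G
    · refine (hR K).2 (by simp [hK, hKG]) (Finset.disjoint_left.2 fun x hx hxR => ?_)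
      have := Finset.disjoint_left.1 hs hx
      have := hKG hx
      grind
    · have hd := (hsplit _ _ hK).resolve_left hKG
      refine (hR' K).2 (by simp [hK, hKG]) (Finset.disjoint_left.2 fun x hx hxR => ?_)
      have := Finset.disjoint_left.1 hs hx
      have := Finset.disjoint_left.1 hd hx
      grind

end Critical

end KohayakawaKreuter

namespace KohayakawaKreuter

open Finset

/-! ### Attaching balanced copies without raising the weight -/

section Steps

variable {V : Type*} [DecidableEq V]

/-- The edge set of a strictly 2-balanced graph with 2-density `μ`, in a quantitative form. -/
structure TwoBalanced (μ ε : ℝ) (F : Finset (Sym2 V)) : Prop where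
  loopless : ∀ e ∈ F, ¬ e.IsDiag
  three_le : 3 ≤ #(cover F)
  weight_eq : weight μ F = 2 - 1 / μ
  weight_ge : ∀ J ⊆ F, J ≠ F → 3 ≤ #(cover J) → 2 - 1 / μ + ε ≤ weight μ J

/-- The edge set of a graph with asymmetric density `m` that is strictly balanced with respect to
`d₂(·, H₂)`, where `m₂(H₂) = μ`, in a quantitative form. -/
structure PairBalanced (m μ ε : ℝ) (F : Finset (Sym2 V)) : Prop where
  loopless : ∀ e ∈ F, ¬ e.IsDiag
  weight_eq : weight m F = 2 - 1 / μ
  weight_ge : ∀ J ⊆ F, J ≠ F → J.Nonempty → 2 - 1 / μ + ε ≤ weight m J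

variable {m μ ε : ℝ}

/-- A single edge has weight exactly 2 - 1/μ. This is why `weight_ge` only concerns subsets with at
least three vertices, and why the bound here has no ε. -/
lemma TwoBalanced.le_weight {F : Finset (Sym2 V)} (h : TwoBalanced μ ε F) (hε : 0 < ε)
    {J : Finset (Sym2 V)} (hJ : J ⊆ F) (hne : J.Nonempty) : 2 - 1 / μ ≤ weight μ J := by
  by_cases hJF : J = F
  · rw [hJF, h.weight_eq]
  have hl : ∀ e ∈ J, ¬ e.IsDiag := fun e he => h.loopless e (hJ he)
  by_cases h3 : 3 ≤ #(cover J)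
  · linarith [h.weight_ge J hJ hJF h3]
  · have h1 := card_eq_one_of_card_cover_le_two hl hne (by omega)
    have h2 : (2 : ℝ) ≤ #(cover J) := by exact_mod_cast two_le_card_cover hl hne
    rw [weight, h1]
    push_cast
    linarith

/-- If the common edges cover at least three vertices, strict balancedness gains ε. Otherwise e is
the only common edge, and a third common vertex would gain 1 ≥ ε. Without a gain, only the endpoints
of e are shared. -/
lemma TwoBalanced.attach {F G : Finset (Sym2 V)} (h : TwoBalanced μ ε F) (hε : 0 < ε)
    (hε1 : ε ≤ 1) {e : Sym2 V} (heF : e ∈ F) (heG : e ∈ G) (hFG : ¬ F ⊆ G) :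
    2 - 1 / μ + #(F ∩ G) / μ ≤ #(cover F ∩ cover G) ∧
      (2 - 1 / μ + #(F ∩ G) / μ + ε ≤ #(cover F ∩ cover G) ∨
        cover F ∩ cover G ⊆ e.toFinset) := by
  have hsub : F ∩ G ⊆ F := inter_subset_left
  have hne : (F ∩ G).Nonempty := ⟨e, mem_inter.2 ⟨heF, heG⟩⟩
  have hneq : F ∩ G ≠ F := fun hc => hFG (inter_eq_left.1 hc)
  have hl : ∀ e ∈ F ∩ G, ¬ e.IsDiag := fun e he => h.loopless e (hsub he)
  have hcov : (#(cover (F ∩ G)) : ℝ) ≤ #(cover F ∩ cover G) := by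
    exact_mod_cast card_le_card (cover_inter_subset F G)
  by_cases h3 : 3 ≤ #(cover (F ∩ G))
  · have := h.weight_ge _ hsub hneq h3
    rw [weight] at this
    exact ⟨by linarith, .inl (by linarith)⟩
  · have h1 := card_eq_one_of_card_cover_le_two hl hne (by omega)
    have h2 : (2 : ℝ) ≤ #(cover (F ∩ G)) := by exact_mod_cast two_le_card_cover hl hne
    rw [h1]
    push_cast
    refine ⟨by linarith, ?_⟩
    by_cases h4 : 3 ≤ #(cover F ∩ cover G)
    · left
      have : (3 : ℝ) ≤ #(cover F ∩ cover G) := by exact_mod_cast h4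
      linarith
    · right
      have hsub' : e.toFinset ⊆ cover F ∩ cover G :=
        subset_inter (toFinset_subset_cover heF) (toFinset_subset_cover heG)
      refine (eq_of_subset_of_card_le hsub' ?_).ge
      rw [Sym2.card_toFinset_of_not_isDiag e (h.loopless e heF)]
      omega

/-- `S` extends `G` by at most `C` edges without increasing the weight, and either decreases the
weight by `ε` or is attached to `G` only at the edge `e`. -/
structure IsExtension (m ε : ℝ) (C : ℕ) (G : Finset (Sym2 V)) (e : Sym2 V)
    (S : Finset (Sym2 V)) : Prop where
  ssubset : G ⊂ S
  card_le : #(S \ G) ≤ C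
  weight_le : weight m S ≤ weight m G
  weight_le_or : weight m S ≤ weight m G - ε ∨ cover (S \ G) ∩ cover G ⊆ e.toFinset

lemma ssubset_union_right {α : Type*} [DecidableEq α] {G F : Finset α} (h : ¬ F ⊆ G) :
    G ⊂ G ∪ F :=
  subset_union_left.ssubset_of_ne fun hc => h (union_eq_left.1 hc.symm)

lemma TwoBalanced.isExtension {F G : Finset (Sym2 V)} (h : TwoBalanced μ ε F) (hε : 0 < ε)
    (hε1 : ε ≤ 1) {e : Sym2 V} (heF : e ∈ F) (heG : e ∈ G) (hFG : ¬ F ⊆ G) {C : ℕ}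
    (hC : #F ≤ C) : IsExtension μ ε C G e (G ∪ F) := by
  obtain ⟨ha, hb⟩ := h.attach hε hε1 heF heG hFG
  have h1 : (#(G ∪ F) : ℝ) + #(F ∩ G) = #G + #F := by
    rw [inter_comm]; exact_mod_cast card_union_add_card_inter G F
  have h2 : (#(cover (G ∪ F)) : ℝ) + #(cover F ∩ cover G) = #(cover G) + #(cover F) := by
    rw [inter_comm, cover_union]; exact_mod_cast card_union_add_card_inter _ _
  have h4 : (#(G ∪ F) : ℝ) / μ + #(F ∩ G) / μ = #G / μ + #F / μ := by
    rw [← add_div, h1, add_div]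
  have hw := h.weight_eq
  rw [weight] at hw
  refine ⟨ssubset_union_right hFG, ?_, ?_, ?_⟩
  · rw [union_sdiff_left]
    exact (card_le_card sdiff_subset).trans hC
  · rw [weight, weight]; linarith
  · refine hb.imp (fun hb => ?_) fun hb => ?_
    · rw [weight, weight]; linarith
    · rw [union_sdiff_left]
      exact (inter_subset_inter_right (cover_mono sdiff_subset)).trans hb

/-- The common edges form a nonempty proper subset of F, and in contrast to the 2-balanced case
`weight_ge` also applies to single edges. So ε is always lost, and e is arbitrary. -/
lemma PairBalanced.isExtension {F G : Finset (Sym2 V)} (h : PairBalanced m μ ε F) (hε : 0 < ε)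
    {f : Sym2 V} (e : Sym2 V) (hfF : f ∈ F) (hfG : f ∈ G) (hFG : ¬ F ⊆ G) {C : ℕ}
    (hC : #F ≤ C) : IsExtension m ε C G e (G ∪ F) := by
  have hw := weight_union_le (m := m) G F
  have hi := h.weight_ge (G ∩ F) inter_subset_right (fun hc => hFG (inter_eq_right.1 hc))
    ⟨f, mem_inter.2 ⟨hfG, hfF⟩⟩
  have he := h.weight_eq
  refine ⟨ssubset_union_right hFG, ?_, by linarith, .inl (by linarith)⟩
  rw [union_sdiff_left]
  exact (card_le_card sdiff_subset).trans hC

/-- Groups overlapping red copies. Adding a copy that shares an edge with the union loses at least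
ε, so a largest X with the stated bounds is edge-disjoint from all remaining copies. -/
lemma exists_cluster {A : Finset (Sym2 V)} {φ : Sym2 V → Finset (Sym2 V)}
    (hφ : ∀ f ∈ A, PairBalanced m μ ε (φ f)) (hε : 0 < ε) (hself : ∀ f ∈ A, f ∈ φ f)
    (hother : ∀ f ∈ A, ∀ g ∈ A, f ≠ g → g ∉ φ f) {f : Sym2 V} (hf : f ∈ A) :
    ∃ X ⊆ A, f ∈ X ∧ weight m (X.biUnion φ) ≤ 2 - 1 / μ ∧
      (X ≠ {f} → weight m (X.biUnion φ) ≤ 2 - 1 / μ - ε) ∧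
      ∀ g ∈ A \ X, Disjoint (X.biUnion φ) (φ g) := by
  classical
  let T := A.powerset.filter fun X => f ∈ X ∧ weight m (X.biUnion φ) ≤ 2 - 1 / μ ∧
      (X ≠ {f} → weight m (X.biUnion φ) ≤ 2 - 1 / μ - ε)
  have hT : T.Nonempty := ⟨{f}, by
    simp only [T, mem_filter, mem_powerset, singleton_subset_iff, hf, mem_singleton,
      singleton_biUnion, (hφ f hf).weight_eq, le_refl, ne_eq, not_true_eq_false, false_imp_iff,
      and_self]⟩
  obtain ⟨X, hX, hmax⟩ := exists_max_image T card hT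
  obtain ⟨hXA, hfX, hX1, hX2⟩ : X ⊆ A ∧ f ∈ X ∧ _ ∧ _ := by simpa [T] using hX
  refine ⟨X, hXA, hfX, by simpa using hX1, by simpa using hX2, fun g hg => ?_⟩
  obtain ⟨hgA, hgX⟩ := mem_sdiff.1 hg
  by_contra hd
  have hgQ : ¬ φ g ⊆ X.biUnion φ := fun hc => by
    obtain ⟨k, hk, hgk⟩ := mem_biUnion.1 (hc (hself g hgA))
    exact hother k (hXA hk) g hgA (fun hkg => hgX (hkg ▸ hk)) hgk
  have hi := (hφ g hgA).weight_ge (X.biUnion φ ∩ φ g) inter_subset_right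
    (fun hc => hgQ (inter_eq_right.1 hc)) (not_disjoint_iff_nonempty_inter.1 hd)
  have hw := weight_union_le (m := m) (X.biUnion φ) (φ g)
  have he := (hφ g hgA).weight_eq
  have hX1' : weight m (X.biUnion φ) ≤ 2 - 1 / μ := by simpa using hX1
  have hins : (insert g X).biUnion φ = X.biUnion φ ∪ φ g := by rw [biUnion_insert, union_comm]
  have hmem : insert g X ∈ T := by
    simp only [T, mem_filter, mem_powerset, hins]
    exact ⟨insert_subset hgA hXA, mem_insert_of_mem hfX, by linarith, fun _ => by linarith⟩
  have := hmax _ hmem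
  rw [card_insert_of_notMem hgX] at this
  omega

/-- The exchange of each edge of A, at cost 1/μ, for a whole red copy at density m. Splitting off
one cluster at a time reduces to edge-disjoint unions. The set W collects the vertices already
present, and enters the claim because equality must exclude accidental incidences with it. -/
lemma weight_clusters {F : Finset (Sym2 V)} (hF : TwoBalanced μ ε F) (hε : 0 < ε) (hε1 : ε ≤ 1)
    {φ : Sym2 V → Finset (Sym2 V)} (A : Finset (Sym2 V)) (hAF : A ⊆ F)
    (hφ : ∀ f ∈ A, PairBalanced m μ ε (φ f)) (hself : ∀ f ∈ A, f ∈ φ f)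
    (hother : ∀ f ∈ A, ∀ g ∈ A, f ≠ g → g ∉ φ f) (W : Finset V) (hW : cover A ⊆ W) :
    (#(W ∪ cover (A.biUnion φ)) : ℝ) - #(A.biUnion φ) / m ≤ #W - #A / μ ∧
      ((#(W ∪ cover (A.biUnion φ)) : ℝ) - #(A.biUnion φ) / m ≤ #W - #A / μ - ε ∨
        ∀ f ∈ A, cover (φ f) ∩ W ⊆ f.toFinset) := by
  induction A using Finset.strongInduction generalizing W with
  | H A ih =>
    rcases A.eq_empty_or_nonempty with rfl | ⟨f, hf⟩
    · simp
    obtain ⟨X, hXA, hfX, hX1, hX2, hX3⟩ := exists_cluster hφ hε hself hother hf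
    set Q := X.biUnion φ with hQ
    have hsd : A \ X ⊆ A := sdiff_subset
    obtain ⟨ih1, ih2⟩ := ih (A \ X) (sdiff_ssubset hXA ⟨f, hfX⟩) (hsd.trans hAF)
      (fun g hg => hφ g (hsd hg)) (fun g hg => hself g (hsd hg))
      (fun g hg k hk => hother g (hsd hg) k (hsd hk)) (W ∪ cover Q)
      (((cover_mono hsd).trans hW).trans subset_union_left)
    set Q' := (A \ X).biUnion φ with hQ'
    have hun : A.biUnion φ = Q ∪ Q' := by
      rw [hQ, hQ', ← union_biUnion, union_sdiff_of_subset hXA]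
    have hdis : Disjoint Q Q' := by
      rw [hQ', disjoint_biUnion_right]; exact hX3
    have hcardQ : (#(Q ∪ Q') : ℝ) / m = #Q / m + #Q' / m := by
      rw [card_union_of_disjoint hdis]; push_cast; rw [add_div]
    have hcardA : (#A : ℝ) / μ = #(A \ X) / μ + #X / μ := by
      rw [← add_div]
      congr 1
      exact_mod_cast (card_sdiff_add_card_eq_card hXA).symm
    have hXQ : X ⊆ Q := fun g hg => mem_biUnion.2 ⟨g, hg, hself g (hXA hg)⟩
    have hcX : cover X ⊆ W ∩ cover Q :=
      subset_inter ((cover_mono hXA).trans hW) (cover_mono hXQ)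
    have hcX' : (#(cover X) : ℝ) ≤ #(W ∩ cover Q) := by exact_mod_cast card_le_card hcX
    have hWQ : (#(W ∪ cover Q) : ℝ) + #(W ∩ cover Q) = #W + #(cover Q) := by
      exact_mod_cast card_union_add_card_inter _ _
    -- The cluster adds at most |cover Q| - |cover X| vertices. Since the weight of Q at m is at
    -- most 2 - 1/μ, hence at most that of X at μ, the net change is at most -|X|/μ.
    have hwX := hF.le_weight hε (hXA.trans hAF) ⟨f, hfX⟩
    rw [weight] at hwX hX1 hX2
    rw [hun, cover_union, ← union_assoc, hcardQ, hcardA]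
    refine ⟨by linarith, ?_⟩
    by_cases hXf : X = {f}
    · by_cases hWf : cover (φ f) ∩ W ⊆ f.toFinset
      · refine ih2.imp (fun h => by linarith) fun h g hg => ?_
        by_cases hgf : g = f
        · rwa [hgf]
        · refine Subset.trans (inter_subset_inter_left subset_union_left) (h g ?_)
          rw [hXf]; simp [hg, hgf]
      · left
        have hQf : Q = φ f := by rw [hQ, hXf, singleton_biUnion]
        have hff : f.toFinset ⊂ W ∩ cover Q := by
          rw [hQf, inter_comm]
          refine ssubset_of_subset_not_subset ?_ hWf
          rw [inter_comm, ← hQf]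
          simpa [hXf] using hcX
        have h3 := card_lt_card hff
        rw [Sym2.card_toFinset_of_not_isDiag f (hF.loopless f (hAF hf))] at h3
        have h3' : (3 : ℝ) ≤ #(W ∩ cover Q) := by exact_mod_cast h3
        have hX1c : (#X : ℝ) = 1 := by rw [hXf]; simp
        rw [hX1c]
        linarith
    · left
      have := hX2 hXf
      linarith

/-- The common assumptions on the two kinds of copies in a critical family: either all of them are
2-balanced with the same density, or the blue ones are 2-balanced and the red ones are balanced with
respect to them. -/
def IsBalancedFamily (m μ ε : ℝ) (fam : Finset (Bool × Finset (Sym2 V))) : Prop :=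
  (m = μ ∧ ∀ c F, (c, F) ∈ fam → TwoBalanced μ ε F) ∨
    ((∀ F, (true, F) ∈ fam → PairBalanced m μ ε F) ∧ ∀ F, (false, F) ∈ fam → TwoBalanced μ ε F)

theorem IsCritical.exists_isExtension {fam : Finset (Bool × Finset (Sym2 V))} (h : IsCritical fam)
    (hε : 0 < ε) (hε1 : ε ≤ 1) (hbal : IsBalancedFamily m μ ε fam) {C : ℕ} (hC : 1 ≤ C)
    (hcard : ∀ c F, (c, F) ∈ fam → #F ≤ C) {G : Finset (Sym2 V)} (hG : G ⊆ edges fam)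
    {e : Sym2 V} (he : e ∈ G) {c : Bool} {F : Finset (Sym2 V)} (hF : (c, F) ∈ fam) (heF : e ∈ F)
    (hFG : ¬ F ⊆ G) : ∃ S ⊆ edges fam, IsExtension m ε (C * C) G e S := by
  have hCC : C ≤ C * C := Nat.le_mul_of_pos_right C hC
  rcases hbal with ⟨rfl, hbal⟩ | ⟨hred, hblue⟩
  · exact ⟨G ∪ F, union_subset hG (subset_edges hF),
      (hbal c F hF).isExtension hε hε1 heF he hFG ((hcard _ _ hF).trans hCC)⟩
  cases c with
  | true => exact ⟨G ∪ F, union_subset hG (subset_edges hF),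
      (hred F hF).isExtension hε e heF he hFG ((hcard _ _ hF).trans hCC)⟩
  | false =>
    have hex : ∀ f ∈ F, ∃ F', (true, F') ∈ fam ∧ F ∩ F' = {f} :=
      fun f hf => h.exists_inter_eq_of_blue hF hf
    choose! φ hφ hφF using hex
    have hself : ∀ f ∈ F, f ∈ φ f := fun f hf =>
      (mem_inter.1 ((hφF f hf).symm ▸ mem_singleton_self f)).2
    have hother : ∀ f ∈ F, ∀ g ∈ F, f ≠ g → g ∉ φ f := fun f hf g hg hfg hgf =>
      hfg (mem_singleton.1 ((hφF f hf) ▸ mem_inter.2 ⟨hg, hgf⟩)).symm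
    -- A red copy that shares an edge with G is attached alone and loses ε. If there is none, the
    -- red copies at all edges of F outside G are attached together: at most C copies with at most C
    -- edges each.
    by_cases hmeet : ∃ f ∈ F \ G, ∃ k ∈ φ f, k ∈ G
    · obtain ⟨f, hf, k, hk, hkG⟩ := hmeet
      obtain ⟨hfF, hfG⟩ := mem_sdiff.1 hf
      exact ⟨G ∪ φ f, union_subset hG (subset_edges (hφ f hfF)),
        (hred _ (hφ f hfF)).isExtension hε e hk hkG (fun hc => hfG (hc (hself f hfF)))
          ((hcard _ _ (hφ f hfF)).trans hCC)⟩
    push Not at hmeet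
    set A := F \ G with hA
    have hAF : A ⊆ F := sdiff_subset
    set Q := A.biUnion φ with hQ
    have hAQ : A ⊆ Q := fun f hf => mem_biUnion.2 ⟨f, hf, hself f (hAF hf)⟩
    have hGQ : Disjoint G Q := by
      rw [Finset.disjoint_left]
      intro k hkG hkQ
      obtain ⟨f, hf, hk⟩ := mem_biUnion.1 hkQ
      exact hmeet f hf k hk hkG
    have hsd : (G ∪ Q) \ G = Q := by rw [union_sdiff_left, sdiff_eq_self_of_disjoint hGQ.symm]
    have hAne : ∃ f, f ∈ A := by
      obtain ⟨f, hf, hfG⟩ := not_subset.1 hFG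
      exact ⟨f, mem_sdiff.2 ⟨hf, hfG⟩⟩
    have hbF := hblue F hF
    set W := cover G ∪ cover F with hW
    obtain ⟨h1, h2⟩ := weight_clusters hbF hε hε1 (φ := φ) A hAF
      (fun f hf => hred _ (hφ f (hAF hf))) (fun f hf => hself f (hAF hf))
      (fun f hf g hg => hother f (hAF hf) g (hAF hg)) W
      ((cover_mono hAF).trans subset_union_right)
    obtain ⟨h3, h4⟩ := hbF.attach hε hε1 heF he hFG
    have hWc : (#W : ℝ) + #(cover F ∩ cover G) = #(cover G) + #(cover F) := by
      rw [inter_comm]; exact_mod_cast card_union_add_card_inter _ _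
    have hle : (#(cover (G ∪ Q)) : ℝ) ≤ #(W ∪ cover Q) := by
      rw [cover_union]
      exact_mod_cast card_le_card (union_subset_union_left subset_union_left)
    have hcs : (#(G ∪ Q) : ℝ) / m = #G / m + #Q / m := by
      rw [card_union_of_disjoint hGQ]; push_cast; rw [add_div]
    have hcA : (#A : ℝ) / μ + #(F ∩ G) / μ = #F / μ := by
      rw [← add_div]
      congr 1
      exact_mod_cast card_sdiff_add_card_inter F G
    have hw := hbF.weight_eq
    rw [weight] at hw
    refine ⟨G ∪ Q, union_subset hG (biUnion_subset.2 fun f hf => subset_edges (hφ f (hAF hf))),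
      ?_, ?_, ?_, ?_⟩
    · refine ssubset_union_right fun hc => ?_
      obtain ⟨f, hf⟩ := hAne
      exact (mem_sdiff.1 hf).2 (hc (hAQ hf))
    · rw [hsd]
      refine (card_biUnion_le_card_mul A φ C fun f hf => hcard _ _ (hφ f (hAF hf))).trans ?_
      exact Nat.mul_le_mul_right _ ((card_le_card hAF).trans (hcard _ _ hF))
    · rw [weight, weight, hcs]; linarith
    · rcases h2 with h2 | h2
      · left; rw [weight, weight, hcs]; linarith
      rcases h4 with h4 | h4
      · left; rw [weight, weight, hcs]; linarith
      right
      rw [hsd]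
      intro x hx
      obtain ⟨hxQ, hxG⟩ := mem_inter.1 hx
      obtain ⟨k, hkQ, hxk⟩ := mem_cover.1 hxQ
      obtain ⟨f, hf, hkf⟩ := mem_biUnion.1 hkQ
      have hxf := h2 f hf (mem_inter.2 ⟨mem_cover.2 ⟨k, hkf, hxk⟩, mem_union_left _ hxG⟩)
      exact h4 (mem_inter.2 ⟨toFinset_subset_cover (hAF hf) hxf, hxG⟩)

end Steps

end KohayakawaKreuter

namespace KohayakawaKreuter

open Finset

/-! ### Exploration of a critical family and the number of its states -/

section Exploration

/-- A state of the exploration process on abstract graphs: the list of edges found so far, the number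
of vertices, which are `0, …, v - 1`, and the position of the edge to be processed next. -/
abbrev ExplState := List (ℕ × ℕ) × ℕ × ℕ

/-- The data of an extension by at most `2 * C` new vertices and at most `C` new edges, whose
endpoints carry labels in `Fin U`. -/
abbrev ExtData (C U : ℕ) := Fin (2 * C + 1) × (Fin C → Option (Fin U × Fin U))

/-- Extend a state as prescribed by the data `d`, with labels read off by `ρ`. -/
def extend {C U : ℕ} (ρ : Fin U → ℕ) (s : ExplState) (d : ExtData C U) : ExplState :=
  (s.1 ++ (List.ofFn d.2).reduceOption.map (Prod.map ρ ρ), s.2.1 + d.1, s.2.2)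

/-- The labels of the endpoints of the current edge and of the new vertices. -/
def localLabel (C : ℕ) (s : ExplState) (j : Fin (2 * C + 2)) : ℕ :=
  if (j : ℕ) = 0 then (s.1.getD s.2.2 (0, 0)).1
  else if (j : ℕ) = 1 then (s.1.getD s.2.2 (0, 0)).2 else s.2.1 + (j - 2)

/-- The moves that pass to the next edge or attach something to the current edge only. -/
def localMoves (C : ℕ) (s : ExplState) : Finset ExplState :=
  insert (s.1, s.2.1, s.2.2 + 1)
    (univ.image fun d : ExtData C (2 * C + 2) => extend (localLabel C s) s d)

/-- All moves within the vertex set `0, …, M - 1`. -/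
def globalMoves (C M : ℕ) (s : ExplState) : Finset ExplState :=
  univ.image fun d : ExtData C M => extend Fin.val s d

/-- The states that can be reached by `t` moves of which `d` are global. -/
def reach (C M : ℕ) : ℕ → ℕ → Finset ExplState
  | 0, _ => {([(0, 1)], 2, 0)}
  | t + 1, 0 => (reach C M t 0).biUnion (localMoves C)
  | t + 1, d + 1 => (reach C M t (d + 1)).biUnion (localMoves C) ∪
      (reach C M t d).biUnion (globalMoves C M)

/-- Since the start state is in `reach C M 0 d` for all d, the index d is a budget for global moves.
With a local and P global choices the recursion closes because a P^(d+1) + P^d P = (a + 1) P^(d+1).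
Thus M enters only through the d-th power. -/
lemma card_reach_le (C M t d : ℕ) : #(reach C M t d) ≤
    (Fintype.card (ExtData C (2 * C + 2)) + 2) ^ t * Fintype.card (ExtData C M) ^ d := by
  set a := Fintype.card (ExtData C (2 * C + 2)) + 1 with ha
  have hP : 1 ≤ Fintype.card (ExtData C M) :=
    Fintype.card_pos_iff.2 ⟨(0, fun _ => none)⟩
  set P := Fintype.card (ExtData C M) with hPdef
  have hloc : ∀ s, #(localMoves C s) ≤ a := fun s =>
    (card_insert_le _ _).trans (Nat.succ_le_succ card_image_le)
  have hglob : ∀ s, #(globalMoves C M s) ≤ P := fun s => card_image_le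
  change _ ≤ (a + 1) ^ t * P ^ d
  induction t generalizing d with
  | zero => simpa [reach] using Nat.one_le_pow _ _ hP
  | succ t ih =>
    cases d with
    | zero =>
      calc #(reach C M (t + 1) 0) ≤ #(reach C M t 0) * a :=
            card_biUnion_le_card_mul _ _ _ fun s _ => hloc s
        _ ≤ ((a + 1) ^ t * P ^ 0) * (a + 1) := Nat.mul_le_mul (ih 0) (Nat.le_succ a)
        _ = _ := by ring
    | succ d =>
      calc #(reach C M (t + 1) (d + 1))
          ≤ #(reach C M t (d + 1)) * a + #(reach C M t d) * P :=
            (card_union_le _ _).trans (add_le_add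
              (card_biUnion_le_card_mul _ _ _ fun s _ => hloc s)
              (card_biUnion_le_card_mul _ _ _ fun s _ => hglob s))
        _ ≤ ((a + 1) ^ t * P ^ (d + 1)) * a + ((a + 1) ^ t * P ^ d) * P :=
            add_le_add (Nat.mul_le_mul_right _ (ih _)) (Nat.mul_le_mul_right _ (ih _))
        _ = _ := by ring

lemma length_extend_le {C U : ℕ} (ρ : Fin U → ℕ) (s : ExplState) (d : ExtData C U) :
    (extend ρ s d).1.length ≤ s.1.length + C := by
  have := List.reduceOption_length_le (List.ofFn d.2)
  simp only [List.length_ofFn] at this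
  simp only [extend, List.length_append, List.length_map]
  omega

lemma length_le_of_mem_reach {C M t d : ℕ} {s : ExplState} (hs : s ∈ reach C M t d) :
    s.1.length ≤ 1 + C * t := by
  have hloc : ∀ s s' : ExplState, s' ∈ localMoves C s → s'.1.length ≤ s.1.length + C := by
    intro s s' hs'
    simp only [localMoves, mem_insert, mem_image, mem_univ, true_and] at hs'
    rcases hs' with rfl | ⟨d, rfl⟩
    · simp
    · exact length_extend_le _ _ _
  have hglob : ∀ s s' : ExplState, s' ∈ globalMoves C M s → s'.1.length ≤ s.1.length + C := by
    intro s s' hs'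
    simp only [globalMoves, mem_image, mem_univ, true_and] at hs'
    obtain ⟨d, rfl⟩ := hs'
    exact length_extend_le _ _ _
  induction t generalizing d s with
  | zero => simp [reach] at hs; simp [hs]
  | succ t ih =>
    have key : ∃ d' s', s' ∈ reach C M t d' ∧ s.1.length ≤ s'.1.length + C := by
      cases d with
      | zero =>
        obtain ⟨s', h1, h2⟩ := mem_biUnion.1 hs
        exact ⟨_, s', h1, hloc _ _ h2⟩
      | succ d =>
        rcases mem_union.1 hs with hs | hs
        · obtain ⟨s', h1, h2⟩ := mem_biUnion.1 hs
          exact ⟨_, s', h1, hloc _ _ h2⟩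
        · obtain ⟨s', h1, h2⟩ := mem_biUnion.1 hs
          exact ⟨_, s', h1, hglob _ _ h2⟩
    obtain ⟨d', s', h1, h2⟩ := key
    have := ih h1
    rw [mul_add]
    omega

lemma mem_reach_succ_of_local {C M t d : ℕ} {s s' : ExplState} (hs : s ∈ reach C M t d)
    (h : s' ∈ localMoves C s) : s' ∈ reach C M (t + 1) d := by
  cases d with
  | zero => exact mem_biUnion.2 ⟨s, hs, h⟩
  | succ d => exact mem_union_left _ (mem_biUnion.2 ⟨s, hs, h⟩)

lemma mem_reach_succ_of_global {C M t d : ℕ} {s s' : ExplState} (hs : s ∈ reach C M t d)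
    (h : s' ∈ globalMoves C M s) : s' ∈ reach C M (t + 1) (d + 1) :=
  mem_union_right _ (mem_biUnion.2 ⟨s, hs, h⟩)

lemma exists_extData {C U : ℕ} (ρ : Fin U → ℕ) {L : List (ℕ × ℕ)} (hL : L.length ≤ C)
    (h : ∀ x ∈ L, x.1 ∈ Set.range ρ ∧ x.2 ∈ Set.range ρ) (s : ExplState) {w : ℕ}
    (hw : w ≤ 2 * C) : ∃ d : ExtData C U, extend ρ s d = (s.1 ++ L, s.2.1 + w, s.2.2) := by
  have h1 : ∃ L' : List (Fin U × Fin U), L'.map (Prod.map ρ ρ) = L := by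
    have : L ∈ Set.range (List.map (Prod.map ρ ρ)) := by
      rw [Set.range_list_map]
      intro x hx
      obtain ⟨⟨a, ha⟩, ⟨b, hb⟩⟩ := h x hx
      exact ⟨(a, b), by simp [ha, hb]⟩
    exact this
  obtain ⟨L', rfl⟩ := h1
  rw [List.length_map] at hL
  -- Padding with `none` yields exactly C entries; `reduceOption` removes the padding.
  let o : List (Option (Fin U × Fin U)) := L'.map some ++ List.replicate (C - L'.length) none
  have ho : o.length = C := by simp [o]; omega
  have ho' : List.ofFn (fun j : Fin C => o.get (j.cast ho.symm)) = o := by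
    apply List.ext_get
    · simp [ho]
    · intro n h1 h2; simp
  have hr : o.reduceOption = L' := by
    simp [o, List.reduceOption]
  refine ⟨(⟨w, by omega⟩, fun j => o.get (j.cast ho.symm)), ?_⟩
  simp only [extend, ho', hr]

/-- The edge set of an abstract state. -/
def stateEdges (l : List (ℕ × ℕ)) : Finset (Sym2 ℕ) := (l.map fun x => s(x.1, x.2)).toFinset

lemma mem_stateEdges {l : List (ℕ × ℕ)} {e : Sym2 ℕ} :
    e ∈ stateEdges l ↔ ∃ x ∈ l, s(x.1, x.2) = e := by simp [stateEdges]

lemma card_stateEdges_le (l : List (ℕ × ℕ)) : #(stateEdges l) ≤ l.length :=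
  (List.toFinset_card_le _).trans (by simp)

variable {V : Type*} [DecidableEq V]

/-- The map `ι` realises the abstract state `s` as the edge set `G`. -/
structure Realizes (s : ExplState) (ι : ℕ → V) (G : Finset (Sym2 V)) : Prop where
  injOn : Set.InjOn ι (Set.Iio s.2.1)
  lt : ∀ x ∈ s.1, x.1 < s.2.1 ∧ x.2 < s.2.1
  image_eq : (stateEdges s.1).image (Sym2.map ι) = G
  cover_eq : cover G = (range s.2.1).image ι
  length_eq : s.1.length = #G

lemma Realizes.injOn_cover {s : ExplState} {ι : ℕ → V} {G : Finset (Sym2 V)}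
    (h : Realizes s ι G) : Set.InjOn ι (cover (stateEdges s.1)) := by
  refine h.injOn.mono fun z hz => ?_
  obtain ⟨e, he, hze⟩ := mem_cover.1 (mem_coe.1 hz)
  obtain ⟨x, hx, rfl⟩ := mem_stateEdges.1 he
  rcases Sym2.mem_iff.1 hze with rfl | rfl
  · exact (h.lt x hx).1
  · exact (h.lt x hx).2

/-- The new vertices are labelled consecutively from the old number of vertices on; each lies on a
new edge, so there are at most 2C of them. Old labels keep their images, hence the edges processed
earlier keep their meaning. -/
lemma Realizes.exists_extend {s : ExplState} {ι : ℕ → V} {G S : Finset (Sym2 V)}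
    (h : Realizes s ι G) (hGS : G ⊆ S) {C : ℕ} (hC : #(S \ G) ≤ C) :
    ∃ (w : ℕ) (L : List (ℕ × ℕ)) (ι' : ℕ → V), w ≤ 2 * C ∧ L.length ≤ C ∧
      Realizes (s.1 ++ L, s.2.1 + w, s.2.2) ι' S ∧ (∀ z < s.2.1, ι' z = ι z) ∧
      ∀ x ∈ L, (x.1 < s.2.1 + w ∧ ι' x.1 ∈ cover (S \ G)) ∧
        (x.2 < s.2.1 + w ∧ ι' x.2 ∈ cover (S \ G)) := by
  obtain ⟨l, v, i⟩ := s
  have hinj : Set.InjOn ι (Set.Iio v) := h.injOn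
  have hlt : ∀ x ∈ l, x.1 < v ∧ x.2 < v := h.lt
  have himg : (stateEdges l).image (Sym2.map ι) = G := h.image_eq
  have hcov : cover G = (range v).image ι := h.cover_eq
  have hlen : l.length = #G := h.length_eq
  set N := cover S \ cover G with hN
  have hScov : cover S = cover G ∪ cover (S \ G) := by
    rw [← cover_union, union_sdiff_of_subset hGS]
  have hNc : #N ≤ 2 * C := by
    have : N ⊆ cover (S \ G) := by
      rw [hN, hScov, union_sdiff_left]; exact sdiff_subset
    exact (card_le_card this).trans ((card_cover_le _).trans (by omega))
  let ι' : ℕ → V := fun z => if z < v then ι z else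
    if hz : z - v < #N then N.equivFin.symm ⟨z - v, hz⟩ else ι z
  have hι1 : ∀ z < v, ι' z = ι z := fun z hz => by simp [ι', hz]
  have hι2 : ∀ z, ∀ hz : z < #N, ι' (v + z) = N.equivFin.symm ⟨z, hz⟩ := fun z hz => by
    simp [ι', hz]
  have hmemN : ∀ z, v ≤ z → z < v + #N → ι' z ∈ N := by
    intro z h1 h2
    obtain ⟨k, rfl⟩ := Nat.exists_eq_add_of_le h1
    rw [hι2 k (by omega)]
    exact (N.equivFin.symm _).2
  have hmemG : ∀ z < v, ι' z ∈ cover G := fun z hz => by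
    rw [hι1 z hz, hcov]; exact mem_image_of_mem _ (mem_range.2 hz)
  have hinj' : Set.InjOn ι' (Set.Iio (v + #N)) := by
    intro z hz z' hz' he
    simp only [Set.mem_Iio] at hz hz'
    by_cases h1 : z < v <;> by_cases h2 : z' < v
    · exact hinj h1 h2 (by rwa [hι1 z h1, hι1 z' h2] at he)
    · have := hmemG z h1
      have h4 := hmemN z' (by omega) hz'
      rw [← he] at h4
      exact absurd this (mem_sdiff.1 h4).2
    · have := hmemG z' h2
      have h4 := hmemN z (by omega) hz
      rw [he] at h4
      exact absurd this (mem_sdiff.1 h4).2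
    · obtain ⟨k, rfl⟩ := Nat.exists_eq_add_of_le (not_lt.1 h1)
      obtain ⟨k', rfl⟩ := Nat.exists_eq_add_of_le (not_lt.1 h2)
      rw [hι2 k (by omega), hι2 k' (by omega)] at he
      have := N.equivFin.symm.injective (Subtype.ext he)
      simpa using this
  have himage : (range (v + #N)).image ι' = cover S := by
    ext x
    simp only [mem_image, mem_range]
    constructor
    · rintro ⟨z, hz, rfl⟩
      by_cases h1 : z < v
      · exact cover_mono hGS (hmemG z h1)
      · exact (mem_sdiff.1 (hmemN z (by omega) hz)).1
    · intro hx
      by_cases hxG : x ∈ cover G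
      · rw [hcov] at hxG
        obtain ⟨z, hz, rfl⟩ := mem_image.1 hxG
        rw [mem_range] at hz
        exact ⟨z, by omega, hι1 z hz⟩
      · have hxN : x ∈ N := mem_sdiff.2 ⟨hx, hxG⟩
        refine ⟨v + N.equivFin ⟨x, hxN⟩, by have := (N.equivFin ⟨x, hxN⟩).2; omega, ?_⟩
        rw [hι2 _ (N.equivFin ⟨x, hxN⟩).2]
        simp
  have hpair : ∀ e ∈ S, ∃ x : ℕ × ℕ, (x.1 < v + #N ∧ x.2 < v + #N) ∧ s(ι' x.1, ι' x.2) = e := by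
    intro e he
    induction e with | _ a b
    have ha : a ∈ cover S := mem_cover.2 ⟨_, he, Sym2.mem_mk_left a b⟩
    have hb : b ∈ cover S := mem_cover.2 ⟨_, he, Sym2.mem_mk_right a b⟩
    rw [← himage] at ha hb
    obtain ⟨z, hz, rfl⟩ := mem_image.1 ha
    obtain ⟨z', hz', rfl⟩ := mem_image.1 hb
    exact ⟨(z, z'), ⟨mem_range.1 hz, mem_range.1 hz'⟩, rfl⟩
  choose! pr hpr1 hpr2 using hpair
  have hL : ∀ x, x ∈ (S \ G).toList.map pr ↔ ∃ e ∈ S \ G, pr e = x := by simp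
  refine ⟨#N, (S \ G).toList.map pr, ι', hNc, by simpa using hC,
    ⟨hinj', ?_, ?_, himage.symm, ?_⟩, hι1, ?_⟩
  · intro x hx
    rcases List.mem_append.1 hx with hx | hx
    · have := hlt x hx
      exact ⟨this.1.trans_le (Nat.le_add_right _ _), this.2.trans_le (Nat.le_add_right _ _)⟩
    · obtain ⟨e, he, rfl⟩ := (hL x).1 hx
      exact hpr1 e (mem_sdiff.1 he).1
  · ext e
    simp only [mem_image, mem_stateEdges, exists_exists_and_eq_and, Sym2.map_mk]
    constructor
    · rintro ⟨x, hx, rfl⟩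
      rcases List.mem_append.1 hx with hx | hx
      · apply hGS
        rw [← himg, hι1 _ (hlt x hx).1, hι1 _ (hlt x hx).2]
        exact mem_image.2 ⟨s(x.1, x.2), mem_stateEdges.2 ⟨x, hx, rfl⟩, rfl⟩
      · obtain ⟨e, he, rfl⟩ := (hL x).1 hx
        rw [hpr2 e (mem_sdiff.1 he).1]
        exact (mem_sdiff.1 he).1
    · intro he
      by_cases heG : e ∈ G
      · rw [← himg] at heG
        obtain ⟨e', he', rfl⟩ := mem_image.1 heG
        obtain ⟨x, hx, rfl⟩ := mem_stateEdges.1 he'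
        refine ⟨x, List.mem_append_left _ hx, ?_⟩
        rw [hι1 _ (hlt x hx).1, hι1 _ (hlt x hx).2, Sym2.map_mk]
      · exact ⟨pr e, List.mem_append_right _ ((hL _).2 ⟨e, mem_sdiff.2 ⟨he, heG⟩, rfl⟩),
          hpr2 e he⟩
  · simp only [List.length_append, List.length_map, length_toList, hlen]
    rw [add_comm, card_sdiff_add_card_eq_card hGS]
  · intro x hx
    obtain ⟨e, he, rfl⟩ := (hL x).1 hx
    have h1 := hpr1 e (mem_sdiff.1 he).1
    have h2 := hpr2 e (mem_sdiff.1 he).1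
    have h3 := Sym2.mem_mk_left (ι' (pr e).1) (ι' (pr e).2)
    have h4 := Sym2.mem_mk_right (ι' (pr e).1) (ι' (pr e).2)
    rw [h2] at h3 h4
    exact ⟨⟨h1.1, mem_cover.2 ⟨e, he, h3⟩⟩, ⟨h1.2, mem_cover.2 ⟨e, he, h4⟩⟩⟩

/-- An extension of a realised state is realised by a local or by a global move. -/
lemma Realizes.exists_move {m ε : ℝ} {C M : ℕ} {s : ExplState} {ι : ℕ → V}
    {G S : Finset (Sym2 V)} (h : Realizes s ι G) (hi : s.2.2 < s.1.length)
    (hS : IsExtension m ε C G s(ι (s.1.getD s.2.2 (0, 0)).1, ι (s.1.getD s.2.2 (0, 0)).2) S)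
    (hM : s.2.1 + 2 * C ≤ M) :
    ∃ (s' : ExplState) (ι' : ℕ → V) (L : List (ℕ × ℕ)), s'.1 = s.1 ++ L ∧ s'.2.2 = s.2.2 ∧
      Realizes s' ι' S ∧ (∀ z < s.2.1, ι' z = ι z) ∧
      (s' ∈ localMoves C s ∨ s' ∈ globalMoves C M s ∧ weight m S ≤ weight m G - ε) := by
  obtain ⟨w, L, ι', hw, hL, hr, hι, hx⟩ := h.exists_extend hS.ssubset.1 hS.card_le
  refine ⟨(s.1 ++ L, s.2.1 + w, s.2.2), ι', L, rfl, rfl, hr, hι, ?_⟩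
  rcases hS.weight_le_or with hlt | hloc
  · right
    refine ⟨?_, hlt⟩
    obtain ⟨d, hd⟩ := exists_extData (Fin.val : Fin M → ℕ) hL (fun x hxL => by
      have := hx x hxL
      exact ⟨⟨⟨x.1, by omega⟩, rfl⟩, ⟨⟨x.2, by omega⟩, rfl⟩⟩) s hw
    exact mem_image.2 ⟨d, mem_univ _, hd⟩
  · left
    set x₀ := s.1.getD s.2.2 (0, 0) with hx₀
    have hx₀mem : x₀ ∈ s.1 := by
      rw [hx₀, List.getD_eq_getElem _ _ hi]; exact List.getElem_mem hi
    -- An endpoint of a new edge is a new vertex or, by `hloc`, an endpoint of the current edge.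
    -- Hence 2C + 2 labels suffice, whatever the size of G.
    have hlab : ∀ z, z < s.2.1 + w → ι' z ∈ cover (S \ G) →
        z ∈ Set.range (localLabel C s) := by
      intro z hz hzc
      by_cases hzv : z < s.2.1
      · have h1 : ι z ∈ cover G := by
          rw [h.cover_eq]; exact mem_image_of_mem _ (mem_range.2 hzv)
        rw [hι z hzv] at hzc
        have h2 := hloc (mem_inter.2 ⟨hzc, h1⟩)
        rw [Sym2.mem_toFinset, Sym2.mem_iff] at h2
        rcases h2 with h2 | h2
        · exact ⟨⟨0, by omega⟩, by
            simp only [localLabel, if_true]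
            exact (h.injOn hzv (h.lt x₀ hx₀mem).1 h2).symm⟩
        · exact ⟨⟨1, by omega⟩, by
            simp only [localLabel, if_true, one_ne_zero, if_false]
            exact (h.injOn hzv (h.lt x₀ hx₀mem).2 h2).symm⟩
      · refine ⟨⟨z - s.2.1 + 2, by omega⟩, ?_⟩
        simp only [localLabel]
        rw [if_neg (by omega), if_neg (by omega)]
        omega
    obtain ⟨d, hd⟩ := exists_extData (localLabel C s) hL (fun x hxL =>
      ⟨hlab _ (hx x hxL).1.1 (hx x hxL).1.2, hlab _ (hx x hxL).2.1 (hx x hxL).2.2⟩) s hw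
    exact mem_insert_of_mem (mem_image.2 ⟨d, mem_univ _, hd⟩)

/-- The outcome of the exploration of a critical family with an edge set `E`: a copy in `E` of an
abstract edge set `A`, found in a state reached by few moves, whose weight is very small unless
it has many edges. -/
def HasOutcome (m ε gap : ℝ) (C D K : ℕ) (E : Finset (Sym2 V)) : Prop :=
  ∃ t ≤ 2 * K, ∃ d ≤ D, ∃ s ∈ reach C (2 * K + 2 * C) t d, ∃ A ⊆ stateEdges s.1, ∃ ι : ℕ → V,
    Set.InjOn ι (cover A) ∧ A.image (Sym2.map ι) ⊆ E ∧
    (weight m A ≤ -gap ∨ weight m A ≤ 2 - ε * D ∨ weight m A ≤ 2 ∧ K ≤ #A)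

lemma Realizes.hasOutcome {m ε gap : ℝ} {C D K t d : ℕ} {s : ExplState} {ι : ℕ → V}
    {G E : Finset (Sym2 V)} (h : Realizes s ι G) (hGE : G ⊆ E) (ht : t ≤ 2 * K) (hd : d ≤ D)
    (hs : s ∈ reach C (2 * K + 2 * C) t d) {J : Finset (Sym2 V)} (hJ : J ⊆ G)
    (hw : weight m J ≤ -gap ∨ weight m J ≤ 2 - ε * D ∨ weight m J ≤ 2 ∧ K ≤ #J) :
    HasOutcome m ε gap C D K E := by
  rw [← h.image_eq] at hJ
  obtain ⟨A, hA, rfl⟩ := subset_image_iff.1 hJ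
  have hA' : A ⊆ stateEdges s.1 := by exact_mod_cast hA
  have hinj : Set.InjOn ι (cover A) := h.injOn_cover.mono (by exact_mod_cast cover_mono hA')
  refine ⟨t, ht, d, hd, s, hs, A, hA', ι, hinj, ?_, ?_⟩
  · exact (image_mono _ hA').trans (h.image_eq.le.trans hGE)
  · rwa [weight_image hinj, card_image_of_injOn (injOn_sym2Map hinj)] at hw

lemma mem_reach_zero (C M d : ℕ) : (([(0, 1)], 2, 0) : ExplState) ∈ reach C M 0 d := by
  rw [reach]; exact mem_singleton_self _

lemma realizes_start {a b : V} (hab : a ≠ b) :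
    Realizes ([(0, 1)], 2, 0) (fun z => if z = 0 then a else b) {s(a, b)} := by
  refine ⟨?_, by simp, by simp [stateEdges], ?_, by simp⟩
  · intro z hz z' hz' hzz
    simp only [Set.mem_Iio] at hz hz'
    have h1 : z = 0 ∨ z = 1 := by omega
    have h2 : z' = 0 ∨ z' = 1 := by omega
    rcases h1 with rfl | rfl <;> rcases h2 with rfl | rfl <;> simp_all
  · simp [Sym2.toFinset_mk_eq, show range 2 = {0, 1} from rfl, image_insert]

/-- The current edge is extended until all members containing it lie in G, and then the next edge in
the list is taken. Every move raises position plus number of edges. The position never exceeds the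
number of edges, which is below K until the process stops, so 2K moves suffice. -/
theorem IsCritical.hasOutcome {fam : Finset (Bool × Finset (Sym2 V))} (h : IsCritical fam)
    (hl : ∀ c F, (c, F) ∈ fam → ∀ e ∈ F, ¬ e.IsDiag) (hne : (edges fam).Nonempty)
    {m ε gap : ℝ} (hm : 0 < m) (hε : 0 ≤ ε) {C : ℕ} (D K : ℕ)
    (hstep : ∀ G ⊆ edges fam, ∀ e ∈ G, ∀ c F, (c, F) ∈ fam → e ∈ F → ¬ F ⊆ G →
      ∃ S ⊆ edges fam, IsExtension m ε C G e S)
    (hdense : ∃ J ⊆ edges fam, weight m J ≤ -gap) :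
    HasOutcome m ε gap C D K (edges fam) := by
  set E := edges fam with hE
  -- Induction on 2|E| minus position minus number of edges. The last invariant says that the edges
  -- before the current position are exhausted.
  suffices key : ∀ k : ℕ, ∀ (t d : ℕ) (s : ExplState) (ι : ℕ → V) (G : Finset (Sym2 V)),
      2 * #E - (s.2.2 + s.1.length) = k → Realizes s ι G → G ⊆ E → G.Nonempty →
      s ∈ reach C (2 * K + 2 * C) t d → t ≤ 2 * K → t + 1 ≤ s.2.2 + s.1.length →
      s.2.2 ≤ s.1.length → d ≤ D → weight m G ≤ 2 - ε * d →
      (∀ j < s.2.2, ∀ c F, (c, F) ∈ fam →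
        s(ι (s.1.getD j (0, 0)).1, ι (s.1.getD j (0, 0)).2) ∈ F → F ⊆ G) →
      HasOutcome m ε gap C D K E by
    obtain ⟨e, he⟩ := hne
    have hed : ¬ e.IsDiag := by
      obtain ⟨c, F, hF, heF⟩ := mem_edges.1 he
      exact hl c F hF e heF
    induction e with | _ a b
    rw [Sym2.mk_isDiag_iff] at hed
    refine key _ 0 0 ([(0, 1)], 2, 0) _ {s(a, b)} rfl (realizes_start hed) (by simpa using he)
      (singleton_nonempty _) (mem_reach_zero _ _ _) (Nat.zero_le _) (Nat.le_refl _)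
      (Nat.zero_le _) (Nat.zero_le _) ?_ (fun j hj => absurd hj (Nat.not_lt_zero j))
    rw [weight, cover_singleton, Sym2.card_toFinset_of_not_isDiag _ (by simpa using hed)]
    have : 0 < 1 / m := by positivity
    simp only [card_singleton, Nat.cast_one, Nat.cast_ofNat, CharP.cast_eq_zero, mul_zero,
      sub_zero]
    linarith
  intro k
  induction k using Nat.strong_induction_on with
  | _ k ih =>
  intro t d s ι G hk hr hGE hGne hs ht hts hi hd hw hdone
  have hGcard := card_le_card hGE
  have hlen := hr.length_eq
  have hw2 : weight m G ≤ 2 := by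
    have : 0 ≤ ε * d := by positivity
    linarith
  by_cases hdD : d = D
  · exact hr.hasOutcome hGE ht hd hs Subset.rfl (.inr (.inl (hdD ▸ hw)))
  by_cases hKl : K ≤ #G
  · exact hr.hasOutcome hGE ht hd hs Subset.rfl (.inr (.inr ⟨hw2, hKl⟩))
  by_cases hGeq : G = E
  · obtain ⟨J, hJ, hJw⟩ := hdense
    exact hr.hasOutcome hGE ht hd hs (hGeq ▸ hJ) (.inl hJw)
  have hGlt : #G < #E := card_lt_card (hGE.ssubset_of_ne hGeq)
  have hmemG : ∀ e ∈ G, ∃ j < s.1.length,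
      s(ι (s.1.getD j (0, 0)).1, ι (s.1.getD j (0, 0)).2) = e := by
    intro e he
    rw [← hr.image_eq] at he
    obtain ⟨e', he', rfl⟩ := mem_image.1 he
    obtain ⟨x, hx, rfl⟩ := mem_stateEdges.1 he'
    obtain ⟨j, hj, rfl⟩ := List.mem_iff_getElem.1 hx
    exact ⟨j, hj, by rw [List.getD_eq_getElem _ _ hj, Sym2.map_mk]⟩
  -- If every edge of G were exhausted, no member could cross out of G, against connectedness.
  have hilt : s.2.2 < s.1.length := by
    by_contra hcon
    obtain ⟨e, he, c, F, hF, heF, hFG⟩ := h.exists_crossing hGE hGne hGeq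
    obtain ⟨j, hj, rfl⟩ := hmemG e he
    exact hFG (hdone j (by omega) c F hF heF)
  set e := s(ι (s.1.getD s.2.2 (0, 0)).1, ι (s.1.getD s.2.2 (0, 0)).2) with he
  by_cases hact : ∀ c F, (c, F) ∈ fam → e ∈ F → F ⊆ G
  · refine ih _ ?_ (t + 1) d (s.1, s.2.1, s.2.2 + 1) ι G rfl
      ⟨hr.injOn, hr.lt, hr.image_eq, hr.cover_eq, hr.length_eq⟩ hGE hGne
      (mem_reach_succ_of_local hs (mem_insert_self _ _)) (by omega) (by simp only; omega)
      (by simp only; omega) hd hw ?_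
    · simp only; omega
    · intro j hj
      by_cases hjs : j = s.2.2
      · subst hjs; exact hact
      · exact hdone j (by simp only at hj; omega)
  push Not at hact
  obtain ⟨c, F, hF, heF, hFG⟩ := hact
  have hlook : s.1.getD s.2.2 (0, 0) ∈ s.1 := by
    rw [List.getD_eq_getElem _ _ hilt]; exact List.getElem_mem hilt
  have heG : e ∈ G := by
    rw [← hr.image_eq]
    exact mem_image.2 ⟨_, mem_stateEdges.2 ⟨_, hlook, rfl⟩, rfl⟩
  obtain ⟨S, hSE, hS⟩ := hstep G hGE e heG c F hF heF hFG
  -- Fewer than K edges cover at most 2K vertices, so with the new ones all labels stay below 2K +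
  -- 2C.
  have hv : s.2.1 ≤ 2 * K := by
    have h1 : #(cover G) = s.2.1 := by
      rw [hr.cover_eq, card_image_of_injOn, card_range]
      simpa using hr.injOn
    have := card_cover_le G
    omega
  obtain ⟨s', ι', L, hs'l, hs'i, hr', hι, hmove⟩ := hr.exists_move hilt hS
    (M := 2 * K + 2 * C) (by omega)
  have hlen' := hr'.length_eq
  have hSG := card_lt_card hS.ssubset
  have hSc := card_le_card hSE
  have hdone' : ∀ j < s'.2.2, ∀ c F, (c, F) ∈ fam →
      s(ι' (s'.1.getD j (0, 0)).1, ι' (s'.1.getD j (0, 0)).2) ∈ F → F ⊆ S := by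
    intro j hj c F hF hjF
    rw [hs'i] at hj
    have hjl : j < s.1.length := by omega
    have hgd : s'.1.getD j (0, 0) = s.1.getD j (0, 0) := by
      rw [hs'l, List.getD_append _ _ _ _ hjl]
    have hmem : s.1.getD j (0, 0) ∈ s.1 := by
      rw [List.getD_eq_getElem _ _ hjl]; exact List.getElem_mem hjl
    rw [hgd, hι _ (hr.lt _ hmem).1, hι _ (hr.lt _ hmem).2] at hjF
    exact (hdone j hj c F hF hjF).trans hS.ssubset.1
  rcases hmove with hloc | ⟨hglob, hwS⟩
  · exact ih _ (by omega) (t + 1) d s' ι' S rfl hr' hSE (hGne.mono hS.ssubset.1)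
      (mem_reach_succ_of_local hs hloc) (by omega) (by omega) (by omega) hd
      (hS.weight_le.trans hw) hdone'
  · refine ih _ (by omega) (t + 1) (d + 1) s' ι' S rfl hr' hSE (hGne.mono hS.ssubset.1)
      (mem_reach_succ_of_global hs hglob) (by omega) (by omega) (by omega) (by omega) ?_ hdone'
    push_cast
    linarith

end Exploration

end KohayakawaKreuter

namespace KohayakawaKreuter

open Finset MeasureTheory ProbabilityTheory unitInterval

/-! ### Union bound in the binomial random graph -/

section Random

lemma setBernoulli_superset_le {ι : Type*} (u : Set ι) (p : unitInterval) (F : Finset ι) :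
    setBernoulli u p {s | (F : Set ι) ⊆ s} ≤ ENNReal.ofReal p ^ #F := by
  rw [setBernoulli_apply']
  have : (fun p : ι → Prop => {i | p i}) ⁻¹' {s | (F : Set ι) ⊆ s} =
      Set.pi (F : Set ι) fun _ => {True} := by
    ext q
    simp [Set.subset_def, Set.mem_pi]
  rw [this, Measure.infinitePi_pi _ (fun i _ => MeasurableSet.of_discrete)]
  refine (prod_le_pow_card _ _ (ENNReal.ofReal p) fun i _ => ?_)
  have hp : ENNReal.ofReal p = (unitInterval.toNNReal p : ENNReal) := by
    rw [ENNReal.ofReal]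
    congr 1
    ext
    simp [Real.coe_toNNReal _ p.2.1]
  rw [hp]
  by_cases hi : i ∈ u <;> simp [hi]

lemma binomialRandom_superset_le {V : Type*} [Countable V] (p : unitInterval)
    (F : Finset (Sym2 V)) :
    SimpleGraph.binomialRandom V p {G | (F : Set (Sym2 V)) ⊆ G.edgeSet} ≤
      ENNReal.ofReal p ^ #F := by
  rw [SimpleGraph.binomialRandom_apply']
  refine (measure_mono ?_).trans (setBernoulli_superset_le _ p F)
  rintro _ ⟨G, hG, rfl⟩
  exact hG

lemma binomialRandom_copy_le {V : Type*} [Fintype V] [DecidableEq V] [Nonempty V]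
    (p : unitInterval) (A : Finset (Sym2 ℕ)) :
    SimpleGraph.binomialRandom V p {G | ∃ ι : ℕ → V, Set.InjOn ι (cover A) ∧
      ((A.image (Sym2.map ι) : Finset (Sym2 V)) : Set (Sym2 V)) ⊆ G.edgeSet} ≤
      (Fintype.card V : ENNReal) ^ #(cover A) * ENNReal.ofReal p ^ #A := by
  classical
  -- Only the values on `cover A` matter; extending by a fixed junk value leaves n^(v(A)) maps for
  -- the union bound.
  let ext : (cover A → V) → ℕ → V := fun g z =>
    if h : z ∈ cover A then g ⟨z, h⟩ else Classical.arbitrary V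
  have hext : ∀ (ι : ℕ → V), ∀ z ∈ cover A, ext (fun x => ι x) z = ι z := fun ι z hz => by
    simp [ext, hz]
  let T : Finset (cover A → V) := univ.filter fun g => Set.InjOn (ext g) (cover A)
  have hsub : {G : SimpleGraph V | ∃ ι : ℕ → V, Set.InjOn ι (cover A) ∧
      ((A.image (Sym2.map ι) : Finset (Sym2 V)) : Set (Sym2 V)) ⊆ G.edgeSet} ⊆
      ⋃ g ∈ T, {G | ((A.image (Sym2.map (ext g)) : Finset (Sym2 V)) : Set (Sym2 V)) ⊆
        G.edgeSet} := by
    rintro G ⟨ι, hι, hG⟩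
    simp only [Set.mem_iUnion]
    refine ⟨fun x => ι x, ?_, ?_⟩
    · simp only [T, mem_filter, mem_univ, true_and]
      exact hι.congr fun z hz => (hext ι z hz).symm
    · rw [Set.mem_ofPred_eq]
      have : A.image (Sym2.map (ext fun x => ι x)) = A.image (Sym2.map ι) :=
        image_congr fun e he => Sym2.map_congr fun z hz =>
          hext ι z (mem_cover.2 ⟨e, he, hz⟩)
      rwa [this]
  refine (measure_mono hsub).trans ((measure_biUnion_finset_le _ _).trans ?_)
  have hT : (#T : ENNReal) ≤ (Fintype.card V : ENNReal) ^ #(cover A) := by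
    have : #T ≤ Fintype.card V ^ #(cover A) := by
      refine (card_le_univ _).trans ?_
      simp
    exact_mod_cast this
  calc _ ≤ ∑ g ∈ T, ENNReal.ofReal p ^ #A := by
        refine sum_le_sum fun g hg => (binomialRandom_superset_le p _).trans_eq ?_
        rw [card_image_of_injOn (injOn_sym2Map (mem_filter.1 hg).2)]
    _ = #T * ENNReal.ofReal p ^ #A := by rw [sum_const, nsmul_eq_mul]
    _ ≤ _ := by gcongr

/-- The number of edge sets considered in the union bound. -/
def outcomeBound (C D K : ℕ) : ℕ :=
  (2 * K + 1) * (D + 1) * ((Fintype.card (ExtData C (2 * C + 2)) + 2) ^ (2 * K) *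
    Fintype.card (ExtData C (2 * K + 2 * C)) ^ D) * 2 ^ (1 + C * (2 * K))

open Classical in
lemma card_outcomes_le (C D K : ℕ) :
    #(((range (2 * K + 1) ×ˢ range (D + 1)).biUnion fun x =>
      reach C (2 * K + 2 * C) x.1 x.2).biUnion fun s => (stateEdges s.1).powerset) ≤
      outcomeBound C D K := by
  refine (card_biUnion_le_card_mul _ _ (2 ^ (1 + C * (2 * K))) ?_).trans ?_
  · intro s hs
    obtain ⟨x, hx, hs⟩ := mem_biUnion.1 hs
    rw [card_powerset]
    refine Nat.pow_le_pow_right (by norm_num) ((card_stateEdges_le _).trans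
      ((length_le_of_mem_reach hs).trans ?_))
    have := mem_range.1 (mem_product.1 hx).1
    gcongr
    omega
  · refine Nat.mul_le_mul_right _ ?_
    refine (card_biUnion_le_card_mul _ _ _ fun x hx => ?_).trans_eq
      (by rw [card_product, card_range, card_range])
    have h1 := mem_range.1 (mem_product.1 hx).1
    have h2 := mem_range.1 (mem_product.1 hx).2
    refine (card_reach_le _ _ _ _).trans (Nat.mul_le_mul ?_ ?_)
    · exact Nat.pow_le_pow_right (by omega) (by omega)
    · exact Nat.pow_le_pow_right (Fintype.card_pos_iff.2 ⟨(0, fun _ => none)⟩) (by omega)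

/-- The left side is at most n^w b^(e(A)) with w the weight. In the first two outcomes w ≤ -gap and
b ≤ 1 suffice; in the third, w ≤ 2 is beaten by b^K ≤ n^(-(2 + gap)). -/
lemma expected_copies_le {m ε gap b : ℝ} {D K n : ℕ} (hb0 : 0 < b) (hb1 : b ≤ 1)
    (hn : 1 ≤ n) (hD : 2 + gap ≤ ε * D) (hbK : b ^ K ≤ (n : ℝ) ^ (-(2 + gap)))
    {p : unitInterval} (hp : (p : ℝ) ≤ b * (n : ℝ) ^ (-1 / m)) {A : Finset (Sym2 ℕ)}
    (hA : weight m A ≤ -gap ∨ weight m A ≤ 2 - ε * D ∨ weight m A ≤ 2 ∧ K ≤ #A) :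
    (n : ENNReal) ^ #(cover A) * ENNReal.ofReal p ^ #A ≤ ENNReal.ofReal ((n : ℝ) ^ (-gap)) := by
  have hn1 : (1 : ℝ) ≤ n := by exact_mod_cast hn
  have hn0 : (0 : ℝ) < n := by linarith
  have h1 : (n : ENNReal) ^ #(cover A) * ENNReal.ofReal p ^ #A =
      ENNReal.ofReal ((n : ℝ) ^ #(cover A) * (p : ℝ) ^ #A) := by
    rw [ENNReal.ofReal_mul (by positivity), ENNReal.ofReal_pow hn0.le, ENNReal.ofReal_pow p.2.1,
      ENNReal.ofReal_natCast]
  rw [h1]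
  refine ENNReal.ofReal_le_ofReal ?_
  have h2 : (n : ℝ) ^ #(cover A) * (p : ℝ) ^ #A ≤ (n : ℝ) ^ weight m A * b ^ #A := by
    calc (n : ℝ) ^ #(cover A) * (p : ℝ) ^ #A
        ≤ (n : ℝ) ^ #(cover A) * (b * (n : ℝ) ^ (-1 / m)) ^ #A := by
          gcongr
          exact p.2.1
      _ = _ := by
          rw [mul_pow, ← Real.rpow_natCast (n : ℝ) #(cover A), ← Real.rpow_mul_natCast hn0.le,
            mul_comm (b ^ #A), ← mul_assoc, ← Real.rpow_add hn0, weight]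
          congr 2
          ring
  refine h2.trans ?_
  have hbA : b ^ #A ≤ 1 := pow_le_one₀ hb0.le hb1
  have small : weight m A ≤ -gap → (n : ℝ) ^ weight m A * b ^ #A ≤ (n : ℝ) ^ (-gap) := by
    intro h
    calc _ ≤ (n : ℝ) ^ (-gap) * 1 := by
          gcongr
      _ = _ := mul_one _
  rcases hA with h | h | ⟨h, hK⟩
  · exact small h
  · exact small (by linarith)
  · calc (n : ℝ) ^ weight m A * b ^ #A ≤ (n : ℝ) ^ (2 : ℝ) * (n : ℝ) ^ (-(2 + gap)) := by
          gcongr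
          exact (pow_le_pow_of_le_one hb0.le hb1 hK).trans hbK
      _ = _ := by rw [← Real.rpow_add hn0]; congr 1; ring

lemma binomialRandom_outcome_le {m ε gap b : ℝ} {C D K n : ℕ} (hb0 : 0 < b) (hb1 : b ≤ 1)
    (hn : 1 ≤ n) (hD : 2 + gap ≤ ε * D) (hbK : b ^ K ≤ (n : ℝ) ^ (-(2 + gap)))
    {p : unitInterval} (hp : (p : ℝ) ≤ b * (n : ℝ) ^ (-1 / m)) :
    SimpleGraph.binomialRandom (Fin n) p {G | ∃ E : Finset (Sym2 (Fin n)),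
      (E : Set (Sym2 (Fin n))) ⊆ G.edgeSet ∧ HasOutcome m ε gap C D K E} ≤
      ENNReal.ofReal (outcomeBound C D K * (n : ℝ) ^ (-gap)) := by
  classical
  have : Nonempty (Fin n) := ⟨⟨0, hn⟩⟩
  let T := (((range (2 * K + 1) ×ˢ range (D + 1)).biUnion fun x =>
      reach C (2 * K + 2 * C) x.1 x.2).biUnion fun s => (stateEdges s.1).powerset).filter
      fun A => weight m A ≤ -gap ∨ weight m A ≤ 2 - ε * D ∨ weight m A ≤ 2 ∧ K ≤ #A
  have hsub : {G : SimpleGraph (Fin n) | ∃ E : Finset (Sym2 (Fin n)),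
      (E : Set (Sym2 (Fin n))) ⊆ G.edgeSet ∧ HasOutcome m ε gap C D K E} ⊆
      ⋃ A ∈ T, {G | ∃ ι : ℕ → Fin n, Set.InjOn ι (cover A) ∧
        ((A.image (Sym2.map ι) : Finset (Sym2 (Fin n))) : Set (Sym2 (Fin n))) ⊆ G.edgeSet} := by
    rintro G ⟨E, hE, t, ht, d, hd, s, hs, A, hA, ι, hι, hAE, hw⟩
    simp only [Set.mem_iUnion]
    refine ⟨A, mem_filter.2 ⟨mem_biUnion.2 ⟨s, mem_biUnion.2 ⟨(t, d), ?_, hs⟩,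
      mem_powerset.2 hA⟩, hw⟩, ι, hι, (coe_subset.2 hAE).trans hE⟩
    simp only [mem_product, mem_range]
    omega
  refine (measure_mono hsub).trans ((measure_biUnion_finset_le _ _).trans ?_)
  calc _ ≤ ∑ A ∈ T, ENNReal.ofReal ((n : ℝ) ^ (-gap)) := by
        refine sum_le_sum fun A hA => (binomialRandom_copy_le p A).trans ?_
        rw [Fintype.card_fin]
        exact expected_copies_le hb0 hb1 hn hD hbK hp (mem_filter.1 hA).2
    _ = #T * ENNReal.ofReal ((n : ℝ) ^ (-gap)) := by rw [sum_const, nsmul_eq_mul]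
    _ ≤ (outcomeBound C D K : ENNReal) * ENNReal.ofReal ((n : ℝ) ^ (-gap)) := by
        gcongr
        exact (card_filter_le _ _).trans (card_outcomes_le C D K)
    _ = _ := by
        rw [ENNReal.ofReal_mul (by positivity), ENNReal.ofReal_natCast]

lemma exists_pow_le_two_pow (q : ℕ) : ∃ A : ℝ, 0 < A ∧ ∀ K : ℕ, ((K : ℝ) + 1) ^ q ≤ A * 2 ^ K := by
  obtain ⟨A, hA⟩ := (tendsto_pow_const_div_const_pow_of_one_lt q
    (one_lt_two : (1 : ℝ) < 2)).bddAbove_range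
  refine ⟨2 * (|A| + 1), by positivity, fun K => ?_⟩
  have h := hA ⟨K + 1, rfl⟩
  simp only at h
  rw [div_le_iff₀ (by positivity)] at h
  push_cast at h
  calc ((K : ℝ) + 1) ^ q ≤ A * 2 ^ (K + 1) := h
    _ ≤ (|A| + 1) * 2 ^ (K + 1) := by gcongr; linarith [le_abs_self A]
    _ = _ := by ring

/-- Exponential growth in K with a base independent of D: the factor raised to the power D is
polynomial in K. -/
lemma exists_outcomeBound_le (C : ℕ) : ∃ B : ℝ, 1 < B ∧ ∀ D : ℕ, ∃ A : ℝ, 0 < A ∧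
    ∀ K : ℕ, (outcomeBound C D K : ℝ) ≤ A * B ^ K := by
  set a : ℝ := (Fintype.card (ExtData C (2 * C + 2)) : ℝ) + 2 with ha
  have ha1 : 1 ≤ a := by
    have : (0 : ℝ) ≤ Fintype.card (ExtData C (2 * C + 2)) := Nat.cast_nonneg _
    linarith
  have h2C : (1 : ℝ) ≤ 2 ^ (2 * C) := one_le_pow₀ (by norm_num)
  -- The last factor 2 absorbs the power of K + 1.
  refine ⟨a ^ 2 * 2 ^ (2 * C) * 2, ?_, fun D => ?_⟩
  · nlinarith [mul_le_mul (one_le_pow₀ ha1 : 1 ≤ a ^ 2) h2C (by norm_num) (by positivity)]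
  obtain ⟨A, hA0, hA⟩ := exists_pow_le_two_pow (1 + 2 * C * D)
  refine ⟨2 * (D + 1) * (((2 * C + 1 : ℕ) : ℝ) * ((2 * C + 3 : ℕ) : ℝ) ^ (2 * C)) ^ D * 2 * A,
    by positivity, fun K => ?_⟩
  have hP : (Fintype.card (ExtData C (2 * K + 2 * C)) : ℝ) ≤
      (((2 * C + 1 : ℕ) : ℝ) * ((2 * C + 3 : ℕ) : ℝ) ^ (2 * C)) * ((K : ℝ) + 1) ^ (2 * C) := by
    have h1 : Fintype.card (ExtData C (2 * K + 2 * C)) =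
        (2 * C + 1) * ((2 * K + 2 * C) * (2 * K + 2 * C) + 1) ^ C := by simp
    have h2 : (2 * K + 2 * C) * (2 * K + 2 * C) + 1 ≤ ((2 * C + 3) * (K + 1)) ^ 2 := by
      have h3 : 2 * K + 2 * C + 1 ≤ (2 * C + 3) * (K + 1) := by nlinarith
      calc (2 * K + 2 * C) * (2 * K + 2 * C) + 1 ≤ (2 * K + 2 * C + 1) ^ 2 := by nlinarith
        _ ≤ _ := Nat.pow_le_pow_left h3 2
    rw [h1, mul_assoc]
    push_cast
    rw [← mul_pow, pow_mul]
    gcongr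
    exact_mod_cast h2
  have hK : (2 * (K : ℝ) + 1) ≤ 2 * (K + 1) := by linarith
  calc (outcomeBound C D K : ℝ)
      = (2 * K + 1) * (D + 1) * (a ^ (2 * K) *
        (Fintype.card (ExtData C (2 * K + 2 * C)) : ℝ) ^ D) * 2 ^ (1 + C * (2 * K)) := by
        rw [outcomeBound]; push_cast; rfl
    _ ≤ (2 * (K + 1)) * (D + 1) * (a ^ (2 * K) *
        ((((2 * C + 1 : ℕ) : ℝ) * ((2 * C + 3 : ℕ) : ℝ) ^ (2 * C)) *
          ((K : ℝ) + 1) ^ (2 * C)) ^ D) * 2 ^ (1 + C * (2 * K)) := by gcongr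
    _ = 2 * (D + 1) * (((2 * C + 1 : ℕ) : ℝ) * ((2 * C + 3 : ℕ) : ℝ) ^ (2 * C)) ^ D * 2 *
        ((K : ℝ) + 1) ^ (1 + 2 * C * D) * (a ^ 2 * 2 ^ (2 * C)) ^ K := by
        rw [mul_pow (((2 * C + 1 : ℕ) : ℝ) * _), ← pow_mul ((K : ℝ) + 1),
          show C * (2 * K) = 2 * C * K by ring, pow_add (2 : ℝ), pow_mul (2 : ℝ) (2 * C) K,
          pow_mul a 2 K, mul_pow (a ^ 2), pow_add ((K : ℝ) + 1)]
        ring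
    _ ≤ 2 * (D + 1) * (((2 * C + 1 : ℕ) : ℝ) * ((2 * C + 3 : ℕ) : ℝ) ^ (2 * C)) ^ D * 2 *
        (A * 2 ^ K) * (a ^ 2 * 2 ^ (2 * C)) ^ K := by
        gcongr
        exact hA K
    _ = _ := by rw [mul_pow (a ^ 2 * 2 ^ (2 * C))]; ring

/-- Below the density `b * n ^ (-1 / m)`, asymptotically almost surely the exploration process has
no outcome. -/
theorem exists_threshold {m ε gap : ℝ} (hε : 0 < ε) (hgap : 0 < gap) (C : ℕ) :
    ∃ b : ℝ, 0 < b ∧ ∀ p : ℕ → unitInterval,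
      (∀ᶠ n : ℕ in atTop, (p n : ℝ) ≤ b * (n : ℝ) ^ (-1 / m)) →
      ∀ A : ∀ n : ℕ, Set (SimpleGraph (Fin n)),
        (∀ (n D K : ℕ), ∀ G ∈ A n, ∃ E : Finset (Sym2 (Fin n)),
          (E : Set (Sym2 (Fin n))) ⊆ G.edgeSet ∧ HasOutcome m ε gap C D K E) →
        Tendsto (fun n : ℕ => SimpleGraph.binomialRandom (Fin n) (p n) (A n)) atTop (𝓝 0) := by
  obtain ⟨B, hB1, hB⟩ := exists_outcomeBound_le C
  set D := ⌈(2 + gap) / ε⌉₊ with hDdef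
  obtain ⟨A₀, hA₀, hbound⟩ := hB D
  have hlogB : 0 < Real.log B := Real.log_pos hB1
  -- For K = ⌈c log n⌉ this makes B^K of order n^(gap/2), half of what the expectation leaves to
  -- spare. Then b is the number with b^(c log n) = n^(-(2 + gap)).
  set c := gap / (2 * Real.log B) with hc
  have hc0 : 0 < c := by positivity
  set b := Real.exp (-((2 + gap) / c)) with hb
  have hb1 : b ≤ 1 := by
    rw [hb, Real.exp_le_one_iff]
    have : 0 ≤ (2 + gap) / c := by positivity
    linarith
  have hD : 2 + gap ≤ ε * D := by
    have := Nat.le_ceil ((2 + gap) / ε)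
    rw [div_le_iff₀ hε] at this
    rw [hDdef]; linarith
  refine ⟨b, Real.exp_pos _, fun p hp A hA => ?_⟩
  have hlim : Tendsto (fun n : ℕ => ENNReal.ofReal (A₀ * B * (n : ℝ) ^ (-(gap / 2)))) atTop
      (𝓝 0) := by
    have h1 : Tendsto (fun n : ℕ => (n : ℝ) ^ (-(gap / 2))) atTop (𝓝 0) :=
      (tendsto_rpow_neg_atTop (by positivity)).comp tendsto_natCast_atTop_atTop
    have h2 := ENNReal.tendsto_ofReal (h1.const_mul (A₀ * B))
    simpa using h2
  refine tendsto_of_tendsto_of_tendsto_of_le_of_le' tendsto_const_nhds hlim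
    (Eventually.of_forall fun _ => zero_le) ?_
  filter_upwards [hp, eventually_ge_atTop 1] with n hpn hn
  have hn1 : (1 : ℝ) ≤ n := by exact_mod_cast hn
  have hn0 : (0 : ℝ) < n := by linarith
  have hlogn : 0 ≤ Real.log n := Real.log_nonneg hn1
  set K := ⌈c * Real.log n⌉₊ with hK
  have hK1 : c * Real.log n ≤ K := Nat.le_ceil _
  have hK2 : (K : ℝ) ≤ c * Real.log n + 1 := (Nat.ceil_lt_add_one (by positivity)).le
  have hbK : b ^ K ≤ (n : ℝ) ^ (-(2 + gap)) := by
    rw [hb, ← Real.exp_nat_mul, Real.rpow_def_of_pos hn0, Real.exp_le_exp]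
    have h1 : (2 + gap) / c * (c * Real.log n) ≤ (2 + gap) / c * K := by gcongr
    have h2 : (2 + gap) / c * (c * Real.log n) = (2 + gap) * Real.log n := by field_simp
    linarith
  have hBK : B ^ K ≤ B * (n : ℝ) ^ (gap / 2) := by
    have h0 : 0 < B := by linarith
    rw [← Real.rpow_natCast]
    calc B ^ (K : ℝ) ≤ B ^ (c * Real.log n + 1) :=
          Real.rpow_le_rpow_of_exponent_le hB1.le hK2
      _ = B * (n : ℝ) ^ (gap / 2) := by
          rw [Real.rpow_add h0, Real.rpow_one, mul_comm, Real.rpow_def_of_pos h0,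
            Real.rpow_def_of_pos hn0, hc]
          congr 2
          field_simp
  refine (measure_mono (fun G hG => hA n D K G hG)).trans
    ((binomialRandom_outcome_le (Real.exp_pos _) hb1 hn hD hbK hpn).trans ?_)
  refine ENNReal.ofReal_le_ofReal ?_
  calc (outcomeBound C D K : ℝ) * (n : ℝ) ^ (-gap)
      ≤ (A₀ * (B * (n : ℝ) ^ (gap / 2))) * (n : ℝ) ^ (-gap) := by
        gcongr
        exact (hbound K).trans (by gcongr)
    _ = A₀ * B * ((n : ℝ) ^ (gap / 2) * (n : ℝ) ^ (-gap)) := by ring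
    _ = _ := by
        rw [← Real.rpow_add hn0]
        congr 2
        ring

end Random

end KohayakawaKreuter

namespace KohayakawaKreuter

open Finset

/-! ### Matroid partition -/

section MatroidPartition

variable {α : Type*} [DecidableEq α]

/-- An (integer valued) matroid rank function. -/
structure IsRank (r : Finset α → ℤ) : Prop where
  empty : r ∅ = 0
  le_insert : ∀ e X, r X ≤ r (insert e X)
  insert_le : ∀ e X, r (insert e X) ≤ r X + 1
  submodular : ∀ X Y, r (X ∪ Y) + r (X ∩ Y) ≤ r X + r Y

lemma IsRank.le_add_card {r : Finset α → ℤ} (h : IsRank r) {X Y : Finset α} (hXY : X ⊆ Y) :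
    r Y ≤ r X + #(Y \ X) := by
  conv_lhs => rw [← union_sdiff_of_subset hXY]
  generalize Y \ X = Z
  induction Z using Finset.induction_on with
  | empty => simp
  | insert e Z he ih =>
    rw [union_insert, card_insert_of_notMem he]
    push_cast
    linarith [h.insert_le e (X ∪ Z)]

lemma IsRank.contract {r : Finset α → ℤ} (h : IsRank r) {e : α} (he : r {e} = 1) :
    IsRank fun X => r (insert e X) - 1 := by
  refine ⟨by simp [he], fun f X => ?_, fun f X => ?_, fun X Y => ?_⟩
  · rw [insert_comm]; linarith [h.le_insert f (insert e X)]
  · rw [insert_comm]; linarith [h.insert_le f (insert e X)]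
  · have := h.submodular (insert e X) (insert e Y)
    rw [← insert_union_distrib, ← insert_inter_distrib] at this
    linarith

/-- The matroid partition theorem. -/
theorem exists_partition_of_rank {N : ℕ} (E : Finset α) (r : Fin N → Finset α → ℤ)
    (hr : ∀ i, IsRank (r i)) (hE : ∀ X ⊆ E, (#X : ℤ) ≤ ∑ i, r i X) :
    ∃ c : α → ℕ, (∀ e ∈ E, c e < N) ∧
      ∀ i : Fin N, r i (E.filter fun e => c e = i) = #(E.filter fun e => c e = i) := by
  induction E using Finset.induction_on generalizing r with
  | empty => exact ⟨fun _ => 0, by simp, fun i => by simp [(hr i).empty]⟩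
  | insert e E he ih =>
    -- Some matroid can take e: contracting e in it keeps the counting condition on E. Otherwise
    -- every matroid i has a tight set X i spanning e in it. Tight sets are closed under union by
    -- submodularity, so one tight Y spans e in all matroids, and Y with e added violates the
    -- hypothesis.
    have hex : ∃ i, r i {e} = 1 ∧ ∀ X ⊆ E, (#X : ℤ) ≤
        ∑ j, r j X + (r i (insert e X) - 1 - r i X) := by
      by_contra! hcon
      have htight : ∀ i, ∃ X ⊆ E, (#X : ℤ) = ∑ j, r j X ∧ r i (insert e X) = r i X := by
        intro i
        by_cases h1 : r i {e} = 1
        · obtain ⟨X, hX, hlt⟩ := hcon i h1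
          have h2 := hE X (hX.trans (subset_insert _ _))
          have h3 := (hr i).le_insert e X
          have h4 := (hr i).insert_le e X
          exact ⟨X, hX, by omega, by omega⟩
        -- Here e is a loop of matroid i and is spanned by the empty set.
        · refine ⟨∅, empty_subset _, by simp [(hr _).empty], ?_⟩
          have h3 := (hr i).le_insert e ∅
          have h4 := (hr i).insert_le e ∅
          rw [(hr i).empty] at *
          rw [insert_empty] at *
          omega
      choose X hXE hX1 hX2 using htight
      have hunion : ∀ s : Finset (Fin N), s.biUnion X ⊆ E ∧
          (#(s.biUnion X) : ℤ) = ∑ j, r j (s.biUnion X) := by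
        intro s
        induction s using Finset.induction_on with
        | empty => simp [(hr _).empty]
        | insert i s _ ihs =>
          rw [biUnion_insert]
          set Y := s.biUnion X
          have hsub : X i ∪ Y ⊆ E := union_subset (hXE i) ihs.1
          refine ⟨hsub, ?_⟩
          have h1 : (#(X i ∪ Y) : ℤ) + #(X i ∩ Y) = #(X i) + #Y := by
            exact_mod_cast card_union_add_card_inter _ _
          have h2 := hE _ (hsub.trans (subset_insert e E))
          have h3 := hE (X i ∩ Y) ((inter_subset_left.trans (hXE i)).trans (subset_insert e E))
          have h4 : ∑ j, r j (X i ∪ Y) + ∑ j, r j (X i ∩ Y) ≤ ∑ j, r j (X i) + ∑ j, r j Y := by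
            rw [← sum_add_distrib, ← sum_add_distrib]
            exact sum_le_sum fun j _ => (hr j).submodular _ _
          have h5 := hX1 i
          have h6 := ihs.2
          linarith
      obtain ⟨hYE, hY⟩ := hunion univ
      set Y := univ.biUnion X
      have heY : e ∉ Y := fun h => he (hYE h)
      have hins : ∀ i, r i (insert e Y) ≤ r i Y := by
        intro i
        have hXY : X i ⊆ Y := subset_biUnion_of_mem X (mem_univ i)
        have h1 := (hr i).submodular Y (insert e (X i))
        have h2 : Y ∪ insert e (X i) = insert e Y := by
          rw [union_insert, union_eq_left.2 hXY]
        have h3 : Y ∩ insert e (X i) = X i := by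
          rw [inter_insert_of_notMem heY, inter_eq_right.2 hXY]
        rw [h2, h3, hX2 i] at h1
        linarith
      have h1 := hE (insert e Y) (insert_subset_insert e hYE)
      rw [card_insert_of_notMem heY] at h1
      push_cast at h1
      have h2 : ∑ i, r i (insert e Y) ≤ ∑ i, r i Y := sum_le_sum fun i _ => hins i
      linarith
    obtain ⟨i, hi, hX⟩ := hex
    let r' : Fin N → Finset α → ℤ := Function.update r i fun X => r i (insert e X) - 1
    have hr' : ∀ j, IsRank (r' j) := by
      intro j
      by_cases hj : j = i
      · subst hj; simpa [r'] using (hr j).contract hi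
      · simpa [r', hj] using hr j
    obtain ⟨c, hc1, hc2⟩ := ih r' hr' (fun X hXE => by
      refine (hX X hXE).trans_eq ?_
      rw [← add_sum_erase univ _ (mem_univ i), ← add_sum_erase univ (fun j => r' j X) (mem_univ i)]
      have : ∑ j ∈ univ.erase i, r' j X = ∑ j ∈ univ.erase i, r j X :=
        sum_congr rfl fun j hj => by simp [r', ne_of_mem_erase hj]
      rw [this]
      simp only [r', Function.update_self]
      ring)
    have hce : ∀ f ∈ E, Function.update c e (i : ℕ) f = c f := fun f hf =>
      Function.update_of_ne (by rintro rfl; exact he hf) _ _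
    refine ⟨Function.update c e i, ?_, fun j => ?_⟩
    · intro f hf
      rcases mem_insert.1 hf with rfl | hf
      · simp
      · rw [hce f hf]; exact hc1 f hf
    · have hfil : (E.filter fun f => Function.update c e (i : ℕ) f = j) =
          E.filter fun f => c f = j := filter_congr fun f hf => by rw [hce f hf]
      rw [filter_insert, hfil]
      have h2 := hc2 j
      by_cases hj : j = i
      · subst hj
        rw [if_pos (by simp), card_insert_of_notMem (by simp [he])]
        simp only [r', Function.update_self] at h2
        push_cast
        linarith
      · rw [if_neg (by simpa using fun h => hj (Fin.ext h).symm)]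
        simpa [r', hj] using h2

end MatroidPartition

/-! ### Graphic matroid and decomposition into forests -/

section NashWilliams

variable {V : Type*} [DecidableEq V]

/-- The incidence vector of an edge over the field with two elements. -/
def incidence (e : Sym2 V) : V → ZMod 2 :=
  Sym2.lift ⟨fun a b => Pi.single a 1 + Pi.single b 1, fun _ _ => add_comm _ _⟩ e

lemma incidence_mk (a b : V) : incidence s(a, b) = Pi.single a 1 + Pi.single b 1 := rfl

lemma incidence_apply_eq_zero {e : Sym2 V} {x : V} (hx : x ∉ e) : incidence e x = 0 := by
  induction e with | _ a b
  simp only [Sym2.mem_iff, not_or] at hx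
  simp [incidence_mk, hx.1, hx.2]

lemma sum_incidence [Fintype V] (e : Sym2 V) : ∑ x, incidence e x = 0 := by
  induction e with | _ a b
  simp only [incidence_mk, Pi.add_apply, sum_add_distrib, sum_pi_single', mem_univ, if_true]
  exact CharTwo.add_self_eq_zero 1

/-- The space spanned by the incidence vectors of a set of edges. -/
def incidenceSpan (X : Finset (Sym2 V)) : Submodule (ZMod 2) (V → ZMod 2) :=
  Submodule.span (ZMod 2) (incidence '' (X : Set (Sym2 V)))

lemma incidenceSpan_mono {X Y : Finset (Sym2 V)} (h : X ⊆ Y) :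
    incidenceSpan X ≤ incidenceSpan Y :=
  Submodule.span_mono (Set.image_mono (by exact_mod_cast h))

lemma incidenceSpan_union (X Y : Finset (Sym2 V)) :
    incidenceSpan (X ∪ Y) = incidenceSpan X ⊔ incidenceSpan Y := by
  rw [incidenceSpan, coe_union, Set.image_union, Submodule.span_union]; rfl

lemma apply_eq_zero_of_mem_incidenceSpan {X : Finset (Sym2 V)} {f : V → ZMod 2}
    (hf : f ∈ incidenceSpan X) {x : V} (hx : x ∉ cover X) : f x = 0 := by
  have : incidenceSpan X ≤ LinearMap.ker (LinearMap.proj (R := ZMod 2) (φ := fun _ => ZMod 2) x) := by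
    rw [incidenceSpan, Submodule.span_le]
    rintro _ ⟨e, he, rfl⟩
    exact incidence_apply_eq_zero fun h => hx (mem_cover.2 ⟨e, by exact_mod_cast he, h⟩)
  exact this hf

lemma sum_eq_zero_of_mem_incidenceSpan [Fintype V] {X : Finset (Sym2 V)} {f : V → ZMod 2}
    (hf : f ∈ incidenceSpan X) : ∑ x, f x = 0 := by
  have : incidenceSpan X ≤ LinearMap.ker
      (∑ x, LinearMap.proj (R := ZMod 2) (φ := fun _ : V => ZMod 2) x) := by
    rw [incidenceSpan, Submodule.span_le]
    rintro _ ⟨e, _, rfl⟩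
    simpa using sum_incidence e
  simpa using this hf

/-- The rank of a set of edges in the graphic matroid. -/
noncomputable def graphicRank (X : Finset (Sym2 V)) : ℕ :=
  Module.finrank (ZMod 2) (incidenceSpan X)

variable [Fintype V]

lemma isRank_graphicRank : IsRank fun X : Finset (Sym2 V) => (graphicRank X : ℤ) := by
  refine ⟨?_, fun e X => ?_, fun e X => ?_, fun X Y => ?_⟩
  · have : incidenceSpan (∅ : Finset (Sym2 V)) = ⊥ := by
      rw [incidenceSpan, coe_empty, Set.image_empty, Submodule.span_empty]
    rw [graphicRank, this, finrank_bot, Nat.cast_zero]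
  · exact_mod_cast Submodule.finrank_mono (incidenceSpan_mono (subset_insert e X))
  · have h1 : Module.finrank (ZMod 2) (incidenceSpan {e}) ≤ 1 := by
      rw [incidenceSpan, coe_singleton, Set.image_singleton]
      exact (finrank_span_le_card _).trans (by simp)
    have h2 := Submodule.finrank_add_le_finrank_add_finrank (incidenceSpan {e}) (incidenceSpan X)
    rw [← incidenceSpan_union, ← insert_eq] at h2
    simp only [graphicRank]
    omega
  · have h1 := Submodule.finrank_sup_add_finrank_inf_eq (incidenceSpan X) (incidenceSpan Y)
    have h2 := Submodule.finrank_mono (le_inf (incidenceSpan_mono inter_subset_left)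
      (incidenceSpan_mono inter_subset_right) : incidenceSpan (X ∩ Y) ≤ _)
    rw [← incidenceSpan_union] at h1
    simp only [graphicRank]
    omega

/-- Vectors in the span vanish outside `cover X` and have coordinate sum zero, so they are
determined by their values on the cover without one vertex. -/
lemma graphicRank_add_one_le {X : Finset (Sym2 V)} (hX : X.Nonempty) :
    graphicRank X + 1 ≤ #(cover X) := by
  obtain ⟨e, he⟩ := hX
  obtain ⟨x₀, hx₀⟩ : ∃ x, x ∈ e := by
    induction e with | _ a b
    exact ⟨a, Sym2.mem_mk_left a b⟩
  have hx₀ : x₀ ∈ cover X := mem_cover.2 ⟨e, he, hx₀⟩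
  let T : (V → ZMod 2) →ₗ[ZMod 2] ((cover X).erase x₀ → ZMod 2) :=
    LinearMap.funLeft (ZMod 2) (ZMod 2) Subtype.val
  have hinj : Function.Injective (T.comp (incidenceSpan X).subtype) := by
    rw [← LinearMap.ker_eq_bot, LinearMap.ker_eq_bot']
    rintro ⟨f, hf⟩ h0
    have h1 : ∀ x, x ≠ x₀ → f x = 0 := by
      intro x hx
      by_cases hxc : x ∈ cover X
      · exact congr_fun h0 ⟨x, mem_erase.2 ⟨hx, hxc⟩⟩
      · exact apply_eq_zero_of_mem_incidenceSpan hf hxc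
    have h2 := sum_eq_zero_of_mem_incidenceSpan hf
    rw [Fintype.sum_eq_single x₀ h1] at h2
    ext x
    by_cases hx : x = x₀
    · rw [hx]; exact h2
    · exact h1 x hx
  have := LinearMap.finrank_le_finrank_of_injective hinj
  simp only [Module.finrank_fintype_fun_eq_card, Fintype.card_coe] at this
  rw [card_erase_of_mem hx₀] at this
  have hpos := card_pos.2 ⟨x₀, hx₀⟩
  simp only [graphicRank]
  omega

/-- Reduces the matroid condition to components. A largest Y ⊆ X with rank at least v(Y) - 1 shares
no vertex with the rest, since an edge touching it could be added. So ranks add up, and induction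
handles X \ Y. -/
lemma card_le_mul_graphicRank {N : ℕ} (X : Finset (Sym2 V)) (hl : ∀ e ∈ X, ¬ e.IsDiag)
    (hX : ∀ J ⊆ X, J.Nonempty → #J + N ≤ N * #(cover J)) : #X ≤ N * graphicRank X := by
  induction X using Finset.strongInduction with
  | H X ih =>
    rcases X.eq_empty_or_nonempty with rfl | ⟨e₀, he₀⟩
    · simp
    let T := X.powerset.filter fun Y => Y.Nonempty ∧ #(cover Y) ≤ graphicRank Y + 1
    have hstep : ∀ Y : Finset (Sym2 V), ∀ a b : V, s(a, b) ∈ X → a ∉ cover Y →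
        graphicRank Y + 1 ≤ graphicRank (insert s(a, b) Y) := by
      intro Y a b hab ha
      have hne : a ≠ b := by simpa using hl _ hab
      refine Submodule.finrank_lt_finrank_of_lt
        (lt_of_le_of_ne (incidenceSpan_mono (subset_insert _ _)) fun heq => ?_)
      have hmem : incidence s(a, b) ∈ incidenceSpan Y := by
        rw [heq]
        exact Submodule.subset_span ⟨_, by simp, rfl⟩
      have := apply_eq_zero_of_mem_incidenceSpan hmem ha
      simp [incidence_mk, hne] at this
    have hT : T.Nonempty := by
      refine ⟨{e₀}, ?_⟩
      simp only [T, mem_filter, mem_powerset, singleton_subset_iff, he₀, singleton_nonempty,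
        true_and, cover_singleton]
      induction e₀ with | _ a b
      have h1 := hstep ∅ a b he₀ (by simp)
      have h2 := card_toFinset_le_two s(a, b)
      rw [insert_empty] at h1
      omega
    obtain ⟨Y, hYT, hmax⟩ := exists_max_image T card hT
    obtain ⟨hYX, hYne, hYr⟩ : Y ⊆ X ∧ Y.Nonempty ∧ #(cover Y) ≤ graphicRank Y + 1 := by
      simpa [T] using hYT
    have hno : ∀ e ∈ X \ Y, ∀ x ∈ e, x ∉ cover Y := by
      intro e he x hx hxY
      obtain ⟨heX, heY⟩ := mem_sdiff.1 he
      obtain ⟨y, rfl⟩ := Sym2.mem_iff_exists.1 hx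
      have hcov : cover (insert s(x, y) Y) = insert y (cover Y) := by
        rw [insert_eq, cover_union, cover_singleton, Sym2.toFinset_mk_eq]
        ext z
        simp only [mem_union, mem_insert, mem_singleton]
        grind
      have hins : insert s(x, y) Y ∈ T := by
        simp only [T, mem_filter, mem_powerset, hcov]
        refine ⟨insert_subset heX hYX, insert_nonempty _ _, ?_⟩
        by_cases hy : y ∈ cover Y
        · rw [insert_eq_of_mem hy]
          refine hYr.trans ?_
          have := isRank_graphicRank.le_insert s(x, y) Y
          omega
        · rw [card_insert_of_notMem hy, Sym2.eq_swap]
          have := hstep Y y x (by rwa [Sym2.eq_swap]) hy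
          omega
      have := hmax _ hins
      rw [card_insert_of_notMem heY] at this
      omega
    have hrank : graphicRank Y + graphicRank (X \ Y) ≤ graphicRank X := by
      have h1 := Submodule.finrank_sup_add_finrank_inf_eq (incidenceSpan Y) (incidenceSpan (X \ Y))
      have h2 : incidenceSpan Y ⊓ incidenceSpan (X \ Y) = ⊥ := by
        rw [eq_bot_iff]
        rintro f ⟨hf1, hf2⟩
        rw [Submodule.mem_bot]
        ext x
        by_cases hx : x ∈ cover Y
        · refine apply_eq_zero_of_mem_incidenceSpan hf2 fun hx' => ?_
          obtain ⟨e, he, hxe⟩ := mem_cover.1 hx'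
          exact hno e he x hxe hx
        · exact apply_eq_zero_of_mem_incidenceSpan hf1 hx
      rw [← incidenceSpan_union, union_sdiff_of_subset hYX, h2, finrank_bot, add_zero] at h1
      exact h1.ge
    have h3 := ih (X \ Y) (sdiff_ssubset hYX hYne) (fun e he => hl e (mem_sdiff.1 he).1)
      fun J hJ => hX J (hJ.trans sdiff_subset)
    have h4 := hX Y hYX hYne
    have h5 := card_sdiff_add_card_eq_card hYX
    have h6 : N * #(cover Y) ≤ N * (graphicRank Y + 1) := Nat.mul_le_mul_left _ hYr
    have h7 : N * (graphicRank Y + graphicRank (X \ Y)) ≤ N * graphicRank X :=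
      Nat.mul_le_mul_left _ hrank
    rw [mul_add] at h6 h7
    omega

/-- The Nash-Williams arboricity theorem. -/
theorem exists_forest_colouring {N : ℕ} (E : Finset (Sym2 V)) (hl : ∀ e ∈ E, ¬ e.IsDiag)
    (hE : ∀ J ⊆ E, J.Nonempty → #J + N ≤ N * #(cover J)) :
    ∃ c : Sym2 V → ℕ, (∀ e ∈ E, c e < N) ∧
      ∀ s : Finset ℕ, ∀ J ⊆ E, (∀ e ∈ J, c e ∈ s) → #J ≤ #s * (#(cover J) - 1) := by
  obtain ⟨c, hcN, hc⟩ := exists_partition_of_rank (N := N) E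
    (fun _ X => (graphicRank X : ℤ)) (fun _ => isRank_graphicRank) (fun X hX => by
      have := card_le_mul_graphicRank X (fun e he => hl e (hX he)) fun J hJ => hE J (hJ.trans hX)
      simp only [sum_const, card_univ, Fintype.card_fin, nsmul_eq_mul]
      exact_mod_cast this)
  refine ⟨c, hcN, fun s J hJ hJs => ?_⟩
  rw [card_eq_sum_card_fiberwise (f := c) (t := s) (by exact hJs)]
  refine sum_le_card_nsmul _ _ _ fun i _ => ?_
  set K := J.filter fun e => c e = i with hK
  rcases K.eq_empty_or_nonempty with h0 | hne
  · simp [h0]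
  obtain ⟨e, he⟩ := hne
  have hiN : i < N := by
    rw [← (mem_filter.1 he).2]; exact hcN e (hJ (mem_filter.1 he).1)
  have h1 := hc ⟨i, hiN⟩
  have hsub : K ⊆ E.filter fun e => c e = i := filter_subset_filter _ hJ
  have h2 := isRank_graphicRank.le_add_card hsub
  simp only at h1 h2
  have h3 : (#((E.filter fun e => c e = i) \ K) : ℤ) + #K = #(E.filter fun e => c e = i) := by
    exact_mod_cast card_sdiff_add_card_eq_card hsub
  have h4 := graphicRank_add_one_le ⟨e, he⟩
  have hKJ : K ⊆ J := filter_subset _ _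
  have h5 := card_le_card (cover_mono hKJ)
  omega

end NashWilliams

/-! ### Decomposition into pseudoforests -/

section Hakimi

variable {V : Type*} [DecidableEq V]

/-- Hakimi's theorem on the decomposition of a graph into pseudoforests. -/
theorem exists_pseudoforest_colouring {N : ℕ} (E : Finset (Sym2 V))
    (hE : ∀ J ⊆ E, #J ≤ N * #(cover J)) :
    ∃ c : Sym2 V → ℕ, (∀ e ∈ E, c e < N) ∧
      ∀ s : Finset ℕ, ∀ J ⊆ E, (∀ e ∈ J, c e ∈ s) → #J ≤ #s * #(cover J) := by
  -- Hall's theorem assigns distinct pairs (endpoint, colour) to the edges. Within one colour the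
  -- edges then inject into their vertices.
  obtain ⟨f, hfinj, hf⟩ := (all_card_le_biUnion_card_iff_exists_injective
    (fun e : E => e.1.toFinset ×ˢ range N)).1 fun s => by
      have h1 : (s.biUnion fun e : E => e.1.toFinset ×ˢ range N) =
          cover (s.image Subtype.val) ×ˢ range N := by
        ext ⟨x, i⟩
        simp only [mem_biUnion, mem_product, mem_cover, mem_image, Sym2.mem_toFinset]
        grind
      rw [h1, card_product, card_range, mul_comm]
      refine le_trans (by rw [card_image_of_injective _ Subtype.val_injective])
        (hE (s.image Subtype.val) ?_)
      intro e he
      obtain ⟨e', _, rfl⟩ := mem_image.1 he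
      exact e'.2
  classical
  refine ⟨fun e => if h : e ∈ E then (f ⟨e, h⟩).2 else 0, fun e he => ?_, fun s J hJ hJs => ?_⟩
  · have := hf ⟨e, he⟩
    simp only [mem_product, mem_range] at this
    simpa [he] using this.2
  · have : #J ≤ #(s ×ˢ cover J) := by
      refine card_le_card_of_injOn
        (fun e => if h : e ∈ E then ((f ⟨e, h⟩).2, (f ⟨e, h⟩).1) else (0, e.out.1)) ?_ ?_
      · intro e he
        have h1 := hf ⟨e, hJ he⟩
        have h2 := hJs e he
        simp only [hJ he, dif_pos, mem_product, Sym2.mem_toFinset, coe_product,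
          Set.mem_prod, mem_coe] at h1 h2 ⊢
        exact ⟨h2, mem_cover.2 ⟨e, he, h1.1⟩⟩
      · intro e he e' he' hee
        simp only [hJ he, hJ he', dif_pos, Prod.mk.injEq] at hee
        have := hfinj (Prod.ext hee.2 hee.1)
        simpa using this
    rwa [card_product] at this

end Hakimi

end KohayakawaKreuter

namespace KohayakawaKreuter

open Finset

/-! ### Constructions along degenerate vertex orderings -/

section Degeneracy

variable {V : Type*} [DecidableEq V]

/-- The degree of a vertex in the graph with a given edge set. -/
def edgeDegree (J : Finset (Sym2 V)) (x : V) : ℕ := #(J.filter fun e => x ∈ e)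

lemma edgeDegree_mono {J K : Finset (Sym2 V)} (h : J ⊆ K) (x : V) :
    edgeDegree J x ≤ edgeDegree K x := card_le_card (filter_subset_filter _ h)

lemma sum_edgeDegree {J : Finset (Sym2 V)} (hJ : ∀ e ∈ J, ¬ e.IsDiag) :
    ∑ x ∈ cover J, edgeDegree J x = 2 * #J := by
  have h := sum_card_bipartiteAbove_eq_sum_card_bipartiteBelow (s := cover J) (t := J)
    fun x e => x ∈ e
  refine h.trans ?_
  rw [sum_const_nat (m := 2), mul_comm]
  intro e he
  rw [← Sym2.card_toFinset_of_not_isDiag e (hJ e he)]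
  congr 1
  ext x
  simp only [mem_bipartiteBelow, Sym2.mem_toFinset, and_iff_right_iff_imp]
  exact fun hx => mem_cover.2 ⟨e, he, hx⟩

lemma exists_edgeDegree_le {m : ℝ} {J : Finset (Sym2 V)} (hJ : ∀ e ∈ J, ¬ e.IsDiag)
    (hne : J.Nonempty) (hm : (#J : ℝ) ≤ m * #(cover J)) :
    ∃ x ∈ cover J, (edgeDegree J x : ℝ) ≤ 2 * m := by
  by_contra! hcon
  have h1 : ∑ x ∈ cover J, (2 * m) < ∑ x ∈ cover J, (edgeDegree J x : ℝ) := by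
    refine sum_lt_sum_of_nonempty ?_ hcon
    rw [← card_pos]
    exact lt_of_lt_of_le two_pos (two_le_card_cover hJ hne)
  have h2 : ∑ x ∈ cover J, (edgeDegree J x : ℝ) = 2 * #J := by exact_mod_cast sum_edgeDegree hJ
  rw [sum_const, nsmul_eq_mul, h2] at h1
  linarith

/-- The edges of `E` inside the vertex set `S`. -/
def edgesIn (E : Finset (Sym2 V)) (S : Finset V) : Finset (Sym2 V) :=
  E.filter fun e => e.toFinset ⊆ S

lemma mem_edgesIn {E : Finset (Sym2 V)} {S : Finset V} {x y : V} :
    s(x, y) ∈ edgesIn E S ↔ s(x, y) ∈ E ∧ x ∈ S ∧ y ∈ S := by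
  simp [edgesIn, Sym2.toFinset_mk_eq, insert_subset_iff]

lemma edgesIn_cover (E : Finset (Sym2 V)) : edgesIn E (cover E) = E :=
  filter_true_of_mem fun _ he => toFinset_subset_cover he

lemma edgesIn_mono (E : Finset (Sym2 V)) {S T : Finset V} (h : S ⊆ T) :
    edgesIn E S ⊆ edgesIn E T :=
  monotone_filter_right _ fun _ _ he => he.trans h

lemma mem_edgesIn_of_insert {E : Finset (Sym2 V)} {S : Finset V} {x : V} {e : Sym2 V}
    (he : e ∈ edgesIn E (insert x S)) (hx : x ∉ e) : e ∈ edgesIn E S := by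
  rw [edgesIn, mem_filter] at he ⊢
  refine ⟨he.1, fun y hy => (mem_insert.1 (he.2 hy)).resolve_left ?_⟩
  rintro rfl
  exact hx (Sym2.mem_toFinset.1 hy)

/-- Induction along a degenerate ordering of the vertices. -/
theorem vertex_induction {E : Finset (Sym2 V)} {d : ℕ}
    (hd : ∀ J ⊆ E, J.Nonempty → ∃ x ∈ cover J, edgeDegree J x ≤ d) {P : Finset V → Prop}
    (h0 : P ∅) (hstep : ∀ S x, x ∉ S → #(S.filter fun y => s(x, y) ∈ E) ≤ d → P S →
      P (insert x S)) (S : Finset V) : P S := by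
  induction S using Finset.strongInduction with
  | H S ih =>
    rcases S.eq_empty_or_nonempty with rfl | ⟨x₀, hx₀⟩
    · exact h0
    have hex : ∃ x ∈ S, edgeDegree (edgesIn E S) x ≤ d := by
      by_cases hne : (edgesIn E S).Nonempty
      · obtain ⟨x, hx, hxd⟩ := hd _ (filter_subset _ _) hne
        obtain ⟨e, he, hxe⟩ := mem_cover.1 hx
        exact ⟨x, (mem_filter.1 he).2 (Sym2.mem_toFinset.2 hxe), hxd⟩
      · refine ⟨x₀, hx₀, ?_⟩
        rw [not_nonempty_iff_eq_empty.1 hne]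
        simp [edgeDegree]
    obtain ⟨x, hx, hxd⟩ := hex
    have := hstep (S.erase x) x (by simp) ?_ (ih _ (erase_ssubset hx))
    · rwa [insert_erase hx] at this
    · refine le_trans (card_le_card_of_injOn (fun y => s(x, y)) ?_ ?_) hxd
      · intro y hy
        simp only [coe_filter, mem_erase, Set.mem_ofPred_eq] at hy
        simp only [coe_filter, Set.mem_ofPred_eq, mem_edgesIn]
        exact ⟨⟨hy.2, hx, hy.1.2⟩, Sym2.mem_mk_left x y⟩
      · intro y _ z _ hyz
        exact Sym2.congr_right.1 hyz

/-- A `(2k + 1)`-degenerate graph has a vertex bipartition with both parts `k`-degenerate. -/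
theorem exists_bipartition_of_degenerate {E : Finset (Sym2 V)} (hl : ∀ e ∈ E, ¬ e.IsDiag) {k : ℕ}
    (hd : ∀ J ⊆ E, J.Nonempty → ∃ x ∈ cover J, edgeDegree J x ≤ 2 * k + 1) :
    ∃ c : V → Bool, ∀ J ⊆ E, J.Nonempty → (∀ e ∈ J, ∀ x ∈ e, ∀ y ∈ e, c x = c y) →
      ∃ x ∈ cover J, edgeDegree J x ≤ k := by
  suffices h : ∀ S : Finset V, ∃ c : V → Bool, ∀ J ⊆ edgesIn E S, J.Nonempty →
      (∀ e ∈ J, ∀ x ∈ e, ∀ y ∈ e, c x = c y) → ∃ x ∈ cover J, edgeDegree J x ≤ k by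
    simpa only [edgesIn_cover] using h (cover E)
  refine vertex_induction hd ?_ ?_
  · refine ⟨fun _ => true, fun J hJ ⟨e, he⟩ => ?_⟩
    have := (mem_filter.1 (hJ he)).2
    exact absurd (subset_empty.1 this) (Sym2.toFinset_ne_empty e)
  rintro S x hxS hdeg ⟨c, hc⟩
  -- Of at most 2k + 1 earlier neighbours, at most k lie on one of the sides; x joins that side, so
  -- it has degree at most k in any J without crossing edges.
  obtain ⟨β, hβ⟩ : ∃ β : Bool, #(S.filter fun y => s(x, y) ∈ E ∧ c y = β) ≤ k := by
    by_contra! hcon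
    have h1 := hcon true
    have h2 := hcon false
    have h3 := card_filter_add_card_filter_not (s := S.filter fun y => s(x, y) ∈ E)
      fun y => c y = true
    simp only [filter_filter, Bool.not_eq_true] at h3
    omega
  refine ⟨Function.update c x β, fun J hJ hne hmono => ?_⟩
  by_cases hxJ : x ∈ cover J
  · refine ⟨x, hxJ, le_trans ?_ hβ⟩
    refine (card_le_card ?_).trans (card_image_le (f := fun y => s(x, y)))
    intro e he
    obtain ⟨heJ, hxe⟩ := mem_filter.1 he
    obtain ⟨y, rfl⟩ := Sym2.mem_iff_exists.1 hxe
    have hE := mem_edgesIn.1 (hJ heJ)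
    have hne : y ≠ x := by
      have := hl _ hE.1
      rw [Sym2.mk_isDiag_iff] at this
      exact Ne.symm this
    have hcol := hmono _ heJ x (Sym2.mem_mk_left x y) y (Sym2.mem_mk_right x y)
    rw [Function.update_self, Function.update_of_ne hne] at hcol
    exact mem_image.2 ⟨y, mem_filter.2 ⟨(mem_insert.1 hE.2.2).resolve_left hne, hE.1, hcol.symm⟩,
      rfl⟩
  · have hxe : ∀ e ∈ J, x ∉ e := fun e he hx => hxJ (mem_cover.2 ⟨e, he, hx⟩)
    refine hc J (fun e he => mem_edgesIn_of_insert (hJ he) (hxe e he)) hne fun e he y hy z hz => ?_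
    have := hmono e he y hy z hz
    rwa [Function.update_of_ne (by rintro rfl; exact hxe e he hy),
      Function.update_of_ne (by rintro rfl; exact hxe e he hz)] at this

/-- A `d`-degenerate graph is `(d + 1)`-colourable. -/
theorem exists_colouring_of_degenerate {E : Finset (Sym2 V)} (hl : ∀ e ∈ E, ¬ e.IsDiag) {d : ℕ}
    (hd : ∀ J ⊆ E, J.Nonempty → ∃ x ∈ cover J, edgeDegree J x ≤ d) :
    ∃ c : V → Fin (d + 1), ∀ x y, s(x, y) ∈ E → c x ≠ c y := by
  suffices h : ∀ S : Finset V, ∃ c : V → Fin (d + 1), ∀ x ∈ S, ∀ y ∈ S, s(x, y) ∈ E →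
      c x ≠ c y by
    obtain ⟨c, hc⟩ := h (cover E)
    exact ⟨c, fun x y hxy => hc x (mem_cover.2 ⟨_, hxy, Sym2.mem_mk_left x y⟩) y
      (mem_cover.2 ⟨_, hxy, Sym2.mem_mk_right x y⟩) hxy⟩
  refine vertex_induction hd ⟨fun _ => 0, by simp⟩ ?_
  rintro S x hxS hdeg ⟨c, hc⟩
  obtain ⟨β, -, hβ⟩ : ∃ β ∈ (univ : Finset (Fin (d + 1))),
      β ∉ (S.filter fun y => s(x, y) ∈ E).image c := by
    refine exists_mem_notMem_of_card_lt_card ?_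
    rw [card_univ, Fintype.card_fin]
    exact Nat.lt_succ_of_le (card_image_le.trans hdeg)
  have hβ' : ∀ y ∈ S, s(x, y) ∈ E → c y ≠ β := fun y hy hxy h =>
    hβ (mem_image.2 ⟨y, mem_filter.2 ⟨hy, hxy⟩, h⟩)
  refine ⟨Function.update c x β, fun y hy z hz hyz => ?_⟩
  have hne : y ≠ z := by simpa using hl _ hyz
  rcases mem_insert.1 hy with rfl | hyS
  · rw [Function.update_self, Function.update_of_ne hne.symm]
    exact (hβ' z ((mem_insert.1 hz).resolve_left hne.symm) hyz).symm
  · have hyx : y ≠ x := by rintro rfl; exact hxS hyS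
    rw [Function.update_of_ne hyx]
    rcases mem_insert.1 hz with rfl | hzS
    · rw [Function.update_self]
      exact hβ' y hyS (by rwa [Sym2.eq_swap])
    · rw [Function.update_of_ne (by rintro rfl; exact hxS hzS)]
      exact hc y hyS z hzS hyz

/-- All pairs of distinct elements of `A` are in `R`. -/
def IsCliqueIn (R : Finset (Sym2 V)) (A : Finset V) : Prop :=
  ∀ x ∈ A, ∀ y ∈ A, x ≠ y → s(x, y) ∈ R

/-- An `a`-degenerate graph can be made `K_a`-free by the removal of a forest. -/
theorem exists_forest_compl_cliqueFree {E : Finset (Sym2 V)} (hl : ∀ e ∈ E, ¬ e.IsDiag) {a : ℕ}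
    (ha : 3 ≤ a) (hd : ∀ J ⊆ E, J.Nonempty → ∃ x ∈ cover J, edgeDegree J x ≤ a) :
    ∃ R ⊆ E, (∀ A : Finset V, #A = a → ¬ IsCliqueIn R A) ∧
      ∀ J ⊆ E \ R, J.Nonempty → #J + 1 ≤ #(cover J) := by
  suffices h : ∀ S : Finset V, ∃ R ⊆ edgesIn E S, (∀ A : Finset V, #A = a → ¬ IsCliqueIn R A) ∧
      ∀ J ⊆ edgesIn E S \ R, J.Nonempty → #J + 1 ≤ #(cover J) by
    simpa only [edgesIn_cover] using h (cover E)
  refine vertex_induction hd ?_ ?_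
  · refine ⟨∅, empty_subset _, fun A hA hcl => ?_, fun J hJ ⟨e, he⟩ => ?_⟩
    · obtain ⟨x, hx, y, hy, hxy⟩ := one_lt_card.1 (by omega : 1 < #A)
      exact notMem_empty _ (hcl x hx y hy hxy)
    · have := (mem_filter.1 (mem_sdiff.1 (hJ he)).1).2
      exact absurd (subset_empty.1 this) (Sym2.toFinset_ne_empty e)
  rintro S x hxS hdeg ⟨R, hRS, hRA, hB⟩
  set D := S.filter fun y => s(x, y) ∈ E with hD
  have hxR : ∀ e ∈ R, x ∉ e := fun e he hx =>
    hxS ((mem_filter.1 (hRS he)).2 (Sym2.mem_toFinset.2 hx))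
  have hnew : ∀ e ∈ edgesIn E (insert x S), x ∈ e → ∃ y ∈ D, e = s(x, y) := by
    intro e he hxe
    obtain ⟨y, rfl⟩ := Sym2.mem_iff_exists.1 hxe
    have hE := mem_edgesIn.1 he
    have hne : y ≠ x := by
      have := hl _ hE.1
      rw [Sym2.mk_isDiag_iff] at this
      exact Ne.symm this
    exact ⟨y, mem_filter.2 ⟨(mem_insert.1 hE.2.2).resolve_left hne, hE.1⟩, rfl⟩
  rcases D.eq_empty_or_nonempty with hD0 | hDne
  · have hEq : edgesIn E (insert x S) = edgesIn E S := by
      refine Subset.antisymm (fun e he => mem_edgesIn_of_insert he fun hxe => ?_)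
        (edgesIn_mono E (subset_insert x S))
      obtain ⟨y, hy, -⟩ := hnew e he hxe
      simp [hD0] at hy
    exact ⟨R, hEq ▸ hRS, hRA, hEq ▸ hB⟩
  -- The edge xy goes to the forest, the other edges at x to R, so no K_a through x may arise. If no
  -- y works, then D has a elements and every D without y is a clique. As a ≥ 3, each pair in D
  -- avoids some y, so D itself is a K_a in R.
  obtain ⟨y, hyD, hy⟩ : ∃ y ∈ D, ∀ B ⊆ D.erase y, #B = a - 1 → ¬ IsCliqueIn R B := by
    by_contra! hcon
    obtain ⟨y₀, hy₀⟩ := hDne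
    obtain ⟨B₀, hB₀, hB₀c, -⟩ := hcon y₀ hy₀
    have h1 := card_le_card hB₀
    have h2 := card_erase_add_one hy₀
    have hDa : #D = a := by omega
    refine hRA D hDa fun u hu w hw huw => ?_
    obtain ⟨y, hyD, hyuw⟩ : ∃ y ∈ D, y ∉ ({u, w} : Finset V) :=
      exists_mem_notMem_of_card_lt_card (card_le_two.trans_lt (by omega))
    obtain ⟨B, hBD, hBc, hBcl⟩ := hcon y hyD
    have hBeq : B = D.erase y := eq_of_subset_of_card_le hBD (by
      rw [card_erase_of_mem hyD]; omega)
    simp only [mem_insert, mem_singleton, not_or] at hyuw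
    exact hBcl u (hBeq ▸ mem_erase.2 ⟨Ne.symm hyuw.1, hu⟩) w
      (hBeq ▸ mem_erase.2 ⟨Ne.symm hyuw.2, hw⟩) huw
  have hyx : y ≠ x := by rintro rfl; exact hxS (mem_filter.1 hyD).1
  refine ⟨R ∪ (D.erase y).image fun z => s(x, z), union_subset
    (hRS.trans (edgesIn_mono E (subset_insert x S))) ?_, fun A hA hcl => ?_, fun J hJ hne => ?_⟩
  · intro e he
    obtain ⟨z, hz, rfl⟩ := mem_image.1 he
    have := mem_filter.1 (mem_of_mem_erase hz)
    exact mem_edgesIn.2 ⟨this.2, mem_insert_self _ _, mem_insert_of_mem this.1⟩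
  · have hRmem : ∀ u w, u ≠ x → w ≠ x →
        s(u, w) ∈ R ∪ (D.erase y).image (fun z => s(x, z)) → s(u, w) ∈ R := by
      intro u w hu hw h
      rcases mem_union.1 h with h | h
      · exact h
      · obtain ⟨z, _, hz⟩ := mem_image.1 h
        rcases Sym2.eq_iff.1 hz with ⟨h1, _⟩ | ⟨h1, _⟩
        · exact absurd h1.symm hu
        · exact absurd h1.symm hw
    by_cases hxA : x ∈ A
    · refine hy (A.erase x) (fun u hu => ?_) (by rw [card_erase_of_mem hxA, hA]) ?_
      · obtain ⟨hux, huA⟩ := mem_erase.1 hu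
        rcases mem_union.1 (hcl x hxA u huA hux.symm) with h | h
        · exact absurd (Sym2.mem_mk_left x u) (hxR _ h)
        · obtain ⟨z, hz, hzu⟩ := mem_image.1 h
          rwa [← Sym2.congr_right.1 hzu]
      · intro u hu w hw huw
        exact hRmem u w (ne_of_mem_erase hu) (ne_of_mem_erase hw)
          (hcl u (mem_of_mem_erase hu) w (mem_of_mem_erase hw) huw)
    · refine hRA A hA fun u hu w hw huw => hRmem u w ?_ ?_ (hcl u hu w hw huw)
      · rintro rfl; exact hxA hu
      · rintro rfl; exact hxA hw
  · have hJ' : J.erase s(x, y) ⊆ edgesIn E S \ R := by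
      intro e he
      obtain ⟨hne, heJ⟩ := mem_erase.1 he
      obtain ⟨heE, heR⟩ := mem_sdiff.1 (hJ heJ)
      rw [mem_union, not_or] at heR
      refine mem_sdiff.2 ⟨mem_edgesIn_of_insert heE fun hxe => ?_, heR.1⟩
      obtain ⟨z, hz, rfl⟩ := hnew e heE hxe
      have hzy : z ≠ y := by rintro rfl; exact hne rfl
      exact heR.2 (mem_image.2 ⟨z, mem_erase.2 ⟨hzy, hz⟩, rfl⟩)
    -- Then x is a leaf of J.
    by_cases hxy : s(x, y) ∈ J
    · have hxc : x ∉ cover (J.erase s(x, y)) := by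
        intro hx
        obtain ⟨e, he, hxe⟩ := mem_cover.1 hx
        exact hxS ((mem_filter.1 (mem_sdiff.1 (hJ' he)).1).2 (Sym2.mem_toFinset.2 hxe))
      have hins : insert x (cover (J.erase s(x, y))) ⊆ cover J := insert_subset
        (mem_cover.2 ⟨_, hxy, Sym2.mem_mk_left x y⟩) (cover_mono (erase_subset _ _))
      have h1 := card_le_card hins
      rw [card_insert_of_notMem hxc] at h1
      have h2 := card_erase_add_one hxy
      rcases (J.erase s(x, y)).eq_empty_or_nonempty with h0 | h0
      · have h3 : #J = 1 := by rw [← h2, h0]; rfl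
        rw [h3]
        have hlJ : ∀ e ∈ J, ¬ e.IsDiag := fun e he =>
          hl e (mem_filter.1 (mem_sdiff.1 (hJ he)).1).1
        exact two_le_card_cover hlJ hne
      · have := hB _ hJ' h0
        omega
    · rw [erase_eq_of_notMem hxy] at hJ'
      exact hB J hJ' hne

end Degeneracy

end KohayakawaKreuter

namespace KohayakawaKreuter

open Finset

/-! ### Elementary edge and degree counts -/

section Counting

variable {V : Type*} [DecidableEq V]

lemma subset_image_offDiag_cover {J : Finset (Sym2 V)} (hJ : ∀ e ∈ J, ¬ e.IsDiag) :
    J ⊆ (cover J).offDiag.image fun x => s(x.1, x.2) := by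
  intro e he
  induction e with | _ a b
  refine mem_image.2 ⟨(a, b), mem_offDiag.2 ⟨mem_cover.2 ⟨_, he, Sym2.mem_mk_left a b⟩,
    mem_cover.2 ⟨_, he, Sym2.mem_mk_right a b⟩, by simpa using hJ _ he⟩, rfl⟩

lemma card_le_choose {J : Finset (Sym2 V)} (hJ : ∀ e ∈ J, ¬ e.IsDiag) :
    #J ≤ (#(cover J)).choose 2 := by
  rw [← Sym2.card_image_offDiag]
  exact card_le_card (subset_image_offDiag_cover hJ)

lemma two_mul_card_le {J : Finset (Sym2 V)} (hJ : ∀ e ∈ J, ¬ e.IsDiag) :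
    2 * (#J : ℝ) ≤ #(cover J) * ((#(cover J) : ℝ) - 1) := by
  have h1 : (#J : ℝ) ≤ ((#(cover J)).choose 2 : ℕ) := by exact_mod_cast card_le_choose hJ
  rw [Nat.cast_choose_two] at h1
  linarith

lemma isCliqueIn_cover {J : Finset (Sym2 V)} (hJ : ∀ e ∈ J, ¬ e.IsDiag)
    (h : (#(cover J)).choose 2 ≤ #J) : IsCliqueIn J (cover J) := by
  rw [← Sym2.card_image_offDiag] at h
  have heq := eq_of_subset_of_card_le (subset_image_offDiag_cover hJ) h
  intro x hx y hy hxy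
  rw [heq]
  exact mem_image.2 ⟨(x, y), mem_offDiag.2 ⟨hx, hy, hxy⟩, rfl⟩

/-- The vertices can be 2-coloured so that no edge of `J` is monochromatic. -/
def IsBipartiteSet (J : Finset (Sym2 V)) : Prop :=
  ∃ c : V → Bool, ∀ x y, s(x, y) ∈ J → c x ≠ c y

lemma IsBipartiteSet.four_mul_card_le {J : Finset (Sym2 V)} (h : IsBipartiteSet J) :
    4 * (#J : ℝ) ≤ (#(cover J) : ℝ) ^ 2 := by
  obtain ⟨c, hc⟩ := h
  set P := (cover J).filter fun x => c x = true
  set Q := (cover J).filter fun x => ¬ c x = true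
  have hPQ : (#P : ℝ) + #Q = #(cover J) := by
    exact_mod_cast card_filter_add_card_filter_not (s := cover J) fun x => c x = true
  have hsub : J ⊆ (P ×ˢ Q).image fun x => s(x.1, x.2) := by
    intro e he
    induction e with | _ a b
    have ha : a ∈ cover J := mem_cover.2 ⟨_, he, Sym2.mem_mk_left a b⟩
    have hb : b ∈ cover J := mem_cover.2 ⟨_, he, Sym2.mem_mk_right a b⟩
    have hab := hc a b he
    by_cases hca : c a = true
    · exact mem_image.2 ⟨(a, b), mem_product.2 ⟨mem_filter.2 ⟨ha, hca⟩,
        mem_filter.2 ⟨hb, fun h => hab (hca.trans h.symm)⟩⟩, rfl⟩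
    · refine mem_image.2 ⟨(b, a), mem_product.2 ⟨mem_filter.2 ⟨hb, ?_⟩,
        mem_filter.2 ⟨ha, hca⟩⟩, Sym2.eq_swap⟩
      revert hab hca
      cases c a <;> cases c b <;> simp
  have hle : (#J : ℝ) ≤ #P * #Q := by
    exact_mod_cast (card_le_card hsub).trans (card_image_le.trans (card_product P Q).le)
  nlinarith [sq_nonneg ((#P : ℝ) - #Q)]

lemma edgeDegree_add {J K : Finset (Sym2 V)} (x : V) :
    edgeDegree (J ∪ K) x + edgeDegree (J ∩ K) x = edgeDegree J x + edgeDegree K x := by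
  rw [edgeDegree, edgeDegree, filter_union, filter_inter_distrib]
  exact card_union_add_card_inter _ _

lemma card_eq_edgeDegree_add (F : Finset (Sym2 V)) (x : V) :
    #F = edgeDegree F x + #(F.filter fun e => x ∉ e) :=
  (card_filter_add_card_filter_not _).symm

lemma card_cover_filter_notMem_lt {F : Finset (Sym2 V)} {x : V} (hx : x ∈ cover F) :
    #(cover (F.filter fun e => x ∉ e)) + 1 ≤ #(cover F) := by
  refine card_lt_card ((ssubset_iff_of_subset (cover_mono (filter_subset _ _))).2 ⟨x, hx, ?_⟩)
  intro h
  obtain ⟨e, he, hxe⟩ := mem_cover.1 h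
  exact (mem_filter.1 he).2 hxe

lemma filter_notMem_ne {F : Finset (Sym2 V)} {x : V} (hx : x ∈ cover F) :
    F.filter (fun e => x ∉ e) ≠ F := by
  intro h
  obtain ⟨e, he, hxe⟩ := mem_cover.1 hx
  exact filter_eq_self.1 h e he hxe

end Counting

/-! ### Degrees and edge numbers of balanced sets -/

section Balanced

variable {V : Type*} [DecidableEq V] {m μ ε : ℝ} {F : Finset (Sym2 V)}

lemma TwoBalanced.card_eq (h : TwoBalanced μ ε F) (hμ : 0 < μ) :
    (#F : ℝ) = μ * (#(cover F) - 2) + 1 := by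
  have := h.weight_eq
  rw [weight] at this
  field_simp at this
  linarith

lemma TwoBalanced.three_le_real (h : TwoBalanced μ ε F) : (3 : ℝ) ≤ #(cover F) := by
  exact_mod_cast h.three_le

lemma TwoBalanced.nonempty (h : TwoBalanced μ ε F) : F.Nonempty := by
  rw [nonempty_iff_ne_empty]
  rintro rfl
  have := h.three_le
  simp at this

lemma TwoBalanced.card_cover_le (h : TwoBalanced μ ε F) (hμ : 1 < μ) : #(cover F) ≤ #F := by
  have h1 := h.card_eq (by linarith)
  have h3 := h.three_le_real
  have : (#(cover F) : ℝ) < #F + 1 := by nlinarith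
  exact Nat.lt_succ_iff.1 (by exact_mod_cast this)

/-- Deleting x removes at least one vertex without lowering the weight below that of F, so deg(x)/μ
≥ 1 when edges remain; the other case is a direct count. -/
lemma TwoBalanced.le_edgeDegree (h : TwoBalanced μ ε F) (hε : 0 < ε) (hμ : 1 < μ) {x : V}
    (hx : x ∈ cover F) : μ ≤ edgeDegree F x := by
  have h0 : 0 < μ := by linarith
  have h1 := h.card_eq h0
  have h3 := h.three_le_real
  have h4 : (#F : ℝ) = edgeDegree F x + #(F.filter fun e => x ∉ e) := by
    exact_mod_cast card_eq_edgeDegree_add F x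
  have h5 : (#(cover (F.filter fun e => x ∉ e)) : ℝ) + 1 ≤ #(cover F) := by
    exact_mod_cast card_cover_filter_notMem_lt hx
  set J := F.filter fun e => x ∉ e
  rcases J.eq_empty_or_nonempty with hJ | hJ
  · rw [hJ] at h4
    simp only [card_empty, Nat.cast_zero, add_zero] at h4
    nlinarith
  · have h6 := h.le_weight hε (filter_subset _ _ : J ⊆ F) hJ
    rw [weight] at h6
    field_simp at h6
    nlinarith

/-- Four vertices are needed for strictness: in a triangle both μ and all degrees equal 2. -/
lemma TwoBalanced.lt_edgeDegree (h : TwoBalanced μ ε F) (hε : 0 < ε) (hμ : 1 < μ)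
    (hv : 4 ≤ #(cover F)) {x : V} (hx : x ∈ cover F) : μ < edgeDegree F x := by
  have h0 : 0 < μ := by linarith
  have h1 := h.card_eq h0
  have h3 : (4 : ℝ) ≤ #(cover F) := by exact_mod_cast hv
  have h4 : (#F : ℝ) = edgeDegree F x + #(F.filter fun e => x ∉ e) := by
    exact_mod_cast card_eq_edgeDegree_add F x
  have h5 : (#(cover (F.filter fun e => x ∉ e)) : ℝ) + 1 ≤ #(cover F) := by
    exact_mod_cast card_cover_filter_notMem_lt hx
  have hne := filter_notMem_ne hx
  have hJF : (F.filter fun e => x ∉ e) ⊆ F := filter_subset _ _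
  set J := F.filter fun e => x ∉ e
  rcases J.eq_empty_or_nonempty with hJ | hJ
  · rw [hJ] at h4
    simp only [card_empty, Nat.cast_zero, add_zero] at h4
    nlinarith
  by_cases hc : 3 ≤ #(cover J)
  · have h6 := h.weight_ge J hJF hne hc
    rw [weight] at h6
    have h7 : 2 - 1 / μ < #(cover J) - #J / μ := by linarith
    field_simp at h7
    nlinarith
  · have h6 := card_eq_one_of_card_cover_le_two (fun e he => h.loopless e (hJF he)) hJ (by omega)
    rw [h6] at h4
    push_cast at h4
    nlinarith

lemma TwoBalanced.two_le_edgeDegree (h : TwoBalanced μ ε F) (hε : 0 < ε) (hμ : 1 < μ) {x : V}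
    (hx : x ∈ cover F) : 2 ≤ edgeDegree F x := by
  have h1 := h.le_edgeDegree hε hμ hx
  have h2 : (1 : ℝ) < edgeDegree F x := by linarith
  exact_mod_cast h2

lemma PairBalanced.card_eq (h : PairBalanced m μ ε F) (hm : 0 < m) :
    (#F : ℝ) = m * (#(cover F) - 2) + m / μ := by
  have := h.weight_eq
  rw [weight] at this
  have h2 : (#F : ℝ) = m * (#F / m) := by field_simp
  rw [h2, show (#F : ℝ) / m = #(cover F) - (2 - 1 / μ) by linarith]
  ring

lemma PairBalanced.three_le (h : PairBalanced m μ ε F) (hμ : 1 < μ) (hm : μ < m) :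
    3 ≤ #(cover F) := by
  have h1 := h.card_eq (by linarith)
  have h2 : 1 < m / μ := by rwa [one_lt_div (by linarith)]
  by_contra hc
  rcases F.eq_empty_or_nonempty with rfl | hF
  · have := h.weight_eq
    simp only [weight, cover_empty, card_empty, CharP.cast_eq_zero, zero_div, sub_zero] at this
    have : 1 / μ < 1 := by rwa [div_lt_one (by linarith)]
    linarith
  · have h3 := card_eq_one_of_card_cover_le_two h.loopless hF (by omega)
    have h4 := two_le_card_cover h.loopless hF
    have h5 : #(cover F) = 2 := by omega
    rw [h3, h5] at h1
    push_cast at h1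
    linarith

lemma PairBalanced.nonempty (h : PairBalanced m μ ε F) (hμ : 1 < μ) (hm : μ < m) :
    F.Nonempty := by
  rw [nonempty_iff_ne_empty]
  rintro rfl
  have := h.three_le hμ hm
  simp at this

lemma PairBalanced.lt_edgeDegree (h : PairBalanced m μ ε F) (hε : 0 < ε) (hμ : 1 < μ)
    (hm : μ < m) {x : V} (hx : x ∈ cover F) : m < edgeDegree F x := by
  have h0 : 0 < m := by linarith
  have h1 := h.card_eq h0
  have h2 : 1 < m / μ := by rwa [one_lt_div (by linarith)]
  have h3 : (3 : ℝ) ≤ #(cover F) := by exact_mod_cast h.three_le hμ hm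
  have h4 : (#F : ℝ) = edgeDegree F x + #(F.filter fun e => x ∉ e) := by
    exact_mod_cast card_eq_edgeDegree_add F x
  have h5 : (#(cover (F.filter fun e => x ∉ e)) : ℝ) + 1 ≤ #(cover F) := by
    exact_mod_cast card_cover_filter_notMem_lt hx
  have hne := filter_notMem_ne hx
  have hJF : (F.filter fun e => x ∉ e) ⊆ F := filter_subset _ _
  set J := F.filter fun e => x ∉ e
  rcases J.eq_empty_or_nonempty with hJ | hJ
  · rw [hJ] at h4
    simp only [card_empty, Nat.cast_zero, add_zero] at h4
    nlinarith
  · have h6 := h.weight_ge J hJF hne hJ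
    rw [weight] at h6
    have h7 : (#J : ℝ) / m < #(cover J) - 2 + 1 / μ := by linarith
    rw [div_lt_iff₀ h0] at h7
    have h8 : m / μ = 1 / μ * m := by ring
    nlinarith

/-- Compare m(v - 2) + 1 < e with 2e ≤ v(v - 1) and divide v(v - 1) - 2 = (v - 2)(v + 1) by v - 2.
-/
lemma PairBalanced.two_mul_lt (h : PairBalanced m μ ε F) (hμ : 1 < μ) (hm : μ < m) :
    2 * m < #(cover F) + 1 := by
  have h1 := h.card_eq (by linarith)
  have h2 : 1 < m / μ := by rwa [one_lt_div (by linarith)]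
  have h3 : (3 : ℝ) ≤ #(cover F) := by exact_mod_cast h.three_le hμ hm
  have h4 := two_mul_card_le h.loopless
  nlinarith

/-- With t = 1/μ the claim is 2m(1 - t) ≤ v - 1. From 2μ < 2m < v + 1 one gets (1 - t)v ≤ v - 2 + t,
hence 2m(1 - t)v ≤ 2e ≤ v(v - 1). -/
lemma PairBalanced.half_le (h : PairBalanced m μ ε F) (hμ : 1 < μ) (hm : μ < m) :
    (m - 1 / 2) * (#(cover F) - 1) ≤ #F := by
  have h0 : 0 < m := by linarith
  have hμ0 : 0 < μ := by linarith
  have h1 := h.card_eq h0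
  have h3 : (3 : ℝ) ≤ #(cover F) := by exact_mod_cast h.three_le hμ hm
  have h4 := two_mul_card_le h.loopless
  have h5 := h.two_mul_lt hμ hm
  set v : ℝ := (#(cover F) : ℝ)
  set t := 1 / μ with ht
  have htμ : t * μ = 1 := by rw [ht]; field_simp
  have ht0 : 0 < t := by positivity
  have hmt : m / μ = m * t := by rw [ht]; ring
  rw [hmt] at h1
  rw [h1] at h4 ⊢
  have h6 : 2 ≤ t * (v + 1) := by nlinarith
  have h7 : 2 * m * (1 - t) * v ≤ (v - 1) * v := by nlinarith
  have h8 : 2 * m * (1 - t) ≤ v - 1 := le_of_mul_le_mul_right h7 (by linarith)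
  nlinarith

end Balanced

/-! ### Colouring sparse edge sets -/

section Colourings

variable {V : Type*} [DecidableEq V] {m μ ε : ℝ} {fam : Finset (Bool × Finset (Sym2 V))}

lemma colourable_of_forall {R : Finset (Sym2 V)} (h1 : ∀ F, (true, F) ∈ fam → F ⊆ R → False)
    (h2 : ∀ F, (false, F) ∈ fam → F ⊆ edges fam \ R → False) : Colourable fam :=
  ⟨R, fun F => ⟨fun hF hFR => h1 F hF hFR, fun hF hd => h2 F hF fun _ he =>
    mem_sdiff.2 ⟨subset_edges hF he, Finset.disjoint_left.1 hd he⟩⟩⟩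

lemma exists_edgeDegree_le_nat {E : Finset (Sym2 V)} (hl : ∀ e ∈ E, ¬ e.IsDiag)
    (hs : ∀ J ⊆ E, (#J : ℝ) ≤ m * #(cover J)) {d : ℕ} (hd : 2 * m < d + 1) :
    ∀ J ⊆ E, J.Nonempty → ∃ x ∈ cover J, edgeDegree J x ≤ d := by
  intro J hJ hne
  obtain ⟨x, hx, h⟩ := exists_edgeDegree_le (fun e he => hl e (hJ he)) hne (hs J hJ)
  refine ⟨x, hx, Nat.lt_succ_iff.1 ?_⟩
  have : (edgeDegree J x : ℝ) < d + 1 := by linarith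
  exact_mod_cast this

/-- Average degree at most 2m < 2⌊m⌋ + 2 makes E (2⌊m⌋ + 1)-degenerate. K consists of the edges
inside the two ⌊m⌋-degenerate parts, its complement of the edges between them. -/
lemma exists_split_of_floor {E : Finset (Sym2 V)} (hl : ∀ e ∈ E, ¬ e.IsDiag)
    (hs : ∀ J ⊆ E, (#J : ℝ) ≤ m * #(cover J)) (hm : 0 ≤ m) :
    ∃ K ⊆ E, (∀ F ⊆ K, F.Nonempty → ∃ x ∈ cover F, (edgeDegree F x : ℝ) ≤ m) ∧
      ∀ F ⊆ E \ K, IsBipartiteSet F := by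
  have hfl := Nat.lt_floor_add_one m
  obtain ⟨c, hc⟩ := exists_bipartition_of_degenerate hl (k := ⌊m⌋₊)
    (exists_edgeDegree_le_nat hl hs (by push_cast; linarith))
  refine ⟨E.filter fun e => ∀ x ∈ e.toFinset, ∀ y ∈ e.toFinset, c x = c y, filter_subset _ _,
    fun F hF hne => ?_, fun F hF => ⟨c, fun x y hxy hcxy => ?_⟩⟩
  · obtain ⟨x, hx, hdeg⟩ := hc F (hF.trans (filter_subset _ _)) hne fun e he x hx y hy =>
      (mem_filter.1 (hF he)).2 x (Sym2.mem_toFinset.2 hx) y (Sym2.mem_toFinset.2 hy)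
    exact ⟨x, hx, (Nat.cast_le.2 hdeg).trans (Nat.floor_le hm)⟩
  · obtain ⟨h1, h2⟩ := mem_sdiff.1 (hF hxy)
    refine h2 (mem_filter.2 ⟨h1, ?_⟩)
    simp only [Sym2.toFinset_mk_eq, mem_insert, mem_singleton]
    rintro _ (rfl | rfl) _ (rfl | rfl) <;> simp [hcxy]

lemma colourable_of_blue_not_bipartite (hl : ∀ e ∈ edges fam, ¬ e.IsDiag)
    (hs : ∀ J ⊆ edges fam, (#J : ℝ) ≤ m * #(cover J)) (hm : 0 ≤ m)
    (hred : ∀ F, (true, F) ∈ fam → F.Nonempty ∧ ∀ x ∈ cover F, m < edgeDegree F x)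
    (hblue : ∀ F, (false, F) ∈ fam → ¬ IsBipartiteSet F) : Colourable fam := by
  obtain ⟨K, hK, h1, h2⟩ := exists_split_of_floor hl hs hm
  refine colourable_of_forall (R := K) (fun F hF hFK => ?_) fun F hF hFK => hblue F hF (h2 F hFK)
  obtain ⟨x, hx, hdeg⟩ := h1 F hFK (hred F hF).1
  exact absurd ((hred F hF).2 x hx) (not_lt.2 hdeg)

lemma colourable_of_red_not_bipartite (hl : ∀ e ∈ edges fam, ¬ e.IsDiag)
    (hs : ∀ J ⊆ edges fam, (#J : ℝ) ≤ m * #(cover J)) (hm : 0 ≤ m)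
    (hblue : ∀ F, (false, F) ∈ fam → F.Nonempty ∧ ∀ x ∈ cover F, m < edgeDegree F x)
    (hred : ∀ F, (true, F) ∈ fam → ¬ IsBipartiteSet F) : Colourable fam := by
  obtain ⟨K, hK, h1, h2⟩ := exists_split_of_floor hl hs hm
  refine colourable_of_forall (R := edges fam \ K) (fun F hF hFK => hred F hF (h2 F hFK))
    fun F hF hFK => ?_
  rw [Finset.sdiff_sdiff_eq_self hK] at hFK
  obtain ⟨x, hx, hdeg⟩ := h1 F hFK (hblue F hF).1
  exact absurd ((hblue F hF).2 x hx) (not_lt.2 hdeg)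

/-- For v ≥ 2N, sparsity gives e ≤ (N - 1/2)v ≤ N(v - 1); for smaller v, e ≤ v(v - 1)/2 is enough.
This is where the 1/2 in the forest conditions comes from. -/
lemma card_add_le_of_le_sub_half {E : Finset (Sym2 V)} (hl : ∀ e ∈ E, ¬ e.IsDiag)
    (hs : ∀ J ⊆ E, (#J : ℝ) ≤ m * #(cover J)) {N : ℕ} (hN : m ≤ N - 1 / 2) :
    ∀ J ⊆ E, J.Nonempty → #J + N ≤ N * #(cover J) := by
  intro J hJ hne
  have hlJ : ∀ e ∈ J, ¬ e.IsDiag := fun e he => hl e (hJ he)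
  have h1 := hs J hJ
  have h2 := two_mul_card_le hlJ
  have h3 : (2 : ℝ) ≤ #(cover J) := by exact_mod_cast two_le_card_cover hlJ hne
  have : (#J : ℝ) + N ≤ N * #(cover J) := by
    rcases le_total (2 * (N : ℝ)) #(cover J) with h | h <;> nlinarith
  exact_mod_cast this

lemma colourable_of_forests [Fintype V] (hl : ∀ e ∈ edges fam, ¬ e.IsDiag)
    (hs : ∀ J ⊆ edges fam, (#J : ℝ) ≤ m * #(cover J)) {a b : ℕ} (hm : m ≤ (a + b : ℕ) - 1 / 2)
    (hred : ∀ F, (true, F) ∈ fam → ∃ J ⊆ F, a * (#(cover J) - 1) < #J)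
    (hblue : ∀ F, (false, F) ∈ fam → ∃ J ⊆ F, b * (#(cover J) - 1) < #J) : Colourable fam := by
  obtain ⟨c, hc, hcs⟩ := exists_forest_colouring _ hl (card_add_le_of_le_sub_half hl hs hm)
  refine colourable_of_forall (R := (edges fam).filter fun e => c e < a)
    (fun F hF hFR => ?_) fun F hF hFR => ?_
  · obtain ⟨J, hJ, hlt⟩ := hred F hF
    have hJR := hJ.trans hFR
    have := hcs (range a) J (hJR.trans (filter_subset _ _)) fun e he =>
      mem_range.2 (mem_filter.1 (hJR he)).2
    rw [card_range] at this
    omega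
  · obtain ⟨J, hJ, hlt⟩ := hblue F hF
    have hJR := hJ.trans hFR
    have := hcs (Ico a (a + b)) J (hJR.trans sdiff_subset) fun e he => by
      obtain ⟨h1, h2⟩ := mem_sdiff.1 (hJR he)
      have := hc e h1
      simp only [mem_filter, h1, true_and] at h2
      rw [mem_Ico]
      omega
    rw [Nat.card_Ico, Nat.add_sub_cancel_left] at this
    omega

lemma colourable_of_pseudoforests
    (hs : ∀ J ⊆ edges fam, (#J : ℝ) ≤ m * #(cover J)) {a b : ℕ} (hm : m ≤ (a + b : ℕ))
    (hred : ∀ F, (true, F) ∈ fam → ∃ J ⊆ F, a * #(cover J) < #J)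
    (hblue : ∀ F, (false, F) ∈ fam → ∃ J ⊆ F, b * #(cover J) < #J) : Colourable fam := by
  obtain ⟨c, hc, hcs⟩ := exists_pseudoforest_colouring (N := a + b) (edges fam) fun J hJ => by
    have : (#J : ℝ) ≤ (a + b : ℕ) * #(cover J) := (hs J hJ).trans (by gcongr)
    exact_mod_cast this
  refine colourable_of_forall (R := (edges fam).filter fun e => c e < a)
    (fun F hF hFR => ?_) fun F hF hFR => ?_
  · obtain ⟨J, hJ, hlt⟩ := hred F hF
    have hJR := hJ.trans hFR
    have := hcs (range a) J (hJR.trans (filter_subset _ _)) fun e he =>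
      mem_range.2 (mem_filter.1 (hJR he)).2
    rw [card_range] at this
    omega
  · obtain ⟨J, hJ, hlt⟩ := hblue F hF
    have hJR := hJ.trans hFR
    have := hcs (Ico a (a + b)) J (hJR.trans sdiff_subset) fun e he => by
      obtain ⟨h1, h2⟩ := mem_sdiff.1 (hJR he)
      have := hc e h1
      simp only [mem_filter, h1, true_and] at h2
      rw [mem_Ico]
      omega
    rw [Nat.card_Ico, Nat.add_sub_cancel_left] at this
    omega

/-- The blue edges form a forest, which has no room for a copy with at least as many edges as
vertices. -/
lemma colourable_of_red_clique (hl : ∀ e ∈ edges fam, ¬ e.IsDiag)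
    (hs : ∀ J ⊆ edges fam, (#J : ℝ) ≤ m * #(cover J)) {a : ℕ} (ha : 3 ≤ a) (hm : 2 * m < a + 1)
    (hred : ∀ F, (true, F) ∈ fam → ∃ A, #A = a ∧ IsCliqueIn F A)
    (hblue : ∀ F, (false, F) ∈ fam → F.Nonempty ∧ #(cover F) ≤ #F) : Colourable fam := by
  obtain ⟨R, hR, h1, h2⟩ := exists_forest_compl_cliqueFree hl ha
    (exists_edgeDegree_le_nat hl hs hm)
  refine colourable_of_forall (R := R) (fun F hF hFR => ?_) fun F hF hFR => ?_
  · obtain ⟨A, hA, hcl⟩ := hred F hF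
    exact h1 A hA fun x hx y hy hxy => hFR (hcl x hx y hy hxy)
  · have := h2 F hFR (hblue F hF).1
    have := (hblue F hF).2
    omega

/-- Average degree at most 4 allows a proper 5-colouring of the vertices. Pulling back the partition
of K₅ into two 5-cycles leaves no monochromatic triangle. -/
lemma colourable_of_triangles (hl : ∀ e ∈ edges fam, ¬ e.IsDiag)
    (hs : ∀ J ⊆ edges fam, (#J : ℝ) ≤ m * #(cover J)) (hm : m ≤ 2)
    (hfam : ∀ c F, (c, F) ∈ fam → ∃ A, #A = 3 ∧ IsCliqueIn F A) : Colourable fam := by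
  obtain ⟨c, hc⟩ := exists_colouring_of_degenerate hl (d := 4)
    (exists_edgeDegree_le_nat hl hs (by push_cast; linarith))
  have key : ∀ i j k : Fin 5, i ≠ j → i ≠ k → j ≠ k →
      ¬ ((i = j + 1 ∨ j = i + 1) ∧ (i = k + 1 ∨ k = i + 1) ∧ (j = k + 1 ∨ k = j + 1)) ∧
      ¬ (¬ (i = j + 1 ∨ j = i + 1) ∧ ¬ (i = k + 1 ∨ k = i + 1) ∧ ¬ (j = k + 1 ∨ k = j + 1)) := by
    decide
  let R := (edges fam).filter fun e => ∃ x ∈ e.toFinset, ∃ y ∈ e.toFinset, c x = c y + 1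
  have hR : ∀ x y, s(x, y) ∈ edges fam →
      (s(x, y) ∈ R ↔ (c x = c y + 1 ∨ c y = c x + 1)) := by
    intro x y hxy
    have h1 : ∀ i : Fin 5, i ≠ i + 1 := by decide
    simp [R, mem_filter, hxy, Sym2.toFinset_mk_eq, h1]
  refine colourable_of_forall (R := R) (fun F hF hFR => ?_) fun F hF hFR => ?_
  all_goals
    obtain ⟨A, hA, hcl⟩ := hfam _ F hF
    obtain ⟨x, y, z, hxy, hxz, hyz, rfl⟩ := card_eq_three.1 hA
    have e1 := hcl x (by simp) y (by simp) hxy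
    have e2 := hcl x (by simp) z (by simp) hxz
    have e3 := hcl y (by simp) z (by simp) hyz
    have hE := subset_edges hF
    have hk := key (c x) (c y) (c z) (hc x y (hE e1)) (hc x z (hE e2)) (hc y z (hE e3))
  · exact hk.1 ⟨(hR x y (hE e1)).1 (hFR e1), (hR x z (hE e2)).1 (hFR e2),
      (hR y z (hE e3)).1 (hFR e3)⟩
  · exact hk.2 ⟨fun h => (mem_sdiff.1 (hFR e1)).2 ((hR x y (hE e1)).2 h),
      fun h => (mem_sdiff.1 (hFR e2)).2 ((hR x z (hE e2)).2 h),
      fun h => (mem_sdiff.1 (hFR e3)).2 ((hR y z (hE e3)).2 h)⟩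

lemma IsCritical.exists_red_blue (h : IsCritical fam) {e : Sym2 V} (he : e ∈ edges fam) :
    ∃ F₁ F₂, (true, F₁) ∈ fam ∧ (false, F₂) ∈ fam ∧ F₁ ∩ F₂ = {e} := by
  obtain ⟨c, F, hF, heF⟩ := mem_edges.1 he
  cases c with
  | true =>
    obtain ⟨F', hF', hi⟩ := h.exists_inter_eq_of_red hF heF
    exact ⟨F, F', hF, hF', hi⟩
  | false =>
    obtain ⟨F', hF', hi⟩ := h.exists_inter_eq_of_blue hF heF
    exact ⟨F', F, hF', hF, by rw [inter_comm, hi]⟩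

lemma edgeDegree_add_le {F₁ F₂ : Finset (Sym2 V)} (h₁ : F₁ ⊆ edges fam) (h₂ : F₂ ⊆ edges fam)
    {e : Sym2 V} (hi : F₁ ∩ F₂ = {e}) (x : V) :
    edgeDegree F₁ x + edgeDegree F₂ x ≤ edgeDegree (edges fam) x + 1 := by
  rw [← edgeDegree_add, hi]
  refine add_le_add (edgeDegree_mono (union_subset h₁ h₂) x) ?_
  exact (card_filter_le _ _).trans (by simp)

/-- At a vertex of E a red and a blue copy share just one edge, so the degree in E is at least 2(k +
1) - 1, above the average. -/
lemma IsCritical.not_sparse_of_degrees (h : IsCritical fam) (hl : ∀ e ∈ edges fam, ¬ e.IsDiag)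
    (hne : (edges fam).Nonempty) (hs : ∀ J ⊆ edges fam, (#J : ℝ) ≤ m * #(cover J)) {k : ℕ}
    (hm : 2 * m < 2 * k + 1)
    (hdeg : ∀ c F, (c, F) ∈ fam → ∀ x ∈ cover F, k + 1 ≤ edgeDegree F x) : False := by
  obtain ⟨x, hx, hxd⟩ := exists_edgeDegree_le hl hne (hs _ Subset.rfl)
  obtain ⟨e, he, hxe⟩ := mem_cover.1 hx
  obtain ⟨F₁, F₂, hF₁, hF₂, hi⟩ := h.exists_red_blue he
  have he' := mem_inter.1 (hi ▸ mem_singleton_self e)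
  have h1 := edgeDegree_add_le (subset_edges hF₁) (subset_edges hF₂) hi x
  have h2 := hdeg _ F₁ hF₁ x (mem_cover.2 ⟨e, he'.1, hxe⟩)
  have h3 := hdeg _ F₂ hF₂ x (mem_cover.2 ⟨e, he'.2, hxe⟩)
  have h4 : 2 * k + 1 ≤ edgeDegree (edges fam) x := by omega
  have h5 : (2 * k + 1 : ℝ) ≤ edgeDegree (edges fam) x := by exact_mod_cast h4
  linarith

/-- A blue copy adds at least one to each degree in the red copy. So all degrees in E are at least a
+ 1, and the set S of vertices of degree at most b is independent. -/
lemma IsCritical.not_sparse_of_biclique (h : IsCritical fam) (hl : ∀ e ∈ edges fam, ¬ e.IsDiag)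
    (hne : (edges fam).Nonempty) (hs : ∀ J ⊆ edges fam, (#J : ℝ) ≤ m * #(cover J)) {a b : ℕ}
    (hab : a ≤ b) (hm : m * (a + b + 2) < (a + 1) * (b + 1))
    (hred : ∀ F, (true, F) ∈ fam → (∀ x ∈ cover F, a ≤ edgeDegree F x) ∧
      ∀ e ∈ F, ∃ x ∈ e, b ≤ edgeDegree F x)
    (hblue : ∀ F, (false, F) ∈ fam → ∀ x ∈ cover F, 2 ≤ edgeDegree F x) : False := by
  set E := edges fam with hE
  have hdeg : ∀ e ∈ E, (∀ x ∈ e, a + 1 ≤ edgeDegree E x) ∧ ∃ x ∈ e, b + 1 ≤ edgeDegree E x := by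
    intro e he
    obtain ⟨F₁, F₂, hF₁, hF₂, hi⟩ := h.exists_red_blue he
    have he' := mem_inter.1 (hi ▸ mem_singleton_self e)
    have key : ∀ x ∈ e, edgeDegree F₁ x + 1 ≤ edgeDegree E x := by
      intro x hxe
      have h1 := edgeDegree_add_le (subset_edges hF₁) (subset_edges hF₂) hi x
      have h3 := hblue F₂ hF₂ x (mem_cover.2 ⟨e, he'.2, hxe⟩)
      rw [← hE] at h1
      omega
    refine ⟨fun x hx => ?_, ?_⟩
    · have := (hred F₁ hF₁).1 x (mem_cover.2 ⟨e, he'.1, hx⟩)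
      have := key x hx
      omega
    · obtain ⟨x, hx, hb⟩ := (hred F₁ hF₁).2 e he'.1
      exact ⟨x, hx, by have := key x hx; omega⟩
  set S := (cover E).filter fun x => edgeDegree E x ≤ b with hS
  set T := (cover E).filter fun x => ¬ edgeDegree E x ≤ b with hT
  have hST : (#S : ℝ) + #T = #(cover E) := by
    exact_mod_cast card_filter_add_card_filter_not (s := cover E) fun x => edgeDegree E x ≤ b
  have hsum : ∑ x ∈ S, edgeDegree E x + ∑ x ∈ T, edgeDegree E x = 2 * #E := by
    rw [← sum_edgeDegree hl]
    exact sum_filter_add_sum_filter_not _ _ _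
  have hS1 : #S * (a + 1) ≤ ∑ x ∈ S, edgeDegree E x := by
    rw [← smul_eq_mul]
    refine card_nsmul_le_sum _ _ _ fun x hx => ?_
    obtain ⟨e, he, hxe⟩ := mem_cover.1 (mem_filter.1 hx).1
    exact (hdeg e he).1 x hxe
  have hT1 : #T * (b + 1) ≤ ∑ x ∈ T, edgeDegree E x := by
    rw [← smul_eq_mul]
    refine card_nsmul_le_sum _ _ _ fun x hx => ?_
    have := (mem_filter.1 hx).2
    omega
  have hS2 : ∑ x ∈ S, edgeDegree E x ≤ #E := by
    have h := sum_card_bipartiteAbove_eq_sum_card_bipartiteBelow (s := S) (t := E)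
      fun x e => x ∈ e
    refine h.trans_le ?_
    refine (sum_le_card_nsmul _ _ 1 fun e he => ?_).trans (by simp)
    obtain ⟨x, hx, hxb⟩ := (hdeg e he).2
    obtain ⟨y, rfl⟩ := Sym2.mem_iff_exists.1 hx
    rw [← card_singleton y]
    refine card_le_card fun z hz => ?_
    obtain ⟨hzS, hze⟩ := mem_filter.1 hz
    rcases Sym2.mem_iff.1 hze with rfl | rfl
    · have := (mem_filter.1 hzS).2
      omega
    · exact mem_singleton_self _
  have hv : 0 < (#(cover E) : ℝ) := by
    have := two_le_card_cover hl hne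
    exact_mod_cast (by omega : 0 < #(cover E))
  have hE' := hs E Subset.rfl
  have h1 : (#S : ℝ) * (a + 1) ≤ #E := by exact_mod_cast hS1.trans hS2
  have h2 : (#S : ℝ) * (a + 1) + #T * (b + 1) ≤ 2 * #E := by
    have : #S * (a + 1) + #T * (b + 1) ≤ 2 * #E := by omega
    exact_mod_cast this
  have hab' : (a : ℝ) ≤ b := by exact_mod_cast hab
  -- The combination of `h1` and `h2` with multipliers b - a and a + 1 weighs S and T equally.
  have h3 : (a + 1 : ℝ) * (b + 1) * #(cover E) ≤ #E * (a + b + 2) := by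
    rw [← hST]
    nlinarith [mul_le_mul_of_nonneg_left h1 (by linarith : (0 : ℝ) ≤ b - a),
      mul_le_mul_of_nonneg_left h2 (by positivity : (0 : ℝ) ≤ a + 1)]
  have h4 : (#E : ℝ) * (a + b + 2) ≤ m * #(cover E) * (a + b + 2) := by gcongr
  have h5 : m * (a + b + 2) * #(cover E) < (a + 1) * (b + 1) * #(cover E) := by gcongr
  nlinarith

end Colourings

end KohayakawaKreuter

namespace KohayakawaKreuter

open Finset

/-! ### Invariance under injective vertex maps -/

section Copies

variable {U V : Type*} [DecidableEq V]

/-- `F` is the image of `A` under an injective map of vertices. -/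
def IsCopy (A : Finset (Sym2 U)) (F : Finset (Sym2 V)) : Prop :=
  ∃ φ : U → V, Function.Injective φ ∧ F = A.image (Sym2.map φ)

lemma card_image_sym2Map {φ : U → V} (hφ : Function.Injective φ) (A : Finset (Sym2 U)) :
    #(A.image (Sym2.map φ)) = #A := card_image_of_injective _ (Sym2.map.injective hφ)

variable [DecidableEq U]

lemma card_cover_image {φ : U → V} (hφ : Function.Injective φ) (A : Finset (Sym2 U)) :
    #(cover (A.image (Sym2.map φ))) = #(cover A) := by
  rw [cover_image, card_image_of_injective _ hφ]

omit [DecidableEq U] in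
lemma loopless_image {φ : U → V} (hφ : Function.Injective φ) {A : Finset (Sym2 U)}
    (h : ∀ e ∈ A, ¬ e.IsDiag) : ∀ e ∈ A.image (Sym2.map φ), ¬ e.IsDiag := by
  intro e he
  obtain ⟨f, hf, rfl⟩ := mem_image.1 he
  rw [Sym2.isDiag_map hφ]
  exact h f hf

lemma edgeDegree_image {φ : U → V} (hφ : Function.Injective φ) (A : Finset (Sym2 U)) (x : U) :
    edgeDegree (A.image (Sym2.map φ)) (φ x) = edgeDegree A x := by
  rw [edgeDegree, edgeDegree, filter_image, card_image_sym2Map hφ]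
  congr 1
  ext e
  simp [Sym2.mem_map, hφ.eq_iff]

variable {A : Finset (Sym2 U)} {F : Finset (Sym2 V)} {m μ ε : ℝ}

omit [DecidableEq U] in
lemma IsCopy.card_eq (h : IsCopy A F) : #F = #A := by
  obtain ⟨φ, hφ, rfl⟩ := h
  exact card_image_sym2Map hφ A

lemma IsCopy.card_cover_eq (h : IsCopy A F) : #(cover F) = #(cover A) := by
  obtain ⟨φ, hφ, rfl⟩ := h
  exact card_cover_image hφ A

lemma IsCopy.twoBalanced (h : IsCopy A F) (hA : TwoBalanced μ ε A) : TwoBalanced μ ε F := by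
  obtain ⟨φ, hφ, rfl⟩ := h
  refine ⟨loopless_image hφ hA.loopless, ?_, ?_, fun J hJ hne h3 => ?_⟩
  · rw [card_cover_image hφ]; exact hA.three_le
  · rw [weight_image hφ.injOn]; exact hA.weight_eq
  · obtain ⟨K, hK, rfl⟩ := subset_image_iff.1 hJ
    rw [card_cover_image hφ] at h3
    rw [weight_image hφ.injOn]
    exact hA.weight_ge K hK (fun h => hne (by rw [h])) h3

lemma IsCopy.pairBalanced (h : IsCopy A F) (hA : PairBalanced m μ ε A) :
    PairBalanced m μ ε F := by
  obtain ⟨φ, hφ, rfl⟩ := h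
  refine ⟨loopless_image hφ hA.loopless, ?_, fun J hJ hne h3 => ?_⟩
  · rw [weight_image hφ.injOn]; exact hA.weight_eq
  · obtain ⟨K, hK, rfl⟩ := subset_image_iff.1 hJ
    rw [weight_image hφ.injOn]
    exact hA.weight_ge K hK (fun h => hne (by rw [h])) (by simpa using h3)

omit [DecidableEq U] in
lemma IsCopy.not_isBipartiteSet (h : IsCopy A F) (hA : ¬ IsBipartiteSet A) :
    ¬ IsBipartiteSet F := by
  obtain ⟨φ, hφ, rfl⟩ := h
  rintro ⟨c, hc⟩
  exact hA ⟨fun x => c (φ x), fun x y hxy =>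
    hc _ _ (mem_image.2 ⟨s(x, y), hxy, rfl⟩)⟩

lemma IsCopy.exists_subset (h : IsCopy A F) {P : ℕ → ℕ → Prop}
    (hA : ∃ J ⊆ A, P #(cover J) #J) : ∃ J ⊆ F, P #(cover J) #J := by
  obtain ⟨φ, hφ, rfl⟩ := h
  obtain ⟨J, hJ, hP⟩ := hA
  refine ⟨J.image (Sym2.map φ), image_subset_image hJ, ?_⟩
  rwa [card_cover_image hφ, card_image_sym2Map hφ]

lemma IsCopy.exists_isCliqueIn (h : IsCopy A F) (hA : IsCliqueIn A (cover A)) :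
    ∃ B, #B = #(cover A) ∧ IsCliqueIn F B := by
  obtain ⟨φ, hφ, rfl⟩ := h
  refine ⟨(cover A).image φ, card_image_of_injective _ hφ, ?_⟩
  intro x hx y hy hxy
  obtain ⟨z, hz, rfl⟩ := mem_image.1 hx
  obtain ⟨w, hw, rfl⟩ := mem_image.1 hy
  exact mem_image.2 ⟨s(z, w), hA z hz w hw fun h => hxy (by rw [h]), rfl⟩

lemma IsCopy.le_edgeDegree (h : IsCopy A F) {a b : ℕ}
    (hA : (∀ x ∈ cover A, a ≤ edgeDegree A x) ∧ ∀ e ∈ A, ∃ x ∈ e, b ≤ edgeDegree A x) :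
    (∀ x ∈ cover F, a ≤ edgeDegree F x) ∧ ∀ e ∈ F, ∃ x ∈ e, b ≤ edgeDegree F x := by
  obtain ⟨φ, hφ, rfl⟩ := h
  constructor
  · intro x hx
    rw [cover_image] at hx
    obtain ⟨z, hz, rfl⟩ := mem_image.1 hx
    rw [edgeDegree_image hφ]
    exact hA.1 z hz
  · intro e he
    obtain ⟨f, hf, rfl⟩ := mem_image.1 he
    obtain ⟨x, hx, hb⟩ := hA.2 f hf
    exact ⟨φ x, Sym2.mem_map.2 ⟨x, hx, rfl⟩, by rwa [edgeDegree_image hφ]⟩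

end Copies

/-! ### Critical families contain dense sets -/

section Dense

variable {U W V : Type*} [DecidableEq V] {m μ ε : ℝ} {fam : Finset (Bool × Finset (Sym2 V))}

lemma IsCritical.edges_nonempty (h : IsCritical fam) (hn : ∀ c F, (c, F) ∈ fam → F.Nonempty) :
    (edges fam).Nonempty := by
  rcases fam.eq_empty_or_nonempty with rfl | ⟨⟨c, F⟩, hF⟩
  · exact absurd ⟨∅, by simp⟩ h.not_colourable
  · exact (hn c F hF).mono (subset_edges hF)

variable [DecidableEq U] [DecidableEq W] {A₁ : Finset (Sym2 U)} {A₂ : Finset (Sym2 W)}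

/-- The conditions under which a critical family of copies of `A₁` and `A₂` is shown to contain a
set of edges of density larger than `m`. -/
inductive DensityCondition (m : ℝ) (A₁ : Finset (Sym2 U)) (A₂ : Finset (Sym2 W)) : Prop
  | not_bipartite : ¬ IsBipartiteSet A₂ → DensityCondition m A₁ A₂
  | arboricity_blue : (∃ J ⊆ A₂, 2 * (#(cover J) - 1) < #J) → DensityCondition m A₁ A₂
  | clique : IsCliqueIn A₁ (cover A₁) → DensityCondition m A₁ A₂
  | biclique (a b : ℕ) : 3 ≤ a → a ≤ b → #(cover A₁) = a + b → #A₁ ≤ a * b →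
      ((∀ x ∈ cover A₁, a ≤ edgeDegree A₁ x) ∧ ∀ e ∈ A₁, ∃ x ∈ e, b ≤ edgeDegree A₁ x) →
      DensityCondition m A₁ A₂
  | arboricity_red (l : ℕ) : (∃ J ⊆ A₁, l * (#(cover J) - 1) < #J) → m ≤ l + 1 / 2 →
      DensityCondition m A₁ A₂
  | density_red (l : ℕ) : (∃ J ⊆ A₁, l * #(cover J) < #J) → m ≤ l + 1 → #(cover A₂) < #A₂ →
      DensityCondition m A₁ A₂

theorem IsCritical.exists_dense_of_pairBalanced [Fintype V] (h : IsCritical fam)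
    (h₁ : ∀ F, (true, F) ∈ fam → IsCopy A₁ F) (h₂ : ∀ F, (false, F) ∈ fam → IsCopy A₂ F)
    (hA₁ : PairBalanced m μ ε A₁) (hA₂ : TwoBalanced μ ε A₂) (hε : 0 < ε) (hμ : 1 < μ)
    (hm : μ < m) (hcase : DensityCondition m A₁ A₂) :
    ∃ J ⊆ edges fam, m * #(cover J) < #J := by
  by_contra! hs
  have hm0 : 0 < m := by linarith
  have hb₁ : ∀ F, (true, F) ∈ fam → PairBalanced m μ ε F := fun F hF => (h₁ F hF).pairBalanced hA₁
  have hb₂ : ∀ F, (false, F) ∈ fam → TwoBalanced μ ε F := fun F hF => (h₂ F hF).twoBalanced hA₂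
  have hl : ∀ e ∈ edges fam, ¬ e.IsDiag := by
    intro e he
    obtain ⟨c, F, hF, heF⟩ := mem_edges.1 he
    cases c with
    | true => exact (hb₁ F hF).loopless e heF
    | false => exact (hb₂ F hF).loopless e heF
  cases hcase with
  | not_bipartite hc =>
    exact h.not_colourable <| colourable_of_blue_not_bipartite hl hs hm0.le
      (fun F hF => ⟨(hb₁ F hF).nonempty hμ hm, fun x hx => (hb₁ F hF).lt_edgeDegree hε hμ hm hx⟩)
      fun F hF => (h₂ F hF).not_isBipartiteSet hc
  | arboricity_blue hc =>
    -- The least number N of forests covering E; two are blue. The other N - 2 < m - 1/2 cannot hold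
    -- a red copy, by `PairBalanced.half_le`.
    have h1 := Nat.le_ceil (m + 1 / 2)
    have h2 := Nat.ceil_lt_add_one (show 0 ≤ m + 1 / 2 by linarith)
    set N := ⌈m + 1 / 2⌉₊
    have hN : 2 ≤ N := by
      have : (1 : ℝ) < N := by linarith
      exact_mod_cast this
    obtain ⟨a, ha⟩ := Nat.exists_eq_add_of_le' hN
    rw [ha] at h1 h2
    push_cast at h1 h2
    refine h.not_colourable <| colourable_of_forests hl hs (a := a) (b := 2)
      (by push_cast; linarith) (fun F hF => ⟨F, Subset.rfl, ?_⟩)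
      fun F hF => (h₂ F hF).exists_subset (P := fun v e => 2 * (v - 1) < e) hc
    have h3 := (hb₁ F hF).half_le hμ hm
    have h4 : (3 : ℝ) ≤ #(cover F) := by exact_mod_cast (hb₁ F hF).three_le hμ hm
    have h5 : (a : ℝ) * ((#(cover F) - 1 : ℕ) : ℝ) < #F := by
      rw [Nat.cast_sub (by have := (hb₁ F hF).three_le hμ hm; omega)]
      push_cast
      nlinarith
    exact_mod_cast h5
  | clique hc =>
    exact h.not_colourable <| colourable_of_red_clique hl hs (a := #(cover A₁))
      (hA₁.three_le hμ hm) (hA₁.two_mul_lt hμ hm) (fun F hF => (h₁ F hF).exists_isCliqueIn hc)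
      fun F hF => ⟨(hb₂ F hF).nonempty, (hb₂ F hF).card_cover_le hμ⟩
  | biclique a b ha hab hv he hdeg =>
    have hne := h.edges_nonempty fun c F hF => by
      cases c with
      | true => exact (hb₁ F hF).nonempty hμ hm
      | false => exact (hb₂ F hF).nonempty
    refine h.not_sparse_of_biclique hl hne hs hab ?_ (fun F hF => (h₁ F hF).le_edgeDegree hdeg)
      fun F hF x hx => (hb₂ F hF).two_le_edgeDegree hε hμ hx
    have h1 := hA₁.card_eq hm0
    have h2 : 1 < m / μ := (one_lt_div (by linarith)).2 hm
    have he' : (#A₁ : ℝ) ≤ a * b := by exact_mod_cast he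
    rw [hv] at h1
    push_cast at h1
    have ha' : (3 : ℝ) ≤ a := by exact_mod_cast ha
    have hb' : (3 : ℝ) ≤ b := by exact_mod_cast ha.trans hab
    -- From e = m(v - 2) + m/μ and m/μ > 1. The next inequality needs a, b ≥ 3.
    have h3 : m * (a + b - 2) < a * b - 1 := by linarith
    have h4 : (a * b - 1 : ℝ) * (a + b + 2) ≤ (a + 1) * (b + 1) * (a + b - 2) := by
      nlinarith [mul_nonneg (sub_nonneg.2 ha') (sub_nonneg.2 hb'), sq_nonneg ((a : ℝ) - b)]
    have h5 : (0 : ℝ) < a + b - 2 := by linarith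
    have h6 : m * (a + b - 2) * (a + b + 2) < (a * b - 1) * (a + b + 2) :=
      mul_lt_mul_of_pos_right h3 (by linarith)
    refine lt_of_mul_lt_mul_right (a := (a + b - 2 : ℝ)) ?_ h5.le
    linarith
  | arboricity_red l hc hml =>
    refine h.not_colourable <| colourable_of_forests hl hs (a := l) (b := 1)
      (by push_cast; linarith)
      (fun F hF => (h₁ F hF).exists_subset (P := fun v e => l * (v - 1) < e) hc)
      fun F hF => ⟨F, Subset.rfl, ?_⟩
    have := (hb₂ F hF).card_cover_le hμ
    have := (hb₂ F hF).three_le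
    omega
  | density_red l hc hml hA =>
    refine h.not_colourable <| colourable_of_pseudoforests hs (a := l) (b := 1)
      (by push_cast; linarith)
      (fun F hF => (h₁ F hF).exists_subset (P := fun v e => l * v < e) hc)
      fun F hF => ⟨F, Subset.rfl, ?_⟩
    rw [(h₂ F hF).card_cover_eq, (h₂ F hF).card_eq]
    omega

lemma TwoBalanced.not_isBipartiteSet_of_card_cover_eq (hA : TwoBalanced m ε A₁) (hm : 1 < m)
    (h : #(cover A₁) = 3) : ¬ IsBipartiteSet A₁ := by
  intro hb
  have h1 := hb.four_mul_card_le
  have h2 := hA.card_eq (by linarith)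
  rw [h] at h1 h2
  have h3 : (2 : ℝ) < #A₁ := by rw [h2]; push_cast; linarith
  have h4 : (3 : ℝ) ≤ #A₁ := by exact_mod_cast (show 2 < #A₁ by exact_mod_cast h3)
  norm_num at h1
  linarith

lemma TwoBalanced.isCliqueIn_of_card_cover_eq (hA : TwoBalanced m ε A₁) (hm : 1 < m)
    (h : #(cover A₁) = 3) : m = 2 ∧ IsCliqueIn A₁ (cover A₁) := by
  have h1 := hA.card_eq (by linarith)
  have h2 := card_le_choose hA.loopless
  rw [h] at h1 h2
  have h3 : (2 : ℝ) < #A₁ := by rw [h1]; push_cast; linarith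
  have h4 : 2 < #A₁ := by exact_mod_cast h3
  have h5 : #A₁ = 3 := by
    have : (3 : ℕ).choose 2 = 3 := rfl
    omega
  refine ⟨?_, isCliqueIn_cover hA.loopless (by rw [h, h5]; rfl)⟩
  rw [h5] at h1
  push_cast at h1
  linarith

/-- Insert e = m(v - 2) + 1 into 4e ≤ v² and cancel v - 2. -/
lemma TwoBalanced.four_mul_sub_two_le (hA : TwoBalanced m ε A₁) (hm : 1 < m)
    (h : IsBipartiteSet A₁) : 4 * m - 2 ≤ #(cover A₁) := by
  have h1 := h.four_mul_card_le
  rw [hA.card_eq (by linarith)] at h1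
  have h3 := hA.three_le_real
  by_contra! hc
  nlinarith [mul_pos (show (0 : ℝ) < #(cover A₁) - 2 by linarith) (sub_pos.2 hc)]

/-- A non-bipartite graph opposite one with at least four vertices is handled by the
degenerate-bipartite split, and two triangles by the partition of K₅. Otherwise both graphs are
bipartite, with at least max(4, 4m - 2) vertices. -/
theorem IsCritical.exists_dense_of_twoBalanced [Fintype V] (h : IsCritical fam)
    (h₁ : ∀ F, (true, F) ∈ fam → IsCopy A₁ F) (h₂ : ∀ F, (false, F) ∈ fam → IsCopy A₂ F)
    (hA₁ : TwoBalanced m ε A₁) (hA₂ : TwoBalanced m ε A₂) (hε : 0 < ε) (hm : 1 < m) :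
    ∃ J ⊆ edges fam, m * #(cover J) < #J := by
  by_contra! hs
  have hm0 : 0 < m := by linarith
  have hb : ∀ c F, (c, F) ∈ fam → TwoBalanced m ε F := by
    intro c F hF
    cases c with
    | true => exact (h₁ F hF).twoBalanced hA₁
    | false => exact (h₂ F hF).twoBalanced hA₂
  have hl : ∀ e ∈ edges fam, ¬ e.IsDiag := by
    intro e he
    obtain ⟨c, F, hF, heF⟩ := mem_edges.1 he
    exact (hb c F hF).loopless e heF
  have hne := h.edges_nonempty fun c F hF => (hb c F hF).nonempty
  have hv₁ := hA₁.three_le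
  have hv₂ := hA₂.three_le
  by_cases hB₂ : ¬ IsBipartiteSet A₂ ∧ 4 ≤ #(cover A₁)
  · exact h.not_colourable <| colourable_of_blue_not_bipartite hl hs hm0.le
      (fun F hF => ⟨(hb _ F hF).nonempty, fun x hx => (hb _ F hF).lt_edgeDegree hε hm
        (by rw [(h₁ F hF).card_cover_eq]; exact hB₂.2) hx⟩)
      fun F hF => (h₂ F hF).not_isBipartiteSet hB₂.1
  by_cases hB₁ : ¬ IsBipartiteSet A₁ ∧ 4 ≤ #(cover A₂)
  · exact h.not_colourable <| colourable_of_red_not_bipartite hl hs hm0.le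
      (fun F hF => ⟨(hb _ F hF).nonempty, fun x hx => (hb _ F hF).lt_edgeDegree hε hm
        (by rw [(h₂ F hF).card_cover_eq]; exact hB₁.2) hx⟩)
      fun F hF => (h₁ F hF).not_isBipartiteSet hB₁.1
  by_cases hv : #(cover A₁) = 3 ∧ #(cover A₂) = 3
  · obtain ⟨hm2, hc₁⟩ := hA₁.isCliqueIn_of_card_cover_eq hm hv.1
    obtain ⟨-, hc₂⟩ := hA₂.isCliqueIn_of_card_cover_eq hm hv.2
    refine h.not_colourable <| colourable_of_triangles hl hs hm2.le fun c F hF => ?_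
    cases c with
    | true => rw [← hv.1]; exact (h₁ F hF).exists_isCliqueIn hc₁
    | false => rw [← hv.2]; exact (h₂ F hF).exists_isCliqueIn hc₂
  have hv₁' : 4 ≤ #(cover A₁) := by
    by_contra hc
    have h3 : #(cover A₁) = 3 := by omega
    have := hA₁.not_isBipartiteSet_of_card_cover_eq hm h3
    exact hB₁ ⟨this, by omega⟩
  have hv₂' : 4 ≤ #(cover A₂) := by
    by_contra hc
    have h3 : #(cover A₂) = 3 := by omega
    have := hA₂.not_isBipartiteSet_of_card_cover_eq hm h3
    exact hB₂ ⟨this, by omega⟩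
  have hb₁ : IsBipartiteSet A₁ := by by_contra hc; exact hB₁ ⟨hc, hv₂'⟩
  have hb₂ : IsBipartiteSet A₂ := by by_contra hc; exact hB₂ ⟨hc, hv₁'⟩
  have hlarge : ∀ c F, (c, F) ∈ fam → 4 ≤ #(cover F) ∧ 4 * m - 2 ≤ #(cover F) := by
    intro c F hF
    cases c with
    | true => rw [(h₁ F hF).card_cover_eq]; exact ⟨hv₁', hA₁.four_mul_sub_two_le hm hb₁⟩
    | false => rw [(h₂ F hF).card_cover_eq]; exact ⟨hv₂', hA₂.four_mul_sub_two_le hm hb₂⟩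
  have hk0 := Nat.floor_le hm0.le
  have hk1 := Nat.lt_floor_add_one m
  set k := ⌊m⌋₊
  have hk : 1 ≤ k := by
    have : (0 : ℝ) < k := by linarith
    exact_mod_cast this
  have hkR : (1 : ℝ) ≤ k := by exact_mod_cast hk
  -- Below k + 1/2 the degrees, at least k + 1, are too large. At k + 1/2, k + 1 forests cover E,
  -- and above it k + 1 pseudoforests. In these two cases v ≥ 4m - 2 prevents a copy from fitting
  -- into k of them.
  rcases lt_trichotomy m (k + 1 / 2) with hlt | heq | hgt
  · refine h.not_sparse_of_degrees hl hne hs (k := k) (by linarith) fun c F hF x hx => ?_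
    have := (hb c F hF).lt_edgeDegree hε hm (hlarge c F hF).1 hx
    have : (k : ℝ) < edgeDegree F x := by linarith
    exact_mod_cast this
  · refine h.not_colourable <| colourable_of_forests hl hs (a := k) (b := 1)
      (by push_cast; linarith) (fun F hF => ⟨F, Subset.rfl, ?_⟩) fun F hF => ⟨F, Subset.rfl, ?_⟩
    · have h5 := (hlarge _ F hF).2
      have h6 := (hb _ F hF).card_eq hm0
      have : (k : ℝ) * ((#(cover F) - 1 : ℕ) : ℝ) < #F := by
        rw [Nat.cast_sub (by have := (hlarge _ F hF).1; omega), h6]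
        push_cast
        nlinarith
      exact_mod_cast this
    · have := (hb _ F hF).card_cover_le hm
      have := (hb _ F hF).three_le
      omega
  · have key : ∀ c F, (c, F) ∈ fam → k * #(cover F) < #F := by
      intro c F hF
      have h5 := (hlarge _ F hF).2
      have h6 := (hb _ F hF).card_eq hm0
      have : (k : ℝ) * #(cover F) < #F := by
        rw [h6]
        nlinarith
      exact_mod_cast this
    refine h.not_colourable <| colourable_of_pseudoforests hs (a := k) (b := 1)
      (by push_cast; linarith) (fun F hF => ⟨F, Subset.rfl, key _ F hF⟩)
      fun F hF => ⟨F, Subset.rfl, ?_⟩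
    have := key _ F hF
    nlinarith

end Dense

end KohayakawaKreuter

namespace KohayakawaKreuter

open Finset

/-! ### Threshold for copies of balanced edge sets -/

section Threshold

/-- Every weight is an integer multiple of 1/num(q), so a negative weight is at most -1/num(q). -/
lemma exists_gap_of_rat {m : ℝ} (hm : 0 < m) {q : ℚ} (hq : m = q) :
    ∃ gap : ℝ, 0 < gap ∧ ∀ {V : Type} [DecidableEq V] (J : Finset (Sym2 V)),
      m * #(cover J) < #J → weight m J ≤ -gap := by
  subst hq
  have hq0 : 0 < q := by exact_mod_cast hm
  have hnum : 0 < q.num := Rat.num_pos.2 hq0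
  have hnumR : (0 : ℝ) < q.num := by exact_mod_cast hnum
  have hdenR : (0 : ℝ) < q.den := by exact_mod_cast q.pos
  refine ⟨1 / q.num, by positivity, fun J hJ => ?_⟩
  rw [weight]
  have hq' : (q : ℝ) = q.num / q.den := Rat.cast_def q
  rw [hq'] at hJ ⊢
  rw [div_mul_eq_mul_div, div_lt_iff₀ hdenR] at hJ
  have h1 : q.num * (#(cover J) : ℤ) < #J * q.den := by exact_mod_cast hJ
  have h2 : q.num * (#(cover J) : ℤ) + 1 ≤ #J * q.den := h1
  have h3 : (q.num : ℝ) * #(cover J) + 1 ≤ #J * q.den := by exact_mod_cast h2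
  rw [div_div_eq_mul_div, sub_le_iff_le_add, ← sub_eq_neg_add, ← sub_div, le_div_iff₀ hnumR]
  linarith

lemma TwoBalanced.exists_rat {U : Type*} [DecidableEq U] {m ε : ℝ} {A : Finset (Sym2 U)}
    (h : TwoBalanced m ε A) (hm : 0 < m) : ∃ q : ℚ, m = q := by
  refine ⟨((#A : ℚ) - 1) / (#(cover A) - 2), ?_⟩
  have h1 := h.card_eq hm
  have h3 := h.three_le_real
  push_cast
  rw [eq_div_iff (by linarith)]
  linarith

lemma PairBalanced.exists_rat {U W : Type*} [DecidableEq U] [DecidableEq W] {m μ ε : ℝ}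
    {A : Finset (Sym2 U)} {B : Finset (Sym2 W)} (h : PairBalanced m μ ε A)
    (hB : TwoBalanced μ ε B) (hμ : 1 < μ) (hm : μ < m) : ∃ q : ℚ, m = q := by
  obtain ⟨q, rfl⟩ := hB.exists_rat (by linarith)
  refine ⟨(#A : ℚ) / (#(cover A) - 2 + 1 / q), ?_⟩
  have h1 := h.card_eq (by linarith)
  have h3 : (3 : ℝ) ≤ #(cover A) := by exact_mod_cast h.three_le hμ hm
  have h4 : (0 : ℝ) < 1 / q := by positivity
  push_cast
  rw [eq_div_iff (by linarith), h1]
  ring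

variable {U W : Type*} [DecidableEq U] [DecidableEq W]

/-- Every red-blue colouring of the edges of `G` contains a red copy of `A₁` or a blue copy of
`A₂`. -/
def ArrowsPair {V : Type*} [DecidableEq V] (G : SimpleGraph V) (A₁ : Finset (Sym2 U))
    (A₂ : Finset (Sym2 W)) : Prop :=
  ∀ R : Finset (Sym2 V), ∃ F : Finset (Sym2 V), (F : Set (Sym2 V)) ⊆ G.edgeSet ∧
    (IsCopy A₁ F ∧ F ⊆ R ∨ IsCopy A₂ F ∧ Disjoint F R)

omit [DecidableEq U] [DecidableEq W] in
lemma ArrowsPair.exists_isCritical {V : Type*} [DecidableEq V] [Fintype V] {G : SimpleGraph V}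
    {A₁ : Finset (Sym2 U)} {A₂ : Finset (Sym2 W)} (h : ArrowsPair G A₁ A₂) :
    ∃ fam : Finset (Bool × Finset (Sym2 V)), IsCritical fam ∧
      (edges fam : Set (Sym2 V)) ⊆ G.edgeSet ∧ (∀ F, (true, F) ∈ fam → IsCopy A₁ F) ∧
      ∀ F, (false, F) ∈ fam → IsCopy A₂ F := by
  classical
  let fam₀ : Finset (Bool × Finset (Sym2 V)) := univ.filter fun x =>
    (x.2 : Set (Sym2 V)) ⊆ G.edgeSet ∧ (x.1 = true ∧ IsCopy A₁ x.2 ∨ x.1 = false ∧ IsCopy A₂ x.2)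
  have hfam : ¬ Colourable fam₀ := by
    rintro ⟨R, hR⟩
    obtain ⟨F, hF, ⟨hc, hFR⟩ | ⟨hc, hFR⟩⟩ := h R
    · exact (hR F).1 (by simp [fam₀, hF, hc]) hFR
    · exact (hR F).2 (by simp [fam₀, hF, hc]) hFR
  obtain ⟨fam, hsub, hcr⟩ := KohayakawaKreuter.exists_isCritical hfam
  refine ⟨fam, hcr, fun e he => ?_, fun F hF => ?_, fun F hF => ?_⟩
  · obtain ⟨c, F, hF, heF⟩ := mem_edges.1 (mem_coe.1 he)
    exact (mem_filter.1 (hsub hF)).2.1 heF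
  · simpa using (mem_filter.1 (hsub hF)).2.2
  · simpa using (mem_filter.1 (hsub hF)).2.2

theorem exists_threshold_of_copies {A₁ : Finset (Sym2 U)} {A₂ : Finset (Sym2 W)} {m μ ε : ℝ}
    (hε : 0 < ε) (hε1 : ε ≤ 1) (hμ : 1 < μ) (hA₂ : TwoBalanced μ ε A₂)
    (hA₁ : m = μ ∧ TwoBalanced μ ε A₁ ∨
      μ < m ∧ PairBalanced m μ ε A₁ ∧ DensityCondition m A₁ A₂) :
    ∃ b : ℝ, 0 < b ∧ ∀ p : ℕ → unitInterval,
      (∀ᶠ n : ℕ in atTop, (p n : ℝ) ≤ b * (n : ℝ) ^ (-1 / m)) →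
      Tendsto (fun n : ℕ => SimpleGraph.binomialRandom (Fin n) (p n)
        {G : SimpleGraph (Fin n) | ArrowsPair G A₁ A₂}) atTop (𝓝 0) := by
  have hm : 1 < m := by
    rcases hA₁ with ⟨rfl, -⟩ | ⟨h, -⟩ <;> linarith
  have hm0 : 0 < m := by linarith
  obtain ⟨q, hq⟩ : ∃ q : ℚ, m = q := by
    rcases hA₁ with ⟨rfl, h⟩ | ⟨hlt, h, -⟩
    · exact h.exists_rat hm0
    · exact h.exists_rat hA₂ hμ hlt
  obtain ⟨gap, hgap, hdense⟩ := exists_gap_of_rat hm0 hq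
  set C := max 1 (max #A₁ #A₂)
  obtain ⟨b, hb, hthr⟩ := exists_threshold (m := m) hε hgap (C * C)
  refine ⟨b, hb, fun p hp => hthr p hp _ fun n D K G hG => ?_⟩
  obtain ⟨fam, hcr, hE, hred, hblue⟩ := ArrowsPair.exists_isCritical hG
  have hb₂ : ∀ F, (false, F) ∈ fam → TwoBalanced μ ε F := fun F hF =>
    (hblue F hF).twoBalanced hA₂
  have hcard : ∀ c F, (c, F) ∈ fam → #F ≤ C := by
    intro c F hF
    cases c with
    | true => rw [(hred F hF).card_eq]; exact (le_max_left _ _).trans (le_max_right _ _)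
    | false => rw [(hblue F hF).card_eq]; exact (le_max_right _ _).trans (le_max_right _ _)
  have hbal : IsBalancedFamily m μ ε fam := by
    rcases hA₁ with ⟨rfl, h⟩ | ⟨hlt, h, -⟩
    · refine .inl ⟨rfl, fun c F hF => ?_⟩
      cases c with
      | true => exact (hred F hF).twoBalanced h
      | false => exact hb₂ F hF
    · exact .inr ⟨fun F hF => (hred F hF).pairBalanced h, hb₂⟩
  have hmem : ∀ c F, (c, F) ∈ fam → F.Nonempty ∧ ∀ e ∈ F, ¬ e.IsDiag := by
    intro c F hF
    cases c with
    | false => exact ⟨(hb₂ F hF).nonempty, (hb₂ F hF).loopless⟩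
    | true =>
      rcases hA₁ with ⟨rfl, h⟩ | ⟨hlt, h, -⟩
      · have := (hred F hF).twoBalanced h
        exact ⟨this.nonempty, this.loopless⟩
      · have := (hred F hF).pairBalanced h
        exact ⟨this.nonempty hμ hlt, this.loopless⟩
  refine ⟨edges fam, hE, hcr.hasOutcome (fun c F hF => (hmem c F hF).2)
    (hcr.edges_nonempty fun c F hF => (hmem c F hF).1) hm0 hε.le D K
    (fun S hS e he c F hF heF hFS => hcr.exists_isExtension hε hε1 hbal (le_max_left _ _) hcard
      hS he hF heF hFS) ?_⟩
  obtain ⟨J, hJ, hlt⟩ : ∃ J ⊆ edges fam, m * #(cover J) < #J := by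
    rcases hA₁ with ⟨rfl, h⟩ | ⟨hlt, h, hc⟩
    · exact hcr.exists_dense_of_twoBalanced hred hblue h hA₂ hε hm
    · exact hcr.exists_dense_of_pairBalanced hred hblue h hA₂ hε hμ hlt hc
  exact ⟨J, hJ, hdense J hlt⟩

end Threshold

end KohayakawaKreuter

namespace KohayakawaKreuter

open Finset

/-! ### From graph densities to weights of edge sets -/

section Translation

variable {U : Type*} [Finite U]

/-- The edges of a graph on a finite type, as a finite set. -/
noncomputable def edgesOf (H : SimpleGraph U) : Finset (Sym2 U) := H.edgeSet.toFinite.toFinset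

/-- The edges of a subgraph, as a finite set. -/
noncomputable def subgraphEdges {H : SimpleGraph U} (G : H.Subgraph) : Finset (Sym2 U) :=
  G.edgeSet.toFinite.toFinset

@[simp] lemma mem_edgesOf {H : SimpleGraph U} {e : Sym2 U} : e ∈ edgesOf H ↔ e ∈ H.edgeSet := by
  simp [edgesOf]

@[simp] lemma mem_subgraphEdges {H : SimpleGraph U} {G : H.Subgraph} {e : Sym2 U} :
    e ∈ subgraphEdges G ↔ e ∈ G.edgeSet := by
  simp [subgraphEdges]

lemma subgraphEdges_subset {H : SimpleGraph U} (G : H.Subgraph) : subgraphEdges G ⊆ edgesOf H :=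
  fun _ he => mem_edgesOf.2 (G.edgeSet_subset (mem_subgraphEdges.1 he))

@[simp] lemma subgraphEdges_top (H : SimpleGraph U) :
    subgraphEdges (⊤ : H.Subgraph) = edgesOf H := by
  ext e; simp

lemma loopless_edgesOf (H : SimpleGraph U) : ∀ e ∈ edgesOf H, ¬ e.IsDiag := fun _ he =>
  H.not_isDiag_of_mem_edgeSet (mem_edgesOf.1 he)

lemma edge_coe {H : SimpleGraph U} (G : H.Subgraph) : edge G.coe = #(subgraphEdges G) := by
  rw [edge, subgraphEdges, ← Set.ncard_eq_toFinset_card, ← G.image_coe_edgeSet_coe,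
    Set.ncard_image_of_injective _ (Sym2.map.injective Subtype.val_injective)]

omit [Finite U] in
lemma vert_coe {H : SimpleGraph U} (G : H.Subgraph) : vert G.coe = G.verts.ncard :=
  Nat.card_coe_set_eq _

lemma coe_ne_bot_iff {H : SimpleGraph U} {G : H.Subgraph} :
    G.coe ≠ ⊥ ↔ (subgraphEdges G).Nonempty := by
  rw [← SimpleGraph.edgeSet_nonempty, ← Set.image_nonempty (f := Sym2.map Subtype.val),
    G.image_coe_edgeSet_coe]
  exact ⟨fun ⟨e, he⟩ => ⟨e, by simpa using he⟩, fun ⟨e, he⟩ => ⟨e, by simpa using he⟩⟩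

variable [DecidableEq U]

/-- The subgraph with a given set of edges and no isolated vertices. -/
def subgraphOf (H : SimpleGraph U) (J : Finset (Sym2 U)) (hJ : J ⊆ edgesOf H) : H.Subgraph where
  verts := cover J
  Adj x y := s(x, y) ∈ J
  adj_sub h := by simpa using hJ h
  edge_vert h := mem_coe.2 (mem_cover.2 ⟨_, h, Sym2.mem_mk_left _ _⟩)
  symm := ⟨fun x y h => by rwa [Sym2.eq_swap]⟩

@[simp] lemma subgraphEdges_subgraphOf {H : SimpleGraph U} {J : Finset (Sym2 U)}
    (hJ : J ⊆ edgesOf H) : subgraphEdges (subgraphOf H J hJ) = J := by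
  ext e
  induction e with | _ x y
  simp [subgraphOf]

lemma vert_subgraphOf {H : SimpleGraph U} {J : Finset (Sym2 U)} (hJ : J ⊆ edgesOf H) :
    vert (subgraphOf H J hJ).coe = #(cover J) := by
  rw [vert_coe]
  exact Set.ncard_coe_finset _

lemma edge_subgraphOf {H : SimpleGraph U} {J : Finset (Sym2 U)} (hJ : J ⊆ edgesOf H) :
    edge (subgraphOf H J hJ).coe = #J := by
  rw [edge_coe, subgraphEdges_subgraphOf]

lemma subgraphOf_ne_top {H : SimpleGraph U} {J : Finset (Sym2 U)} (hJ : J ⊆ edgesOf H)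
    (hne : J ≠ edgesOf H) : subgraphOf H J hJ ≠ ⊤ := fun h => hne <| by
  rw [← subgraphEdges_subgraphOf hJ, h, subgraphEdges_top]

lemma card_cover_subgraphEdges_le {H : SimpleGraph U} (G : H.Subgraph) :
    #(cover (subgraphEdges G)) ≤ vert G.coe := by
  rw [vert_coe, ← Set.ncard_coe_finset]
  refine Set.ncard_le_ncard (fun x hx => ?_) (Set.toFinite _)
  obtain ⟨e, he, hx⟩ := mem_cover.1 (mem_coe.1 hx)
  exact G.mem_verts_of_mem_edge (mem_subgraphEdges.1 he) hx

omit [DecidableEq U] in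
lemma le_iSup_subgraph {H : SimpleGraph U} (f : H.Subgraph → ℝ) (G : H.Subgraph) :
    f G ≤ ⨆ J, f J := le_ciSup (Set.finite_range f).bddAbove G

omit [DecidableEq U] in
lemma exists_eq_iSup_subgraph {H : SimpleGraph U} (f : H.Subgraph → ℝ) :
    ∃ G, f G = ⨆ J, f J := exists_eq_ciSup_of_finite

lemma d2_subgraphOf {H : SimpleGraph U} {J : Finset (Sym2 U)} (hJ : J ⊆ edgesOf H)
    (h3 : 3 ≤ #(cover J)) :
    d2 (subgraphOf H J hJ).coe = ((#J : ℝ) - 1) / (#(cover J) - 2) := by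
  have hne : (subgraphOf H J hJ).coe ≠ ⊥ := by
    rw [coe_ne_bot_iff, subgraphEdges_subgraphOf, nonempty_iff_ne_empty]
    rintro rfl
    simp at h3
  rw [d2, if_pos ⟨hne, by rwa [vert_subgraphOf]⟩, vert_subgraphOf, edge_subgraphOf]

lemma card_le_of_m2 {H : SimpleGraph U} {J : Finset (Sym2 U)} (hJ : J ⊆ edgesOf H)
    (h3 : 3 ≤ #(cover J)) : (#J : ℝ) ≤ m2 H * (#(cover J) - 2) + 1 := by
  have h := le_iSup_subgraph (fun J => d2 J.coe) (subgraphOf H J hJ)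
  have h3' : (3 : ℝ) ≤ #(cover J) := by exact_mod_cast h3
  simp only [d2_subgraphOf hJ h3] at h
  rw [div_le_iff₀ (by linarith)] at h
  rw [m2]
  linarith

/-- A subgraph that attains the 2-density has no isolated vertices. -/
lemma card_eq_of_d2_eq {H : SimpleGraph U} (hm : 1 < m2 H) {G : H.Subgraph}
    (hG : d2 G.coe = m2 H) : 3 ≤ #(cover (subgraphEdges G)) ∧
      #(cover (subgraphEdges G)) = vert G.coe ∧
      (#(subgraphEdges G) : ℝ) = m2 H * (#(cover (subgraphEdges G)) - 2) + 1 := by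
  have hc : G.coe ≠ ⊥ ∧ 3 ≤ vert G.coe := by
    by_contra hc
    rw [d2, if_neg hc] at hG
    split_ifs at hG <;> linarith
  rw [d2, if_pos hc, edge_coe] at hG
  have h3 : (3 : ℝ) ≤ vert G.coe := by exact_mod_cast hc.2
  rw [div_eq_iff (by linarith)] at hG
  have hle := card_cover_subgraphEdges_le G
  have hl : ∀ e ∈ subgraphEdges G, ¬ e.IsDiag := fun e he =>
    loopless_edgesOf H e (subgraphEdges_subset G he)
  have h3c : 3 ≤ #(cover (subgraphEdges G)) := by
    by_contra hlt
    have h1 := card_eq_one_of_card_cover_le_two hl (coe_ne_bot_iff.1 hc.1) (by omega)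
    rw [h1] at hG
    push_cast at hG
    nlinarith
  have h4 := card_le_of_m2 (subgraphEdges_subset G) h3c
  have h5 : (vert G.coe : ℝ) ≤ #(cover (subgraphEdges G)) := by nlinarith
  have h6 : #(cover (subgraphEdges G)) = vert G.coe := le_antisymm hle (by exact_mod_cast h5)
  exact ⟨h3c, h6, by rw [h6]; linarith⟩

lemma exists_card_eq_of_m2 {H : SimpleGraph U} (hm : 1 < m2 H) : ∃ J ⊆ edgesOf H,
    3 ≤ #(cover J) ∧ (#J : ℝ) = m2 H * (#(cover J) - 2) + 1 := by
  obtain ⟨G, hG⟩ := exists_eq_iSup_subgraph (fun J : H.Subgraph => d2 J.coe)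
  obtain ⟨h1, -, h2⟩ := card_eq_of_d2_eq hm hG
  exact ⟨_, subgraphEdges_subset G, h1, h2⟩

omit [Finite U] in
lemma le_weight_iff {μ : ℝ} (hμ : 0 < μ) (J : Finset (Sym2 U)) :
    2 - 1 / μ ≤ weight μ J ↔ (#J : ℝ) ≤ μ * (#(cover J) - 2) + 1 := by
  have : weight μ J - (2 - 1 / μ) = (μ * (#(cover J) - 2) + 1 - #J) / μ := by
    rw [weight]; field_simp; ring
  rw [← sub_nonneg, this, le_div_iff₀ hμ, zero_mul, sub_nonneg]

omit [Finite U] in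
lemma weight_eq_iff {μ : ℝ} (hμ : 0 < μ) (J : Finset (Sym2 U)) :
    weight μ J = 2 - 1 / μ ↔ (#J : ℝ) = μ * (#(cover J) - 2) + 1 := by
  have : weight μ J - (2 - 1 / μ) = (μ * (#(cover J) - 2) + 1 - #J) / μ := by
    rw [weight]; field_simp; ring
  rw [← sub_eq_zero, this, div_eq_zero_iff, or_iff_left hμ.ne', sub_eq_zero, eq_comm]

omit [Finite U] [DecidableEq U] in
lemma exists_forall_add_le {α : Type*} (S : Finset α) (f : α → ℝ) {c : ℝ}
    (h : ∀ x ∈ S, c < f x) : ∃ ε : ℝ, 0 < ε ∧ ∀ x ∈ S, c + ε ≤ f x := by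
  rcases S.eq_empty_or_nonempty with rfl | hS
  · exact ⟨1, one_pos, by simp⟩
  · obtain ⟨y, hy, hmin⟩ := S.exists_min_image f hS
    exact ⟨f y - c, sub_pos.2 (h y hy), fun x hx => by linarith [hmin x hx]⟩

omit [Finite U] in
lemma TwoBalanced.exists_of_lt {μ : ℝ} {F : Finset (Sym2 U)} (hl : ∀ e ∈ F, ¬ e.IsDiag)
    (h3 : 3 ≤ #(cover F)) (heq : weight μ F = 2 - 1 / μ)
    (hlt : ∀ J ⊆ F, J ≠ F → 3 ≤ #(cover J) → 2 - 1 / μ < weight μ J) :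
    ∃ ε : ℝ, 0 < ε ∧ TwoBalanced μ ε F := by
  obtain ⟨ε, hε, h⟩ := exists_forall_add_le
    (F.powerset.filter fun J => J ≠ F ∧ 3 ≤ #(cover J)) (weight μ) (c := 2 - 1 / μ)
    fun J hJ => by
      obtain ⟨hJ, h1, h2⟩ := mem_filter.1 hJ
      exact hlt J (mem_powerset.1 hJ) h1 h2
  exact ⟨ε, hε, hl, h3, heq, fun J hJ h1 h2 =>
    h J (mem_filter.2 ⟨mem_powerset.2 hJ, h1, h2⟩)⟩

omit [Finite U] in
lemma PairBalanced.exists_of_lt {m μ : ℝ} {F : Finset (Sym2 U)} (hl : ∀ e ∈ F, ¬ e.IsDiag)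
    (heq : weight m F = 2 - 1 / μ)
    (hlt : ∀ J ⊆ F, J ≠ F → J.Nonempty → 2 - 1 / μ < weight m J) :
    ∃ ε : ℝ, 0 < ε ∧ PairBalanced m μ ε F := by
  obtain ⟨ε, hε, h⟩ := exists_forall_add_le
    (F.powerset.filter fun J => J ≠ F ∧ J.Nonempty) (weight m) (c := 2 - 1 / μ)
    fun J hJ => by
      obtain ⟨hJ, h1, h2⟩ := mem_filter.1 hJ
      exact hlt J (mem_powerset.1 hJ) h1 h2
  exact ⟨ε, hε, hl, heq, fun J hJ h1 h2 => h J (mem_filter.2 ⟨mem_powerset.2 hJ, h1, h2⟩)⟩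

omit [Finite U] in
lemma TwoBalanced.mono {μ ε ε' : ℝ} {F : Finset (Sym2 U)} (h : TwoBalanced μ ε F) (hε : ε' ≤ ε) :
    TwoBalanced μ ε' F :=
  ⟨h.loopless, h.three_le, h.weight_eq, fun J hJ h1 h2 => by linarith [h.weight_ge J hJ h1 h2]⟩

omit [Finite U] in
lemma PairBalanced.mono {m μ ε ε' : ℝ} {F : Finset (Sym2 U)} (h : PairBalanced m μ ε F)
    (hε : ε' ≤ ε) : PairBalanced m μ ε' F :=
  ⟨h.loopless, h.weight_eq, fun J hJ h1 h2 => by linarith [h.weight_ge J hJ h1 h2]⟩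

lemma exists_twoBalanced_subset {H : SimpleGraph U} (hm : 1 < m2 H) :
    ∃ F ⊆ edgesOf H, ∃ ε : ℝ, 0 < ε ∧ TwoBalanced (m2 H) ε F := by
  have hm0 : 0 < m2 H := by linarith
  obtain ⟨J₀, hJ₀, h3, heq⟩ := exists_card_eq_of_m2 hm
  -- An inclusion-minimal set attaining the 2-density is strictly 2-balanced.
  obtain ⟨F, -, hF⟩ := exists_minimal_le_of_wellFoundedLT (α := Finset (Sym2 U))
    (fun J => J ⊆ edgesOf H ∧ 3 ≤ #(cover J) ∧ (#J : ℝ) = m2 H * (#(cover J) - 2) + 1) J₀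
    ⟨hJ₀, h3, heq⟩
  refine ⟨F, hF.1.1, TwoBalanced.exists_of_lt (fun e he => loopless_edgesOf H e (hF.1.1 he))
    hF.1.2.1 ((weight_eq_iff hm0 F).2 hF.1.2.2) fun J hJ hne h3 => ?_⟩
  have hJH := hJ.trans hF.1.1
  refine lt_of_le_of_ne ((le_weight_iff hm0 J).2 (card_le_of_m2 hJH h3)) fun h => hne ?_
  exact hJ.antisymm (hF.2 ⟨hJH, h3, (weight_eq_iff hm0 J).1 h.symm⟩ hJ)

lemma StrictlyTwoBalanced.exists_twoBalanced {H : SimpleGraph U} (h : StrictlyTwoBalanced H)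
    (hm : 1 < m2 H) :
    #(cover (edgesOf H)) = Nat.card U ∧ ∃ ε : ℝ, 0 < ε ∧ TwoBalanced (m2 H) ε (edgesOf H) := by
  have hm0 : 0 < m2 H := by linarith
  obtain ⟨G, hG⟩ := exists_eq_iSup_subgraph (fun J : H.Subgraph => d2 J.coe)
  have hGt : G = ⊤ := by
    by_contra hne
    exact (h G hne).ne hG
  subst hGt
  obtain ⟨h3, hv, heq⟩ := card_eq_of_d2_eq hm hG
  rw [subgraphEdges_top] at h3 hv heq
  refine ⟨by rw [hv, vert_coe, SimpleGraph.Subgraph.verts_top, Set.ncard_univ],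
    TwoBalanced.exists_of_lt (loopless_edgesOf H) h3 ((weight_eq_iff hm0 _).2 heq)
    fun J hJ hne h3 => ?_⟩
  refine lt_of_le_of_ne ((le_weight_iff hm0 J).2 (card_le_of_m2 hJ h3)) fun h' => ?_
  have h1 := (weight_eq_iff hm0 J).1 h'.symm
  have h2 := h _ (subgraphOf_ne_top hJ hne)
  have h3' : (3 : ℝ) ≤ #(cover J) := by exact_mod_cast h3
  rw [d2_subgraphOf hJ h3, h1, div_lt_iff₀ (by linarith)] at h2
  linarith

section Pair

variable {W : Type*} {K : SimpleGraph W}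

lemma d2Pair_subgraphOf {H : SimpleGraph U} (hK : K ≠ ⊥) {J : Finset (Sym2 U)}
    (hJ : J ⊆ edgesOf H) (hne : J.Nonempty) :
    d2Pair (subgraphOf H J hJ).coe K = (#J : ℝ) / (#(cover J) - 2 + 1 / m2 K) := by
  have h2 := two_le_card_cover (fun e he => loopless_edgesOf H e (hJ he)) hne
  rw [d2Pair, if_pos ⟨hK, by rwa [vert_subgraphOf]⟩, vert_subgraphOf, edge_subgraphOf]

lemma card_le_of_m2Pair {H : SimpleGraph U} (hK : K ≠ ⊥) (hμ : 0 < m2 K) {J : Finset (Sym2 U)}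
    (hJ : J ⊆ edgesOf H) (hne : J.Nonempty) :
    (#J : ℝ) ≤ m2Pair H K * (#(cover J) - 2 + 1 / m2 K) := by
  have h := le_iSup_subgraph (fun J => d2Pair J.coe K) (subgraphOf H J hJ)
  have h2 : (2 : ℝ) ≤ #(cover J) := by
    exact_mod_cast two_le_card_cover (fun e he => loopless_edgesOf H e (hJ he)) hne
  have h0 : 0 < 1 / m2 K := by positivity
  simp only [d2Pair_subgraphOf hK hJ hne] at h
  rw [div_le_iff₀ (by linarith)] at h
  exact h

lemma m2Pair_gt_of_lt {H : SimpleGraph U} (hK : K ≠ ⊥) (hμ : 1 < m2 K) (h : m2 K < m2 H) :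
    m2 K < m2Pair H K := by
  obtain ⟨J, hJ, h3, heq⟩ := exists_card_eq_of_m2 (H := H) (by linarith)
  have hne : J.Nonempty := by
    rw [nonempty_iff_ne_empty]
    rintro rfl
    simp at h3
  have h3' : (3 : ℝ) ≤ #(cover J) := by exact_mod_cast h3
  have h0 : 0 < 1 / m2 K := by positivity
  have h1 := card_le_of_m2Pair hK (by linarith) hJ hne
  by_contra! hc
  have h2 : m2Pair H K * (#(cover J) - 2 + 1 / m2 K) ≤ m2 K * (#(cover J) - 2 + 1 / m2 K) :=
    mul_le_mul_of_nonneg_right hc (by linarith)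
  have h4 : m2 K * (#(cover J) - 2 + 1 / m2 K) = m2 K * (#(cover J) - 2) + 1 := by
    have : m2 K ≠ 0 := by linarith
    field_simp
  nlinarith

/-- Since μ(v - 2 + 1/μ) = μ(v - 2) + 1, the bounds d₂(J, K) ≤ μ and d₂(J) ≤ μ agree for every J
with an edge and at least three vertices. -/
lemma m2Pair_eq_of_eq {H : SimpleGraph U} (hK : K ≠ ⊥) (hμ : 1 < m2 K) (h : m2 H = m2 K) :
    m2Pair H K = m2 K := by
  have hμ0 : m2 K ≠ 0 := by linarith
  have h0 : 0 < 1 / m2 K := by positivity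
  have hmul : ∀ t : ℝ, m2 K * (t - 2 + 1 / m2 K) = m2 K * (t - 2) + 1 := fun t => by field_simp
  apply le_antisymm
  · refine ciSup_le fun G => ?_
    rw [d2Pair]
    split_ifs with hc
    · have h2 : (2 : ℝ) ≤ vert G.coe := by exact_mod_cast hc.2
      rw [div_le_iff₀ (by linarith), edge_coe, hmul]
      have hle : (#(cover (subgraphEdges G)) : ℝ) ≤ vert G.coe := by
        exact_mod_cast card_cover_subgraphEdges_le G
      rcases (subgraphEdges G).eq_empty_or_nonempty with he | hne
      · rw [he]
        simp only [card_empty, Nat.cast_zero]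
        nlinarith
      by_cases h3 : 3 ≤ #(cover (subgraphEdges G))
      · have := card_le_of_m2 (subgraphEdges_subset G) h3
        rw [h] at this
        nlinarith
      · rw [card_eq_one_of_card_cover_le_two (fun e he =>
          loopless_edgesOf H e (subgraphEdges_subset G he)) hne (by omega)]
        push_cast
        nlinarith
    · linarith
  · obtain ⟨J, hJ, h3, heq⟩ := exists_card_eq_of_m2 (H := H) (by linarith)
    have hne : J.Nonempty := by
      rw [nonempty_iff_ne_empty]
      rintro rfl
      simp at h3
    have h3' : (3 : ℝ) ≤ #(cover J) := by exact_mod_cast h3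
    have h1 := card_le_of_m2Pair hK (by linarith) hJ hne
    rw [heq, h, ← hmul] at h1
    exact le_of_mul_le_mul_right h1 (by linarith)

lemma StrictlyBalancedWrt.exists_pairBalanced {H : SimpleGraph U} (h : StrictlyBalancedWrt H K)
    (hK : K ≠ ⊥) (hμ : 1 < m2 K) (hm : 0 < m2Pair H K) :
    #(cover (edgesOf H)) = Nat.card U ∧
      ∃ ε : ℝ, 0 < ε ∧ PairBalanced (m2Pair H K) (m2 K) ε (edgesOf H) := by
  have h0 : 0 < 1 / m2 K := by positivity
  obtain ⟨G, hG⟩ := exists_eq_iSup_subgraph (fun J : H.Subgraph => d2Pair J.coe K)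
  have hGt : G = ⊤ := by
    by_contra hne
    exact (h G hne).ne hG
  subst hGt
  change _ = m2Pair H K at hG
  have hw : ∀ J : Finset (Sym2 U), weight (m2Pair H K) J - (2 - 1 / m2 K) =
      (m2Pair H K * (#(cover J) - 2 + 1 / m2 K) - #J) / m2Pair H K := by
    intro J
    rw [weight]
    field_simp
    ring
  have hc : K ≠ ⊥ ∧ 2 ≤ vert (⊤ : H.Subgraph).coe := by
    by_contra hc
    simp only [d2Pair, if_neg hc] at hG
    linarith
  simp only [d2Pair, if_pos hc, edge_coe, subgraphEdges_top] at hG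
  have h2 : (2 : ℝ) ≤ vert (⊤ : H.Subgraph).coe := by exact_mod_cast hc.2
  have hne : (edgesOf H).Nonempty := by
    rw [nonempty_iff_ne_empty]
    intro he
    rw [he] at hG
    simp at hG
    linarith
  rw [div_eq_iff (by linarith)] at hG
  have h1 := card_le_of_m2Pair hK (by linarith) Subset.rfl hne
  have h3 : (vert (⊤ : H.Subgraph).coe : ℝ) ≤ #(cover (edgesOf H)) := by
    rw [hG] at h1
    linarith [le_of_mul_le_mul_left h1 hm]
  have h4 := card_cover_subgraphEdges_le (⊤ : H.Subgraph)
  rw [subgraphEdges_top] at h4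
  have hv : #(cover (edgesOf H)) = vert (⊤ : H.Subgraph).coe :=
    le_antisymm h4 (by exact_mod_cast h3)
  refine ⟨by rw [hv, vert_coe, SimpleGraph.Subgraph.verts_top, Set.ncard_univ],
    PairBalanced.exists_of_lt (loopless_edgesOf H) ?_ fun J hJ hne hJne => ?_⟩
  · rw [← sub_eq_zero, hw, hv, ← hG]
    simp
  · have h5 := h _ (subgraphOf_ne_top hJ hne)
    have h2 : (2 : ℝ) ≤ #(cover J) := by
      exact_mod_cast two_le_card_cover (fun e he => loopless_edgesOf H e (hJ he)) hJne
    rw [d2Pair_subgraphOf hK hJ hJne, div_lt_iff₀ (by linarith)] at h5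
    rw [← sub_pos, hw]
    exact div_pos (by linarith) hm

end Pair

end Translation

end KohayakawaKreuter

namespace KohayakawaKreuter

open Finset

/-! ### The conditions on hearts in terms of edge sets -/

section Conditions

variable {U : Type*} [Finite U] [DecidableEq U] {H : SimpleGraph U}

omit [DecidableEq U] in
lemma card_edgesOf_eq_edge (H : SimpleGraph U) : #(edgesOf H) = edge H := by
  rw [edge, edgesOf, ← Set.ncard_eq_toFinset_card]

omit [DecidableEq U] in
lemma not_isBipartiteSet_of_chromaticNumber (h : 3 ≤ H.chromaticNumber) :
    ¬ IsBipartiteSet (edgesOf H) := by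
  rintro ⟨c, hc⟩
  have h2 : H.Colorable 2 :=
    (SimpleGraph.Coloring.mk c fun {x y} hxy => hc x y (mem_edgesOf.2 hxy)).colorable
  have := h.trans (SimpleGraph.chromaticNumber_le_iff_colorable.2 h2)
  revert this
  decide

lemma exists_subset_of_lt_ar {l : ℕ} (h : (l : ℝ) < ar H) :
    ∃ J ⊆ edgesOf H, l * (#(cover J) - 1) < #J := by
  obtain ⟨G, hG⟩ := exists_eq_iSup_subgraph (fun J : H.Subgraph => d1 J.coe)
  change _ = ar H at hG
  rw [← hG] at h
  simp only [d1] at h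
  split_ifs at h with hv
  · refine ⟨_, subgraphEdges_subset G, ?_⟩
    have hv' : (2 : ℝ) ≤ vert G.coe := by exact_mod_cast hv
    rw [lt_div_iff₀ (by linarith), edge_coe] at h
    have hle := card_cover_subgraphEdges_le G
    have h1 : (l : ℝ) * ((#(cover (subgraphEdges G)) - 1 : ℕ) : ℝ) ≤ l * (vert G.coe - 1) := by
      gcongr
      rw [le_sub_iff_add_le]
      exact_mod_cast (show #(cover (subgraphEdges G)) - 1 + 1 ≤ vert G.coe by omega)
    exact_mod_cast h1.trans_lt h
  · exact absurd h (not_lt.2 (Nat.cast_nonneg l))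

lemma exists_subset_of_lt_mDensity {l : ℕ} (h : (l : ℝ) < mDensity H) :
    ∃ J ⊆ edgesOf H, l * #(cover J) < #J := by
  obtain ⟨G, hG⟩ := exists_eq_iSup_subgraph (fun J : H.Subgraph => density J.coe)
  change _ = mDensity H at hG
  rw [← hG] at h
  simp only [density] at h
  split_ifs at h with hv
  · refine ⟨_, subgraphEdges_subset G, ?_⟩
    have hv' : (1 : ℝ) ≤ vert G.coe := by exact_mod_cast hv
    rw [lt_div_iff₀ (by linarith), edge_coe] at h
    have hle : (#(cover (subgraphEdges G)) : ℝ) ≤ vert G.coe := by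
      exact_mod_cast card_cover_subgraphEdges_le G
    have h1 : (l : ℝ) * #(cover (subgraphEdges G)) ≤ l * vert G.coe := by gcongr
    exact_mod_cast h1.trans_lt h
  · exact absurd h (not_lt.2 (Nat.cast_nonneg l))

lemma isCliqueIn_of_iso {a : ℕ} (f : H ≃g (⊤ : SimpleGraph (Fin a))) :
    IsCliqueIn (edgesOf H) (cover (edgesOf H)) := by
  intro x _ y _ hxy
  rw [mem_edgesOf, SimpleGraph.mem_edgeSet, ← f.map_adj_iff, SimpleGraph.top_adj]
  exact f.injective.ne hxy

lemma le_edgeDegree_of_injective {x : U} {T : Type*} [Fintype T] {g : T → U}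
    (hg : Function.Injective g) (h : ∀ t, H.Adj x (g t)) :
    Fintype.card T ≤ edgeDegree (edgesOf H) x := by
  rw [← Finset.card_univ, edgeDegree]
  refine card_le_card_of_injOn (fun t => s(x, g t)) (fun t _ => ?_) fun t _ t' _ htt => ?_
  · simpa using h t
  · exact hg (Sym2.congr_right.1 htt)

lemma le_edgeDegree_of_iso {S T : Type*} [Fintype S] [Fintype T]
    (f : H ≃g completeBipartiteGraph S T) :
    (∀ s, Fintype.card T ≤ edgeDegree (edgesOf H) (f.symm (.inl s))) ∧
      ∀ t, Fintype.card S ≤ edgeDegree (edgesOf H) (f.symm (.inr t)) := by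
  constructor
  · intro s
    refine le_edgeDegree_of_injective (g := fun t => f.symm (.inr t))
      (fun t t' h => by simpa using h) fun t => ?_
    rw [f.symm.map_adj_iff]
    simp
  · intro s
    refine le_edgeDegree_of_injective (g := fun t => f.symm (.inl t))
      (fun t t' h => by simpa using h) fun t => ?_
    rw [f.symm.map_adj_iff]
    simp

lemma densityCondition_of_iso {W : Type*} [DecidableEq W] {A₂ : Finset (Sym2 W)} {m : ℝ}
    {a b : ℕ} (ha : 3 ≤ a) (hab : a ≤ b) (hcov : #(cover (edgesOf H)) = Nat.card U)
    (f : H ≃g completeBipartiteGraph (Fin a) (Fin b)) : DensityCondition m (edgesOf H) A₂ := by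
  obtain ⟨h1, h2⟩ := le_edgeDegree_of_iso f
  simp only [Fintype.card_fin] at h1 h2
  refine .biclique a b ha hab ?_ ?_ ⟨fun x _ => ?_, fun e he => ?_⟩
  · rw [hcov, Nat.card_congr f.toEquiv]
    simp
  · have hsub : edgesOf H ⊆ (univ : Finset (Fin a × Fin b)).image
        fun x => s(f.symm (.inl x.1), f.symm (.inr x.2)) := by
      intro e he
      induction e with | _ x y
      obtain ⟨z, rfl⟩ := f.symm.surjective x
      obtain ⟨w, rfl⟩ := f.symm.surjective y
      rw [mem_edgesOf, SimpleGraph.mem_edgeSet, f.symm.map_adj_iff] at he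
      rcases z with s | t <;> rcases w with s' | t'
      · simp at he
      · exact mem_image.2 ⟨(s, t'), mem_univ _, rfl⟩
      · exact mem_image.2 ⟨(s', t), mem_univ _, Sym2.eq_swap⟩
      · simp at he
    refine (card_le_card hsub).trans (card_image_le.trans ?_)
    simp
  · obtain ⟨z, rfl⟩ := f.symm.surjective x
    rcases z with s | t
    · exact hab.trans (h1 s)
    · exact h2 t
  · induction e with | _ x y
    obtain ⟨z, rfl⟩ := f.symm.surjective x
    obtain ⟨w, rfl⟩ := f.symm.surjective y
    rw [mem_edgesOf, SimpleGraph.mem_edgeSet, f.symm.map_adj_iff] at he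
    rcases z with s | t
    · exact ⟨_, Sym2.mem_mk_left _ _, h1 s⟩
    · rcases w with s' | t'
      · exact ⟨_, Sym2.mem_mk_right _ _, h1 s'⟩
      · simp at he

/-- A complete bipartite graph with its two sides exchanged. -/
def completeBipartiteSwap (S T : Type*) :
    completeBipartiteGraph S T ≃g completeBipartiteGraph T S where
  toEquiv := Equiv.sumComm S T
  map_rel_iff' {x y} := by
    rcases x with x | x <;> rcases y with y | y <;> simp

omit [DecidableEq U] in
lemma edge_add_one_le_of_isAcyclic [Nonempty U] (h : H.IsAcyclic) : edge H + 1 ≤ Nat.card U := by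
  classical
  have := Fintype.ofFinite U
  obtain ⟨T, hHT, -, hT⟩ := SimpleGraph.Connected.exists_isTree_le_of_le_of_isAcyclic
    (SimpleGraph.connected_top (V := U)) le_top h
  have h1 := hT.card_edgeFinset
  rw [edge, Nat.card_eq_fintype_card, ← h1]
  gcongr
  rw [← Set.ncard_coe_finset]
  refine Set.ncard_le_ncard ?_ (Set.toFinite _)
  rw [SimpleGraph.coe_edgeFinset]
  exact SimpleGraph.edgeSet_mono hHT

/-- With e ≥ v the graph contains a cycle of some length k. If the cycle is proper, then k ≤ μ(k -
2) + 1, whereas v = μ(v - 2) + 1 and k < v; subtracting contradicts μ > 1. -/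
lemma exists_cycleGraph_iso {μ ε : ℝ} (hA : TwoBalanced μ ε (edgesOf H)) (hε : 0 < ε) (hμ : 1 < μ)
    (hcov : #(cover (edgesOf H)) = Nat.card U) (h : #(edgesOf H) ≤ #(cover (edgesOf H))) :
    ∃ k : ℕ, 3 ≤ k ∧ Nonempty (H ≃g SimpleGraph.cycleGraph k) := by
  have := Fintype.ofFinite U
  have hn : Nonempty U := by
    by_contra hn
    rw [not_nonempty_iff] at hn
    have := hA.three_le
    rw [hcov, Nat.card_of_isEmpty] at this
    omega
  have hle := hA.card_cover_le hμ
  have hac : ¬ H.IsAcyclic := fun hac => by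
    have := edge_add_one_le_of_isAcyclic hac
    rw [← card_edgesOf_eq_edge] at this
    omega
  rw [SimpleGraph.isAcyclic_iff_free_cycleGraph] at hac
  push Not at hac
  obtain ⟨k, hk, hfree⟩ := hac
  obtain ⟨φ⟩ := hfree
  refine ⟨k, hk, ?_⟩
  set J := (edgesOf (SimpleGraph.cycleGraph k)).image (Sym2.map φ) with hJ
  have hφ : Function.Injective φ := φ.injective
  have hJH : J ⊆ edgesOf H := by
    intro e he
    obtain ⟨f, hf, rfl⟩ := mem_image.1 he
    induction f with | _ x y
    rw [mem_edgesOf] at hf ⊢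
    exact φ.toHom.map_adj hf
  have hdeg : ∀ x, (SimpleGraph.cycleGraph k).degree x = 2 := fun x => by
    obtain ⟨j, rfl⟩ := Nat.exists_eq_add_of_le' hk
    exact SimpleGraph.cycleGraph_degree_three_le
  have hcardE : #(edgesOf (SimpleGraph.cycleGraph k)) = k := by
    have h1 := (SimpleGraph.cycleGraph k).sum_degrees_eq_twice_card_edges
    simp only [hdeg] at h1
    rw [card_edgesOf_eq_edge, edge, ← SimpleGraph.coe_edgeFinset, Set.ncard_coe_finset]
    simp at h1
    omega
  have hcoverE : #(cover (edgesOf (SimpleGraph.cycleGraph k))) = k := by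
    have : cover (edgesOf (SimpleGraph.cycleGraph k)) = univ := by
      refine eq_univ_of_forall fun x => ?_
      obtain ⟨y, hy⟩ := ((SimpleGraph.cycleGraph k).degree_pos_iff_exists_adj x).1
        (by rw [hdeg]; omega)
      exact mem_cover.2 ⟨s(x, y), mem_edgesOf.2 hy, Sym2.mem_mk_left _ _⟩
    rw [this, card_univ, Fintype.card_fin]
  have hJc : #J = k := by rw [hJ, card_image_sym2Map hφ, hcardE]
  have hJv : #(cover J) = k := by rw [hJ, card_cover_image hφ, hcoverE]
  have hJeq : J = edgesOf H := by
    by_contra hne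
    have h1 := hA.weight_ge J hJH hne (by omega)
    have h2 := (le_weight_iff (by linarith) J).1
      (show 2 - 1 / μ ≤ weight μ J by linarith)
    have h4 := hA.card_eq (by linarith)
    have h5 : (#(edgesOf H) : ℝ) = #(cover (edgesOf H)) := by exact_mod_cast h.antisymm hle
    have h6 : (#J : ℝ) < #(edgesOf H) := by
      exact_mod_cast card_lt_card (hJH.ssubset_of_ne hne)
    rw [hJc, hJv] at h2
    rw [hJc, h5] at h6
    rw [h5] at h4
    nlinarith [mul_pos (sub_pos.2 hμ) (sub_pos.2 h6)]
  have hbij : Function.Bijective φ := by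
    refine (Fintype.bijective_iff_injective_and_card _).2 ⟨hφ, ?_⟩
    rw [Fintype.card_fin, ← Nat.card_eq_fintype_card, ← hcov, ← hJeq, hJv]
  refine ⟨SimpleGraph.Iso.symm ⟨Equiv.ofBijective φ hbij, fun {x y} => ⟨fun hxy => ?_, fun hxy =>
    φ.toHom.map_adj hxy⟩⟩⟩
  have h1 : s(φ x, φ y) ∈ J := by rw [hJeq]; exact mem_edgesOf.2 hxy
  obtain ⟨f, hf, hfe⟩ := mem_image.1 h1
  have h2 : f = s(x, y) := Sym2.map.injective hφ hfe
  rw [h2] at hf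
  exact mem_edgesOf.1 hf

end Conditions

end KohayakawaKreuter

namespace KohayakawaKreuter

open Finset

/-! ### Reduction to two colours and conclusion -/

section Main

/-- Edges in R get colour i₀ and all others i₁. A copy in a third colour is impossible because each
graph has an edge. -/
lemma Arrows.arrowsPair {X : Type*} [DecidableEq X] {G : SimpleGraph X} {r : ℕ}
    {V : Fin r → Type*} {H : ∀ i : Fin r, SimpleGraph (V i)} (h : Arrows G H)
    (hne : ∀ i, H i ≠ ⊥) {i₀ i₁ : Fin r} (hi : i₀ ≠ i₁) {U₁ U₂ : Type*}
    {A₁ : Finset (Sym2 U₁)} {A₂ : Finset (Sym2 U₂)} {f₁ : U₁ → V i₀} {f₂ : U₂ → V i₁}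
    (hf₁ : Function.Injective f₁) (hf₂ : Function.Injective f₂)
    (hA₁ : ∀ e ∈ A₁, e.map f₁ ∈ (H i₀).edgeSet) (hA₂ : ∀ e ∈ A₂, e.map f₂ ∈ (H i₁).edgeSet) :
    ArrowsPair G A₁ A₂ := by
  intro R
  let c : G.EdgeLabeling (Fin r) := fun e => if (e : Sym2 X) ∈ R then i₀ else i₁
  have hc : ∀ i, ∀ e ∈ (c.labelGraph i).edgeSet, ∃ he : e ∈ G.edgeSet, c ⟨e, he⟩ = i := by
    intro i e he
    induction e with | _ x y
    exact (SimpleGraph.EdgeLabeling.labelGraph_adj x y).1 he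
  obtain ⟨i, ⟨φ⟩⟩ := h c
  have hφ : ∀ e ∈ (H i).edgeSet, e.map φ ∈ (c.labelGraph i).edgeSet := by
    intro e he
    induction e with | _ x y
    exact φ.toHom.map_adj he
  by_cases h0 : i = i₀
  · subst h0
    have key : ∀ e ∈ A₁.image (Sym2.map (φ ∘ f₁)), e ∈ G.edgeSet ∧ e ∈ R := by
      intro e he
      obtain ⟨f, hf, rfl⟩ := mem_image.1 he
      rw [← Sym2.map_map]
      obtain ⟨h1, h2⟩ := hc i _ (hφ _ (hA₁ f hf))
      refine ⟨h1, ?_⟩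
      by_contra hR
      simp only [c, if_neg hR] at h2
      exact hi h2.symm
    exact ⟨_, fun e he => (key e he).1, .inl ⟨⟨_, φ.injective.comp hf₁, rfl⟩,
      fun e he => (key e he).2⟩⟩
  by_cases h1 : i = i₁
  · subst h1
    have key : ∀ e ∈ A₂.image (Sym2.map (φ ∘ f₂)), e ∈ G.edgeSet ∧ e ∉ R := by
      intro e he
      obtain ⟨f, hf, rfl⟩ := mem_image.1 he
      rw [← Sym2.map_map]
      obtain ⟨h1, h2⟩ := hc i _ (hφ _ (hA₂ f hf))
      refine ⟨h1, fun hR => ?_⟩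
      simp only [c, if_pos hR] at h2
      exact hi h2
    exact ⟨_, fun e he => (key e he).1, .inr ⟨⟨_, φ.injective.comp hf₂, rfl⟩,
      Finset.disjoint_left.2 fun e he => (key e he).2⟩⟩
  · exfalso
    obtain ⟨e, he⟩ := SimpleGraph.edgeSet_nonempty.2 (hne i)
    obtain ⟨h2, h3⟩ := hc i _ (hφ e he)
    simp only [c] at h3
    split_ifs at h3 with hR
    · exact h0 h3.symm
    · exact h1 h3.symm

lemma map_val_mem_edgeSet {U : Type*} {H : SimpleGraph U} (G : H.Subgraph) {e : Sym2 G.verts}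
    (he : e ∈ G.coe.edgeSet) : e.map Subtype.val ∈ H.edgeSet := by
  refine G.edgeSet_subset ?_
  rw [← G.image_coe_edgeSet_coe]
  exact ⟨e, he, rfl⟩

end Main

end KohayakawaKreuter

theorem theorem1p6 {r : ℕ} (hr : 2 ≤ r) {V : Fin r → Type*} [∀ i, Finite (V i)]
    (H : ∀ i : Fin r, SimpleGraph (V i))
    (hne : ∀ i, H i ≠ ⊥)
    (hanti : ∀ i j : Fin r, i ≤ j → m2 (H j) ≤ m2 (H i))
    (hm2 : 1 < m2 (H ⟨1, by omega⟩))
    (hcases :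
      m2 (H ⟨0, by omega⟩) = m2 (H ⟨1, by omega⟩) ∨
      ∃ (H₁' : (H ⟨0, by omega⟩).Subgraph) (H₂' : (H ⟨1, by omega⟩).Subgraph),
        IsHeartOf H₁' H₂' ∧
        (3 ≤ H₂'.coe.chromaticNumber ∨
          2 < mDensity H₂'.coe ∨
          2 < ar H₂'.coe ∨
          (∃ a : ℕ, 3 ≤ a ∧ Nonempty (H₁'.coe ≃g (⊤ : SimpleGraph (Fin a)))) ∨
          (∃ a b : ℕ, 3 ≤ a ∧ 3 ≤ b ∧
            Nonempty (H₁'.coe ≃g completeBipartiteGraph (Fin a) (Fin b))) ∨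
          (∃ l : ℕ, (l : ℝ) < ar H₁'.coe ∧
            m2Pair (H ⟨0, by omega⟩) (H ⟨1, by omega⟩) ≤ (l : ℝ) + 1 / 2) ∨
          (∃ l : ℕ, (l : ℝ) < mDensity H₁'.coe ∧
            m2Pair (H ⟨0, by omega⟩) (H ⟨1, by omega⟩) ≤ (l : ℝ) + 1 ∧
            ¬ ∃ k : ℕ, 3 ≤ k ∧ Nonempty (H₂'.coe ≃g SimpleGraph.cycleGraph k)))) :
    ∃ b : ℝ, 0 < b ∧ ∀ p : ℕ → unitInterval,
      (∀ᶠ n : ℕ in atTop,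
        (p n : ℝ) ≤ b * (n : ℝ) ^ (-1 / m2Pair (H ⟨0, by omega⟩) (H ⟨1, by omega⟩))) →
      Tendsto
        (fun n : ℕ => SimpleGraph.binomialRandom (Fin n) (p n)
          {G : SimpleGraph (Fin n) | Arrows G H})
        atTop (𝓝 0) := by
  classical
  set i₀ : Fin r := ⟨0, by omega⟩ with hi₀
  set i₁ : Fin r := ⟨1, by omega⟩ with hi₁
  have hi : i₀ ≠ i₁ := by simp [hi₀, hi₁]
  have hle : m2 (H i₁) ≤ m2 (H i₀) := hanti i₀ i₁ (by simp [hi₀, hi₁, Fin.le_def])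
  have hred : ∀ {p : ℕ → unitInterval} {S T : ∀ n, Set (SimpleGraph (Fin n))},
      (∀ n, S n ⊆ T n) →
      Tendsto (fun n => SimpleGraph.binomialRandom (Fin n) (p n) (T n)) atTop (𝓝 0) →
      Tendsto (fun n => SimpleGraph.binomialRandom (Fin n) (p n) (S n)) atTop (𝓝 0) :=
    fun hST hT => tendsto_of_tendsto_of_tendsto_of_le_of_le tendsto_const_nhds hT
      (fun _ => zero_le) fun n => MeasureTheory.measure_mono (hST n)
  rcases hle.eq_or_lt with heq | hlt
  -- No heart is given in case (i); minimal sets attaining the 2-densities take its place.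
  · obtain ⟨F₁, hF₁, ε₁, hε₁, hb₁⟩ := exists_twoBalanced_subset (H := H i₀) (by linarith)
    obtain ⟨F₂, hF₂, ε₂, hε₂, hb₂⟩ := exists_twoBalanced_subset (H := H i₁) hm2
    rw [m2Pair_eq_of_eq (hne i₁) hm2 heq.symm]
    obtain ⟨b, hb, h⟩ := exists_threshold_of_copies (ε := min 1 (min ε₁ ε₂)) (by positivity)
      (min_le_left _ _) hm2 (hb₂.mono ((min_le_right _ _).trans (min_le_right _ _)))
      (.inl ⟨rfl, heq ▸ hb₁.mono ((min_le_right _ _).trans (min_le_left _ _))⟩)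
    refine ⟨b, hb, fun p hp => hred (fun n G hG => ?_) (h p hp)⟩
    exact Arrows.arrowsPair hG hne hi (f₁ := id) (f₂ := id) Function.injective_id
      Function.injective_id (fun e he => by simpa using hF₁ he) fun e he => by simpa using hF₂ he
  · obtain ⟨K₁, K₂, hheart, hc⟩ := hcases.resolve_left hlt.ne'
    have hμ : 1 < m2 K₂.coe := by rw [hheart.right]; exact hm2
    have hm : m2 K₂.coe < m2Pair K₁.coe K₂.coe := by
      rw [hheart.right, hheart.left_of_gt hlt]
      exact m2Pair_gt_of_lt (hne i₁) hm2 hlt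
    obtain ⟨hv₂, ε₂, hε₂, hb₂⟩ := hheart.heart.right.exists_twoBalanced hμ
    have hK₂ : K₂.coe ≠ ⊥ := by
      obtain ⟨e, he⟩ := hb₂.nonempty
      exact SimpleGraph.edgeSet_nonempty.1 ⟨e, mem_edgesOf.1 he⟩
    -- Strictness for the heart is not part of its definition: equality would make its pair density
    -- equal to μ, against `hm`.
    have hlt' : m2 K₂.coe < m2 K₁.coe := by
      refine lt_of_le_of_ne hheart.heart.le fun he => ?_
      rw [m2Pair_eq_of_eq hK₂ hμ he.symm] at hm
      exact hm.false
    obtain ⟨hv₁, ε₁, hε₁, hb₁⟩ := (hheart.heart.left_of_gt hlt').exists_pairBalanced hK₂ hμ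
      (by linarith)
    rw [← hheart.left_of_gt hlt] at hc ⊢
    have hcond : DensityCondition (m2Pair K₁.coe K₂.coe) (edgesOf K₁.coe) (edgesOf K₂.coe) := by
      rcases hc with hc | hc | hc | ⟨a, -, ⟨f⟩⟩ | ⟨a, b, ha, hb, ⟨f⟩⟩ | ⟨l, hl, hml⟩ |
        ⟨l, hl, hml, hcyc⟩
      · exact .not_bipartite (not_isBipartiteSet_of_chromaticNumber hc)
      -- Condition (iii) is subsumed by (iv), as e > 2v gives e > 2(v - 1).
      · obtain ⟨J, hJ, h⟩ := exists_subset_of_lt_mDensity (l := 2) (by exact_mod_cast hc)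
        exact .arboricity_blue ⟨J, hJ, by omega⟩
      · exact .arboricity_blue (exists_subset_of_lt_ar (l := 2) (by exact_mod_cast hc))
      · exact .clique (isCliqueIn_of_iso f)
      · rcases le_total a b with hab | hab
        · exact densityCondition_of_iso ha hab hv₁ f
        · exact densityCondition_of_iso hb hab hv₁ (f.trans (completeBipartiteSwap _ _))
      · exact .arboricity_red l (exists_subset_of_lt_ar hl) hml
      · refine .density_red l (exists_subset_of_lt_mDensity hl) hml ?_
        by_contra hcard
        exact hcyc (exists_cycleGraph_iso hb₂ hε₂ hμ hv₂ (not_lt.1 hcard))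
    obtain ⟨b, hb, h⟩ := exists_threshold_of_copies (ε := min 1 (min ε₁ ε₂)) (by positivity)
      (min_le_left _ _) hμ (hb₂.mono ((min_le_right _ _).trans (min_le_right _ _)))
      (.inr ⟨hm, hb₁.mono ((min_le_right _ _).trans (min_le_left _ _)), hcond⟩)
    refine ⟨b, hb, fun p hp => hred (fun n G hG => ?_) (h p hp)⟩
    exact Arrows.arrowsPair hG hne hi Subtype.val_injective Subtype.val_injective
      (fun e he => map_val_mem_edgeSet K₁ (mem_edgesOf.1 he))
      fun e he => map_val_mem_edgeSet K₂ (mem_edgesOf.1 he)
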